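/- Fix the following quantum algorithm. Let $U_\sim$ be a $D\times D$ unitary ($D\ge1$), $\beta>0$, and let $\varepsilon_{\rm prec},\varepsilon_{\rm fail}>0$. Put $n=\max(0,\lceil\log_2(1/\varepsilon_{\rm prec})\rceil)$ and $k=\lceil\log_2(1/\varepsilon_{\rm fail})\rceil$. The registers are two $D$-dimensional systems $A,B$, $k$ energy registers and one median register of $n$ qubits each, and one ancilla qubit; the basis state $|b\rangle$ of an $n$-qubit register, $0\le b<2^n$, encodes the energy $b/2^n$. *Preparation.* Start from $|\nu\rangle=D^{-1/2}\sum_a|a\rangle|a\rangle$ on $AB$, all other registers being $|0\cdots0\rangle$. With each of the $k$ energy registers run phase estimation of $U_\sim$ on $A$: Hadamard transform, controlled-$U_\sim^{2^j}$ controlled by the $j$-th qubit for $0\le j<n$ (realized by $2^j$ invocations of controlled-$U_\sim$), inverse quantum Fourier transform. Add the median of the $k$ estimates (the entry of index $\lfloor k/2\rfloor$, counted from $0$, of the sorted list) to the median register modulo $2^n$. Rotate the ancilla, controlled by the energy $E$ in the median register, by $$R_E=\begin{pmatrix}\sqrt{e^{-\beta E}}&-\sqrt{1-e^{-\beta E}}\\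 \sqrt{1-e^{-\beta E}}&\sqrt{e^{-\beta E}}\end{pmatrix}.$$ Call the resulting state $|\Psi\rangle$, and let $\Pi_0$ be the projector onto ancilla state $|0\rangle$. *Search.* In rounds $s=0,1,2,\dots$ choose $j$ uniformly at random among the non-negative integers smaller than $(6/5)^s$, prepare $|\Psi\rangle$ afresh, apply $G^j$ with $G=(2|\Psi\rangle\langle\Psi|-I)(I-2\Pi_0)$ (the reflection about $|\Psi\rangle$ being implemented by undoing and redoing the preparation), and measure the ancilla. If the outcome is $0$, stop and output the content of $A$; otherwise go to the next round. The complexity is the expected total number of invocations of controlled-$U_\sim$ and its inverse. **Theorem.** There are absolute constants $\kappa>0$ and $C>0$ with the following properties. (i) If $H$ is a Hermitian matrix with spectrum in $[0,\pi/4]$ and $V$ is a unitary with $\|e^{2\pi iH}-V\|\le\delta$ (operator norm), then there is a Hermitian $H'$ with $V=e^{2\pi iH'}$ and $\|H-H'\|\le\kappa\delta$. (ii) Let $D\ge1$, let $H$ be a Hermitian $D\times D$ matrix with spectrum in $[0,\pi/4]$, let $\beta>0$ and $\varepsilon\in(0,1)$, and let $Z_\beta=\operatorname{tr}e^{-\beta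 H}$ and $\rho_\beta=e^{-\beta H}/Z_\beta$. Let $U_\sim$ be a unitary with $\|e^{2\pi iH}-U_\sim\|\le\varepsilon_{\rm sim}$, and suppose $$\varepsilon_{\rm sim}\le\frac{\varepsilon^2}{8\beta\kappa},\qquad \varepsilon_{\rm prec}=\frac{\varepsilon}{32\beta},\qquad \varepsilon_{\rm fail}=e^{-\beta}\varepsilon^2 .$$ Then the algorithm stops with probability one, its output is a density matrix $\tilde\rho_\beta$ (the same for every successful measurement), and $$\tfrac12\operatorname{tr}\sqrt{XX^\dagger}\le\varepsilon\quad\text{for } X=\rho_\beta-\tilde\rho_\beta .$$ Its expected number of invocations of controlled-$U_\sim$ is at most $$C\,\sqrt{\frac{D}{Z_\beta}}\;\frac{\beta}{\varepsilon}\,\Bigl(\log\frac1\varepsilon+\beta\Bigr).$$ -/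

import Mathlib

open scoped Matrix ENNReal ComplexOrder

namespace GibbsPrep

noncomputable section

/-! ### Operators on a `D`-dimensional system -/

/-- The operator (spectral) norm of a matrix acting on the Hilbert space `ℂ^D`. -/
def opNorm {D : ℕ} (A : Matrix (Fin D) (Fin D) ℂ) : ℝ :=
  ‖Matrix.toEuclideanCLM (n := Fin D) (𝕜 := ℂ) A‖

/-- The time evolution `U = exp(2 π i H)`. -/
def evolution {D : ℕ} (H : Matrix (Fin D) (Fin D) ℂ) : Matrix (Fin D) (Fin D) ℂ :=
  NormedSpace.exp ((2 * (Real.pi : ℂ) * Complex.I) • H)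

/-- The partition function `Z_β = tr (exp (-β H))`. -/
def partitionFunction {D : ℕ} (H : Matrix (Fin D) (Fin D) ℂ) (β : ℝ) : ℝ :=
  (Matrix.trace (NormedSpace.exp ((-(β : ℂ)) • H))).re

/-- The thermal Gibbs state `ρ_β = exp (-β H) / Z_β`. -/
def gibbsState {D : ℕ} (H : Matrix (Fin D) (Fin D) ℂ) (β : ℝ) : Matrix (Fin D) (Fin D) ℂ :=
  ((partitionFunction H β : ℂ)⁻¹) • NormedSpace.exp ((-(β : ℂ)) • H)

/-- The trace distance `(1/2) tr √(X X†)` with `X = ρ - σ`; the trace of the square root of the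
positive semidefinite matrix `X X†` is the sum of the square roots of its eigenvalues. -/
def traceDist {D : ℕ} (ρ σ : Matrix (Fin D) (Fin D) ℂ) : ℝ :=
  (1 / 2) * ∑ i, Real.sqrt
    ((Matrix.isHermitian_mul_conjTranspose_self (ρ - σ)).eigenvalues i)

/-- A Hamiltonian whose energies lie in `[0, π/4]`. -/
def IsScaledHamiltonian {D : ℕ} (H : Matrix (Fin D) (Fin D) ℂ) : Prop :=
  ∃ hH : H.IsHermitian, ∀ a, hH.eigenvalues a ∈ Set.Icc (0 : ℝ) (Real.pi / 4)

/-- `κ` is a constant such that every unitary `V` which is `δ`-close to `exp(2 π i H)` is itself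
the evolution `exp(2 π i H')` of an effective Hamiltonian `H'` with `‖H - H'‖ ≤ κ δ`. -/
def IsSimulationConstant (κ : ℝ) : Prop :=
  ∀ (D : ℕ) (H V : Matrix (Fin D) (Fin D) ℂ) (δ : ℝ),
    IsScaledHamiltonian H → V ∈ Matrix.unitaryGroup (Fin D) ℂ →
    opNorm (evolution H - V) ≤ δ →
    ∃ H' : Matrix (Fin D) (Fin D) ℂ,
      H'.IsHermitian ∧ V = evolution H' ∧ opNorm (H - H') ≤ κ * δ

/-! ### The registers

The systems `A` and `B` have dimension `D`; there are `k` energy registers and one median register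
of `n` qubits each, and one ancilla qubit. The computational basis of an `n`-qubit register is
`Fin (2 ^ n)`, the `j`-th qubit being the `j`-th binary digit. -/

/-- Computational basis of all registers except `A`. -/
abbrev Env (D n k : ℕ) : Type :=
  Fin D × (Fin k → Fin (2 ^ n)) × Fin (2 ^ n) × Fin 2

/-- Computational basis of the whole machine. -/
abbrev Basis (D n k : ℕ) : Type := Fin D × Env D n k

section Registers

variable {D n k : ℕ}

/-- content of `B` -/
def regB (x : Basis D n k) : Fin D := x.2.1

/-- contents of the energy registers -/
def energy (x : Basis D n k) : Fin k → Fin (2 ^ n) := x.2.2.1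

/-- content of the median register -/
def med (x : Basis D n k) : Fin (2 ^ n) := x.2.2.2.1

/-- content of the ancilla -/
def anc (x : Basis D n k) : Fin 2 := x.2.2.2.2

/-- The partial trace over everything except `A`. -/
def partialTrace (M : Matrix (Basis D n k) (Basis D n k) ℂ) : Matrix (Fin D) (Fin D) ℂ :=
  fun a a' => ∑ r : Env D n k, M (a, r) (a', r)

/-- The initial state: the maximally entangled state `|ν⟩ = D^{-1/2} ∑ |a⟩|a⟩` on `AB`, and
all other registers in `|0…0⟩`. -/
def start (D n k : ℕ) : Basis D n k → ℂ :=
  fun x => if x.1 = regB x ∧ (∀ l, energy x l = 0) ∧ med x = 0 ∧ anc x = 0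
    then ((1 / Real.sqrt (D : ℝ) : ℝ) : ℂ) else 0

/-- The projector `Π₀` onto the subspace in which the ancilla is in `|0⟩`. -/
def projZero (D n k : ℕ) : Matrix (Basis D n k) (Basis D n k) ℂ :=
  Matrix.diagonal fun x => if anc x = 0 then 1 else 0

/-! ### The elementary operations -/

/-- The operation `W` applied to the `l`-th energy register. -/
def onEnergy (l : Fin k) (W : Matrix (Fin (2 ^ n)) (Fin (2 ^ n)) ℂ) :
    Matrix (Basis D n k) (Basis D n k) ℂ :=
  fun x y =>
    if x.1 = y.1 ∧ regB x = regB y ∧ med x = med y ∧ anc x = anc y ∧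
        (∀ l', l' ≠ l → energy x l' = energy y l')
    then W (energy x l) (energy y l) else 0

/-- Controlled-`U`, controlled by the `j`-th qubit of the `l`-th energy register, with target
`A`. -/
def controlledU (U : Matrix (Fin D) (Fin D) ℂ) (l : Fin k) (j : Fin n) :
    Matrix (Basis D n k) (Basis D n k) ℂ :=
  fun x y =>
    if x.2 = y.2 then
      if (energy x l).val.testBit j.val then U x.1 y.1 else (1 : Matrix _ _ ℂ) x.1 y.1
    else 0

/-- The Hadamard transform of each of `n` qubits. -/
def hadamard (n : ℕ) : Matrix (Fin (2 ^ n)) (Fin (2 ^ n)) ℂ :=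
  fun b c => ∏ j : Fin n,
    (if b.val.testBit j.val ∧ c.val.testBit j.val then (-1 : ℂ) else 1) /
      ((Real.sqrt 2 : ℝ) : ℂ)

/-- The inverse quantum Fourier transform on `n` qubits. -/
def inverseQFT (n : ℕ) : Matrix (Fin (2 ^ n)) (Fin (2 ^ n)) ℂ :=
  fun b c => Complex.exp (-(2 * (Real.pi : ℂ) * Complex.I * (b.val : ℂ) * (c.val : ℂ)) / 2 ^ n) /
    ((Real.sqrt (2 ^ n) : ℝ) : ℂ)

/-- The median of `b₁, …, b_k`: the entry of index `⌊k/2⌋` (counted from `0`) of the list sorted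
in increasing order. -/
def median (b : Fin k → Fin (2 ^ n)) : Fin (2 ^ n) :=
  if h : 0 < k then b (Tuple.sort b ⟨k / 2, Nat.div_lt_self h one_lt_two⟩) else 0

/-- The reversible median circuit `|b₁…b_k⟩|m⟩ ↦ |b₁…b_k⟩|m + median(b₁,…,b_k) mod 2ⁿ⟩`. -/
def medianGate (D n k : ℕ) : Matrix (Basis D n k) (Basis D n k) ℂ :=
  fun x y =>
    if x.1 = y.1 ∧ regB x = regB y ∧ energy x = energy y ∧ anc x = anc y ∧
        med x = med y + median (energy y)
    then 1 else 0

/-- The rotation `R_E` of the ancilla. -/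
def rotation (β E : ℝ) : Matrix (Fin 2) (Fin 2) ℝ :=
  !![Real.sqrt (Real.exp (-β * E)), -Real.sqrt (1 - Real.exp (-β * E));
     Real.sqrt (1 - Real.exp (-β * E)), Real.sqrt (Real.exp (-β * E))]

/-- The controlled rotation `∑_E |E⟩⟨E| ⊗ R_E`, controlled by the median register, whose content
`m` encodes the energy `m / 2ⁿ`. -/
def rotationGate (D n k : ℕ) (β : ℝ) : Matrix (Basis D n k) (Basis D n k) ℂ :=
  fun x y =>
    if x.1 = y.1 ∧ regB x = regB y ∧ energy x = energy y ∧ med x = med y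
    then ((rotation β ((med x).val / 2 ^ n) (anc x) (anc y) : ℝ) : ℂ) else 0

/-! ### Circuits with access to controlled-`U` -/

/-- A gate is either an operation that does not involve `U`, or an invocation of
controlled-`U` or of its inverse. -/
inductive Gate (D n k : ℕ) : Type
  | free (W : Matrix (Basis D n k) (Basis D n k) ℂ)
  | query (l : Fin k) (j : Fin n)
  | queryInv (l : Fin k) (j : Fin n)

/-- The operation performed by a gate. -/
def Gate.eval (U : Matrix (Fin D) (Fin D) ℂ) :
    Gate D n k → Matrix (Basis D n k) (Basis D n k) ℂ
  | .free W => W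
  | .query l j => controlledU U l j
  | .queryInv l j => (controlledU U l j)ᴴ

/-- The number of invocations of controlled-`U` (or its inverse) made by a gate. -/
def Gate.cost : Gate D n k → ℕ
  | .free _ => 0
  | .query _ _ => 1
  | .queryInv _ _ => 1

/-- The inverse of a (unitary) gate. -/
def Gate.inv : Gate D n k → Gate D n k
  | .free W => .free Wᴴ
  | .query l j => .queryInv l j
  | .queryInv l j => .query l j

/-- A circuit is a list of gates; the head of the list is applied first. -/
abbrev Circuit (D n k : ℕ) : Type := List (Gate D n k)

/-- The operation performed by a circuit. -/
def Circuit.eval (U : Matrix (Fin D) (Fin D) ℂ) :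
    Circuit D n k → Matrix (Basis D n k) (Basis D n k) ℂ
  | [] => 1
  | g :: c => Circuit.eval U c * g.eval U

/-- The number of invocations of controlled-`U` made by a circuit. -/
def Circuit.cost (c : Circuit D n k) : ℕ := (c.map Gate.cost).sum

/-- The inverse circuit. -/
def Circuit.inverse (c : Circuit D n k) : Circuit D n k := (c.map Gate.inv).reverse

/-- Phase estimation with the `l`-th energy register: Hadamard transform, controlled-`U^(2^j)`
controlled by the `j`-th qubit for every `j` (each one being `2^j` invocations of controlled-`U`),
and the inverse quantum Fourier transform. -/
def phaseEstimation (l : Fin k) : Circuit D n k :=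
  [Gate.free (onEnergy l (hadamard n))] ++
    (List.finRange n).flatMap (fun j => List.replicate (2 ^ j.val) (Gate.query l j)) ++
    [Gate.free (onEnergy l (inverseQFT n))]

/-- Steps I and II: phase estimation with each of the `k` energy registers, median, rotation. -/
def preparation (D n k : ℕ) (β : ℝ) : Circuit D n k :=
  (List.finRange k).flatMap phaseEstimation ++
    [Gate.free (medianGate D n k), Gate.free (rotationGate D n k β)]

/-- The Grover iteration `(2|Ψ⟩⟨Ψ| - I)(I - 2Π₀)` where `|Ψ⟩ = V |start⟩` and `V` is the
preparation circuit; the reflection about `|Ψ⟩` is `V (2|start⟩⟨start| - I) V†`. -/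
def groverIteration (D n k : ℕ) (β : ℝ) : Circuit D n k :=
  [Gate.free (1 - (2 : ℂ) • projZero D n k)] ++
    Circuit.inverse (preparation D n k β) ++
    [Gate.free ((2 : ℂ) • Matrix.vecMulVec (start D n k) (star (start D n k)) - 1)] ++
    preparation D n k β

/-- One attempt: prepare `|Ψ⟩` from the initial state and apply `j` Grover iterations. -/
def attempt (D n k : ℕ) (β : ℝ) (j : ℕ) : Circuit D n k :=
  preparation D n k β ++ (List.replicate j (groverIteration D n k β)).flatten

end Registers

/-! ### The algorithm

Search with unknown overlap, in rounds `s = 0, 1, 2, …`: in round `s` a number `j` of Grover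
iterations is chosen uniformly at random among the non-negative integers smaller than `(6/5)^s`,
the attempt with `j` iterations is run on fresh registers, and the ancilla is measured. If the
outcome is `0`, the algorithm stops and outputs the content of `A`; otherwise it goes on to the
next round. -/

section Algorithm

variable {D : ℕ} (n k : ℕ) (U : Matrix (Fin D) (Fin D) ℂ) (β : ℝ)

/-- The state before the measurement in an attempt with `j` Grover iterations. -/
def attemptState (j : ℕ) : Basis D n k → ℂ :=
  Circuit.eval U (attempt D n k β j) *ᵥ start D n k

/-- The probability that the measurement in an attempt with `j` iterations succeeds. -/
def successProb (j : ℕ) : ℝ :=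
  ∑ x, ‖(projZero D n k *ᵥ attemptState n k U β j) x‖ ^ 2

/-- The content of `A` after a successful attempt with `j` iterations, not normalized, i.e.
multiplied by the probability of success. -/
def attemptOutput (j : ℕ) : Matrix (Fin D) (Fin D) ℂ :=
  partialTrace (projZero D n k *
    Matrix.vecMulVec (attemptState n k U β j) (star (attemptState n k U β j)) * projZero D n k)

/-- The number of non-negative integers smaller than `(6/5)^s`. -/
def roundSize (s : ℕ) : ℕ := ⌈((6 : ℝ) / 5) ^ s⌉₊

/-- The probability that round `s` succeeds, if it is reached. -/
def roundSuccess (s : ℕ) : ℝ :=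
  (∑ j ∈ Finset.range (roundSize s), successProb n k U β j) / roundSize s

/-- The probability that round `s` is reached. -/
def reachProb (s : ℕ) : ℝ :=
  ∏ t ∈ Finset.range s, (1 - roundSuccess n k U β t)

/-- The probability that the algorithm stops in round `s`. -/
def stopProb (s : ℕ) : ℝ := reachProb n k U β s * roundSuccess n k U β s

/-- The contribution of round `s` to the output density matrix. -/
def roundOutput (s : ℕ) : Matrix (Fin D) (Fin D) ℂ :=
  ((reachProb n k U β s / roundSize s : ℝ) : ℂ) •
    ∑ j ∈ Finset.range (roundSize s), attemptOutput n k U β j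

/-- The expected total number of invocations of controlled-`U`. -/
def expectedQueries (D n k : ℕ) (U : Matrix (Fin D) (Fin D) ℂ) (β : ℝ) : ℝ≥0∞ :=
  ∑' s : ℕ, ENNReal.ofReal (reachProb n k U β s *
    ((∑ j ∈ Finset.range (roundSize s), (Circuit.cost (attempt D n k β j) : ℝ)) / roundSize s))

/-- The density matrix `ρ` is the output of the algorithm: the algorithm stops with
probability one, the output averaged over all its runs is `ρ`, and so is the output conditioned on
any particular successful attempt. -/
structure IsOutput (ρ : Matrix (Fin D) (Fin D) ℂ) : Prop where
  posSemidef : ρ.PosSemidef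
  trace_eq_one : ρ.trace = 1
  stops : HasSum (stopProb n k U β) 1
  average : HasSum (roundOutput n k U β) ρ
  each : ∀ j, attemptOutput n k U β j = ((successProb n k U β j : ℝ) : ℂ) • ρ

end Algorithm

/-- The number `⌈log₂ (1/ε_prec)⌉` of qubits of an energy register (`0` if this is negative). -/
def precisionQubits (εprec : ℝ) : ℕ := ⌈Real.logb 2 (1 / εprec)⌉₊

/-- The number `⌈log₂ (1/ε_fail)⌉` of repetitions of phase estimation. -/
def repetitions (εfail : ℝ) : ℕ := ⌈Real.logb 2 (1 / εfail)⌉₊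

end

end GibbsPrep

/-! Part (i) is a Lipschitz bound for the logarithm of a unitary. The phases of e^{2πiH} lie on an
arc of length π²/2 < 2π; rotated so that it is centred at 1, the arc keeps a fixed distance from -1.
Eigenvalues of a perturbed unitary stay within δ of the old ones
(`exists_norm_sub_le_of_norm_udiag_sub_le`), so for small δ both spectra avoid -1. Along the chords
1 + t(U - 1) and 1 + t(V - 1) the derivatives of the logarithms differ by resolvent · (U - V) ·
resolvent, with bounded resolvents (`norm_udiag_sub_le_of_exp`). For large δ any choice of phases
will do.

For part (ii), part (i) turns U_~ into an exact evolution e^{2πiH'} with H' = Q diag(θ) Q†. The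
maximally entangled state is an equal superposition of |v_j⟩|v̄_j⟩ over the eigenvectors of H',
phase estimation leaves each v_j untouched, and tracing out B removes the interference. Hence the
accepted state is exactly proportional to ∑ w_j |v_j⟩⟨v_j|, where w_j = `weight` is the mean
Boltzmann factor of the median estimate (`partialTrace_accepted`). Amplitude amplification only
rescales the accepted branch, so every successful attempt yields the same state.

Two errors remain. Passing from the Gibbs state of H to that of H' costs √(βη/2), where η bounds ‖H
- H'‖: the Hilbert–Schmidt distance of the square roots is controlled by a symmetrized relative
entropy (`sum_overlap_sq_sub_le`). Passing from the Gibbs weights e^{-βθ_j} to w_j costs 1 - L/U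
when w_j / e^{-βθ_j} lies in [L, U] (`sum_abs_normalized_sub_le`). The bounds L, U come from tail
estimates for one phase estimation and a Chernoff bound for the median. The two directions of error
are not alike: an underestimate can raise the factor to 1 and must be suppressed by e^{-β}, while an
overestimate can lower it only to e^{-β}.

The cost follows from success probabilities sin²((2j+1)φ) with sin²φ = W/D, W = ∑ w_j: once (6/5)^s
≥ 1/sin φ each round succeeds with probability at least 1/4, the expected work is a convergent
geometric sum, and W is comparable to Z_β by a Peierls–Bogoliubov inequality. -/

namespace GibbsPrep

/-! ### Unitarily diagonalized matrices -/

section Diagonalization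

variable {ι : Type*} [Fintype ι] [DecidableEq ι]

/-- The matrix `P diag(d) P†`. -/
noncomputable def udiag (P : Matrix ι ι ℂ) (d : ι → ℂ) : Matrix ι ι ℂ :=
  P * Matrix.diagonal d * Pᴴ

theorem conjTranspose_mul_self_of_mem {P : Matrix ι ι ℂ} (hP : P ∈ Matrix.unitaryGroup ι ℂ) :
    Pᴴ * P = 1 := (Matrix.mem_unitaryGroup_iff'.1 hP)

theorem mul_conjTranspose_self_of_mem {P : Matrix ι ι ℂ} (hP : P ∈ Matrix.unitaryGroup ι ℂ) :
    P * Pᴴ = 1 := (Matrix.mem_unitaryGroup_iff.1 hP)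

theorem udiag_apply (P : Matrix ι ι ℂ) (d : ι → ℂ) (a b : ι) :
    udiag P d a b = ∑ i, d i * (P a i * star (P b i)) := by
  rw [udiag, Matrix.mul_apply]
  simp only [Matrix.mul_diagonal, Matrix.conjTranspose_apply]
  exact Finset.sum_congr rfl fun i _ => by ring

theorem udiag_add (P : Matrix ι ι ℂ) (d e : ι → ℂ) :
    udiag P (d + e) = udiag P d + udiag P e := by
  rw [udiag, show Matrix.diagonal (d + e) = Matrix.diagonal d + Matrix.diagonal e from
    (Matrix.diagonal_add d e).symm, mul_add, add_mul]; rfl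

theorem udiag_smul (P : Matrix ι ι ℂ) (c : ℂ) (d : ι → ℂ) :
    udiag P (c • d) = c • udiag P d := by
  simp [udiag, Matrix.diagonal_smul]

theorem udiag_neg (P : Matrix ι ι ℂ) (d : ι → ℂ) : udiag P (-d) = -udiag P d := by
  rw [← neg_one_smul ℂ d, udiag_smul, neg_one_smul]

theorem udiag_sub (P : Matrix ι ι ℂ) (d e : ι → ℂ) :
    udiag P (d - e) = udiag P d - udiag P e := by
  rw [sub_eq_add_neg, udiag_add, udiag_neg, sub_eq_add_neg]

theorem udiag_conjTranspose (P : Matrix ι ι ℂ) (d : ι → ℂ) :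
    (udiag P d)ᴴ = udiag P (star d) := by
  simp [udiag, Matrix.conjTranspose_mul, Matrix.diagonal_conjTranspose, mul_assoc]

theorem udiag_mul {P : Matrix ι ι ℂ} (hP : P ∈ Matrix.unitaryGroup ι ℂ) (d e : ι → ℂ) :
    udiag P d * udiag P e = udiag P (d * e) := by
  calc udiag P d * udiag P e
      = P * Matrix.diagonal d * (Pᴴ * P) * Matrix.diagonal e * Pᴴ := by
        simp only [udiag, mul_assoc]
    _ = P * (Matrix.diagonal d * Matrix.diagonal e) * Pᴴ := by
        rw [conjTranspose_mul_self_of_mem hP]; simp only [mul_one, mul_assoc]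
    _ = _ := by rw [Matrix.diagonal_mul_diagonal]; rfl

theorem udiag_one {P : Matrix ι ι ℂ} (hP : P ∈ Matrix.unitaryGroup ι ℂ) : udiag P 1 = 1 := by
  simp [udiag, mul_conjTranspose_self_of_mem hP]

theorem udiag_const {P : Matrix ι ι ℂ} (hP : P ∈ Matrix.unitaryGroup ι ℂ) (c : ℂ) :
    udiag P (fun _ => c) = c • 1 := by
  rw [← udiag_one hP, ← udiag_smul]; congr 1; ext; simp

theorem udiag_trace {P : Matrix ι ι ℂ} (hP : P ∈ Matrix.unitaryGroup ι ℂ) (d : ι → ℂ) :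
    (udiag P d).trace = ∑ i, d i := by
  rw [udiag, Matrix.trace_mul_comm, ← mul_assoc, conjTranspose_mul_self_of_mem hP, one_mul,
    Matrix.trace_diagonal]

theorem udiag_mem_unitaryGroup {P : Matrix ι ι ℂ} (hP : P ∈ Matrix.unitaryGroup ι ℂ) {d : ι → ℂ}
    (hd : ∀ i, ‖d i‖ = 1) : udiag P d ∈ Matrix.unitaryGroup ι ℂ := by
  rw [Matrix.mem_unitaryGroup_iff, Matrix.star_eq_conjTranspose, udiag_conjTranspose,
    udiag_mul hP, ← udiag_one hP]
  congr 1
  ext i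
  simp [Complex.mul_conj, Complex.normSq_eq_norm_sq, hd i]

theorem udiag_isHermitian (P : Matrix ι ι ℂ) (d : ι → ℝ) :
    (udiag P fun i => (d i : ℂ)).IsHermitian := by
  rw [Matrix.IsHermitian, udiag_conjTranspose]
  congr 1; ext i; simp

theorem exp_udiag {P : Matrix ι ι ℂ} (hP : P ∈ Matrix.unitaryGroup ι ℂ) (d : ι → ℂ) :
    NormedSpace.exp (udiag P d) = udiag P fun i => Complex.exp (d i) := by
  have hinv : P⁻¹ = Pᴴ := Matrix.inv_eq_right_inv (mul_conjTranspose_self_of_mem hP)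
  have hu : IsUnit P := IsUnit.of_mul_eq_one _ (mul_conjTranspose_self_of_mem hP)
  rw [udiag, ← hinv, Matrix.exp_conj _ _ hu, Matrix.exp_diagonal, hinv, udiag]
  congr 3
  ext i
  rw [Pi.coe_exp, Complex.exp_eq_exp_ℂ]

theorem eq_udiag_eigenvalues {A : Matrix ι ι ℂ} (hA : A.IsHermitian) :
    A = udiag (hA.eigenvectorUnitary : Matrix ι ι ℂ) fun i => (hA.eigenvalues i : ℂ) := by
  conv_lhs => rw [hA.spectral_theorem]
  rfl

section Norm

open scoped Matrix.Norms.L2Operator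

theorem norm_le_one_of_mem_unitaryGroup {P : Matrix ι ι ℂ} (hP : P ∈ Matrix.unitaryGroup ι ℂ) :
    ‖P‖ ≤ 1 := by
  have h := CStarRing.norm_star_mul_self (x := P)
  rw [Matrix.star_eq_conjTranspose, conjTranspose_mul_self_of_mem hP] at h
  -- Only an inequality: over an empty index type the identity has norm 0.
  have h1 : ‖(1 : Matrix ι ι ℂ)‖ ≤ 1 := by
    rw [← Matrix.diagonal_one, Matrix.l2_opNorm_diagonal]
    exact (pi_norm_le_iff_of_nonneg zero_le_one).2 fun i => by simp
  nlinarith [norm_nonneg P]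

theorem norm_udiag_le {P : Matrix ι ι ℂ} (hP : P ∈ Matrix.unitaryGroup ι ℂ) {d : ι → ℂ} {c : ℝ}
    (hc : 0 ≤ c) (hd : ∀ i, ‖d i‖ ≤ c) : ‖udiag P d‖ ≤ c := by
  have h1 := norm_le_one_of_mem_unitaryGroup hP
  have h2 : ‖Pᴴ‖ ≤ 1 := by rwa [Matrix.l2_opNorm_conjTranspose]
  have h3 : ‖Matrix.diagonal d‖ ≤ c := by
    rw [Matrix.l2_opNorm_diagonal]; exact (pi_norm_le_iff_of_nonneg hc).2 hd
  calc ‖udiag P d‖ ≤ ‖P‖ * ‖Matrix.diagonal d‖ * ‖Pᴴ‖ :=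
        (norm_mul_le _ _).trans (by gcongr; exact norm_mul_le _ _)
    _ ≤ 1 * c * 1 := by gcongr
    _ = c := by ring

/-- Every unitary matrix is unitarily diagonalizable with phases in `(-π, π]`. -/
theorem exists_udiag_of_mem_unitaryGroup {V : Matrix ι ι ℂ} (hV : V ∈ Matrix.unitaryGroup ι ℂ) :
    ∃ Q ∈ Matrix.unitaryGroup ι ℂ, ∃ θ : ι → ℝ, (∀ i, |θ i| ≤ Real.pi) ∧
      V = udiag Q fun i => Complex.exp (θ i * Complex.I) := by
  have hVu : V ∈ unitary (Matrix ι ι ℂ) := hV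
  have hn : IsStarNormal V := by
    constructor
    rw [commute_iff_eq, Matrix.star_eq_conjTranspose, conjTranspose_mul_self_of_mem hV,
      mul_conjTranspose_self_of_mem hV]
  have hfin : (spectrum ℂ V).Finite := Matrix.finite_spectrum V
  -- The spectrum is finite, so the discontinuous function arg is continuous on it and the
  -- functional calculus applies.
  have hc : ContinuousOn (fun z : ℂ => (z.arg : ℂ)) (spectrum ℂ V) := hfin.continuousOn _
  obtain ⟨K, hK⟩ : ∃ K, K = cfc (fun z : ℂ => (z.arg : ℂ)) V := ⟨_, rfl⟩
  have hKs : K.IsHermitian := by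
    have := IsSelfAdjoint.cfc_arg V
    rw [hK]; exact this
  have hexp : NormedSpace.exp (Complex.I • K) = V := by
    have hKn : IsStarNormal K := by
      rw [hK]; infer_instance
    rw [hK, ← CFC.exp_eq_normedSpace_exp (𝕜 := ℂ), ← cfc_comp_smul .., ← cfc_comp' ..]
    · conv_rhs => rw [← cfc_id' ℂ V]
      refine cfc_congr fun y hy ↦ ?_
      have hy₁ : ‖y‖ = 1 := spectrum.norm_eq_one_of_unitary hVu hy
      have : Complex.I * y.arg = Complex.log y :=
        Complex.ext (by simp [Complex.log_re, hy₁]) (by simp [Complex.log_im])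
      have hy0 : y ≠ 0 := by rintro rfl; simp at hy₁
      simpa [← Complex.exp_eq_exp_ℂ, this] using Complex.exp_log hy0
  -- Taking the argument of e^{iλ} instead of the eigenvalue λ itself gives the bound by π without
  -- locating the eigenvalues of K.
  refine ⟨hKs.eigenvectorUnitary, hKs.eigenvectorUnitary.2,
    fun i => (Complex.exp (hKs.eigenvalues i * Complex.I)).arg,
    fun i => Complex.abs_arg_le_pi _, ?_⟩
  conv_lhs => rw [← hexp, eq_udiag_eigenvalues hKs, ← udiag_smul,
    exp_udiag hKs.eigenvectorUnitary.2]
  congr 1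
  ext i
  have := Complex.norm_mul_exp_arg_mul_I (Complex.exp (hKs.eigenvalues i * Complex.I))
  rw [Complex.norm_exp_ofReal_mul_I] at this
  simp only [Complex.ofReal_one, one_mul] at this
  rw [this]
  simp [mul_comm]

end Norm

end Diagonalization

/-! ### The logarithm of a unitary is Lipschitz away from `-1` -/

section Logarithm

theorem sq_norm_segment_exp (φ t : ℝ) :
    ‖1 + (t : ℂ) * (Complex.exp (φ * Complex.I) - 1)‖ ^ 2
      = 1 - 2 * t * (1 - t) * (1 - Real.cos φ) := by
  rw [← Complex.normSq_eq_norm_sq, Complex.normSq_apply]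
  simp [Complex.exp_ofReal_mul_I_re, Complex.exp_ofReal_mul_I_im]
  linear_combination t ^ 2 * Real.sin_sq_add_cos_sq φ

/-- The line through 1 and e^{iφ} is closest to 0 at the midpoint t = 1/2, where the squared modulus
is (1 + cos φ)/2. -/
theorem le_norm_segment_exp {φ c : ℝ} (t : ℝ)
    (hφ : c ^ 2 ≤ (1 + Real.cos φ) / 2) :
    c ≤ ‖1 + (t : ℂ) * (Complex.exp (φ * Complex.I) - 1)‖ := by
  refine le_of_pow_le_pow_left₀ two_ne_zero (norm_nonneg _) ?_
  rw [sq_norm_segment_exp]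
  have h1 := Real.cos_le_one φ
  nlinarith [sq_nonneg (2 * t - 1), mul_nonneg (sq_nonneg (2 * t - 1)) (sub_nonneg.2 h1)]

theorem abs_lt_pi_of_sq_le {φ c : ℝ} (hc : 0 < c) (h : c ^ 2 ≤ (1 + Real.cos φ) / 2)
    (hφ : |φ| ≤ Real.pi) : |φ| < Real.pi := by
  refine lt_of_le_of_ne hφ fun h' => ?_
  have : Real.cos φ = -1 := by rw [← Real.cos_abs, h', Real.cos_pi]
  rw [this] at h
  nlinarith [pow_pos hc 2]

theorem log_exp_mul_I {φ : ℝ} (hφ : |φ| < Real.pi) :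
    Complex.log (Complex.exp (φ * Complex.I)) = φ * Complex.I := by
  rw [abs_lt] at hφ
  rw [Complex.log_exp] <;> simp <;> linarith

theorem segment_exp_mem_slitPlane {φ t : ℝ} (hφ : |φ| < Real.pi) (ht : t ∈ Set.Icc (0 : ℝ) 1) :
    1 + (t : ℂ) * (Complex.exp (φ * Complex.I) - 1) ∈ Complex.slitPlane := by
  have hμ : Complex.exp (φ * Complex.I) ∈ Complex.slitPlane := by
    rw [Complex.mem_slitPlane_iff_arg]
    refine ⟨?_, Complex.exp_ne_zero _⟩
    have h := congrArg Complex.im (log_exp_mul_I hφ)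
    rw [Complex.log_im] at h
    rw [h]
    simp
    rw [abs_lt] at hφ
    exact hφ.2.ne
  have := Complex.starConvex_one_slitPlane hμ (sub_nonneg.2 ht.2) ht.1 (by ring)
  convert this using 1
  simp
  ring

variable {ι : Type*} [Fintype ι] [DecidableEq ι]

/-- The map `d ↦ P diag(d) P†` as a continuous linear map. -/
noncomputable def udiagLin (P : Matrix ι ι ℂ) : (ι → ℂ) →ₗ[ℝ] Matrix ι ι ℂ where
  toFun := udiag P
  map_add' := udiag_add P
  map_smul' c d := udiag_smul P c d

open scoped Matrix.Norms.L2Operator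

theorem hasDerivAt_udiag (P : Matrix ι ι ℂ) {f : ℝ → ι → ℂ} {f' : ι → ℂ} {t : ℝ}
    (h : ∀ i, HasDerivAt (fun s => f s i) (f' i) t) :
    HasDerivAt (fun s => udiag P (f s)) (udiag P f') t := by
  have h1 : HasDerivAt f f' t := hasDerivAt_pi.2 h
  exact ((LinearMap.toContinuousLinearMap (udiagLin P)).hasFDerivAt.comp_hasDerivAt t h1)

/-- Along the chord from 1 to a unitary the eigenbasis does not move, so the matrix logarithm is
differentiated eigenvalue by eigenvalue. The chord stays in the slit plane because that plane is
star-shaped about 1. -/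
theorem hasDerivAt_udiag_log (P : Matrix ι ι ℂ) {φ : ι → ℝ} (hφ : ∀ i, |φ i| < Real.pi) {t : ℝ}
    (ht : t ∈ Set.Icc (0 : ℝ) 1) :
    HasDerivAt (fun s : ℝ => udiag P fun i =>
        Complex.log (1 + (s : ℂ) * (Complex.exp (φ i * Complex.I) - 1)))
      (udiag P fun i => (Complex.exp (φ i * Complex.I) - 1) /
        (1 + (t : ℂ) * (Complex.exp (φ i * Complex.I) - 1))) t := by
  refine hasDerivAt_udiag P fun i => ?_
  have h1 : HasDerivAt (fun s : ℝ => 1 + (s : ℂ) * (Complex.exp (φ i * Complex.I) - 1))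
      (Complex.exp (φ i * Complex.I) - 1) t := by
    have := ((Complex.ofRealCLM.hasDerivAt (x := t)).mul_const
      (Complex.exp (φ i * Complex.I) - 1)).const_add 1
    simpa using this
  exact h1.clog_real (segment_exp_mem_slitPlane (hφ i) ht)

/-- The resolvent identity behind the Lipschitz bound of the logarithm. -/
theorem udiag_log_deriv_sub {P Q : Matrix ι ι ℂ} (hP : P ∈ Matrix.unitaryGroup ι ℂ)
    (hQ : Q ∈ Matrix.unitaryGroup ι ℂ) (t : ℂ) {μ ν : ι → ℂ}
    (hμ : ∀ i, 1 + t * (μ i - 1) ≠ 0) (hν : ∀ i, 1 + t * (ν i - 1) ≠ 0) :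
    (udiag P fun i => (μ i - 1) / (1 + t * (μ i - 1))) -
        (udiag Q fun i => (ν i - 1) / (1 + t * (ν i - 1)))
      = (udiag P fun i => (1 + t * (μ i - 1))⁻¹) * (udiag P μ - udiag Q ν) *
        (udiag Q fun i => (1 + t * (ν i - 1))⁻¹) := by
  have e1 : (udiag P fun i => (1 + t * (μ i - 1))⁻¹) * (1 + t • (udiag P μ - 1)) = 1 := by
    rw [← udiag_one hP, ← udiag_sub, ← udiag_smul, ← udiag_add, udiag_mul hP]
    congr 1; ext i; simp [inv_mul_cancel₀ (hμ i)]
  have e2 : (1 + t • (udiag Q ν - 1)) * (udiag Q fun i => (1 + t * (ν i - 1))⁻¹) = 1 := by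
    rw [← udiag_one hQ, ← udiag_sub, ← udiag_smul, ← udiag_add, udiag_mul hQ]
    congr 1; ext i; simp [mul_inv_cancel₀ (hν i)]
  have e3 : (udiag P fun i => (μ i - 1) / (1 + t * (μ i - 1)))
      = (udiag P fun i => (1 + t * (μ i - 1))⁻¹) * (udiag P μ - 1) := by
    rw [← udiag_one hP, ← udiag_sub, udiag_mul hP]
    congr 1; ext i; simp [div_eq_inv_mul]
  have e4 : (udiag Q fun i => (ν i - 1) / (1 + t * (ν i - 1)))
      = (udiag Q ν - 1) * (udiag Q fun i => (1 + t * (ν i - 1))⁻¹) := by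
    rw [← udiag_one hQ, ← udiag_sub, udiag_mul hQ]
    congr 1
  generalize (udiag P fun i => (1 + t * (μ i - 1))⁻¹) = A at *
  generalize (udiag Q fun i => (1 + t * (ν i - 1))⁻¹) = B at *
  generalize udiag P μ = U at *
  generalize udiag Q ν = V at *
  rw [e3, e4]
  calc A * (U - 1) - (V - 1) * B
      = A * (U - 1) * ((1 + t • (V - 1)) * B) - (A * (1 + t • (U - 1))) * ((V - 1) * B) := by
        rw [e1, e2, mul_one, one_mul]
    _ = A * ((U - 1) * (1 + t • (V - 1)) - (1 + t • (U - 1)) * (V - 1)) * B := by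
        noncomm_ring
    _ = A * (U - V) * B := by
        congr 2
        simp only [mul_add, add_mul, mul_one, one_mul, mul_smul_comm, smul_mul_assoc]
        abel

/-- Mean value inequality on [0, 1] for the difference of the two logarithm paths, which runs from 0
to i times the difference of the phase matrices. By the resolvent identity its derivative has norm
at most c⁻¹ ‖U - V‖ c⁻¹. -/
theorem norm_udiag_sub_le_of_exp {P Q : Matrix ι ι ℂ} (hP : P ∈ Matrix.unitaryGroup ι ℂ)
    (hQ : Q ∈ Matrix.unitaryGroup ι ℂ) {φ θ : ι → ℝ} {c : ℝ} (hc : 0 < c)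
    (hφ : ∀ i, |φ i| ≤ Real.pi) (hθ : ∀ i, |θ i| ≤ Real.pi)
    (hφc : ∀ i, c ^ 2 ≤ (1 + Real.cos (φ i)) / 2) (hθc : ∀ i, c ^ 2 ≤ (1 + Real.cos (θ i)) / 2) :
    ‖(udiag P fun i => (φ i : ℂ)) - udiag Q fun i => (θ i : ℂ)‖ ≤
      ‖(udiag P fun i => Complex.exp (φ i * Complex.I)) -
        udiag Q fun i => Complex.exp (θ i * Complex.I)‖ / c ^ 2 := by
  have hφ' := fun i => abs_lt_pi_of_sq_le hc (hφc i) (hφ i)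
  have hθ' := fun i => abs_lt_pi_of_sq_le hc (hθc i) (hθ i)
  have inv_le : ∀ {ψ : ℝ} (t : ℝ), c ^ 2 ≤ (1 + Real.cos ψ) / 2 →
      ‖(1 + (t : ℂ) * (Complex.exp (ψ * Complex.I) - 1))⁻¹‖ ≤ c⁻¹ := by
    intro ψ t hψ
    rw [norm_inv]
    exact inv_anti₀ hc (le_norm_segment_exp t hψ)
  have key := norm_image_sub_le_of_norm_deriv_le_segment_01'
    (f := fun s : ℝ => (udiag P fun i =>
        Complex.log (1 + (s : ℂ) * (Complex.exp (φ i * Complex.I) - 1))) - udiag Q fun i =>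
        Complex.log (1 + (s : ℂ) * (Complex.exp (θ i * Complex.I) - 1)))
    (C := ‖(udiag P fun i => Complex.exp (φ i * Complex.I)) -
        udiag Q fun i => Complex.exp (θ i * Complex.I)‖ / c ^ 2)
    (fun t ht => ((hasDerivAt_udiag_log P hφ' ht).sub
      (hasDerivAt_udiag_log Q hθ' ht)).hasDerivWithinAt) ?_
  · have e1 : ∀ (R : Matrix ι ι ℂ) (ψ : ι → ℝ), (∀ i, |ψ i| < Real.pi) →
        (udiag R fun i => Complex.log (1 + ((1 : ℝ) : ℂ) * (Complex.exp (ψ i * Complex.I) - 1)))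
          = Complex.I • udiag R fun i => (ψ i : ℂ) := by
      intro R ψ hψ
      rw [← udiag_smul]
      congr 1; ext i
      simp only [Complex.ofReal_one, one_mul, add_sub_cancel, log_exp_mul_I (hψ i), Pi.smul_apply,
        smul_eq_mul]
      ring
    have e0 : ∀ (R : Matrix ι ι ℂ) (ψ : ι → ℝ),
        (udiag R fun i => Complex.log (1 + ((0 : ℝ) : ℂ) * (Complex.exp (ψ i * Complex.I) - 1)))
          = 0 := by
      intro R ψ
      rw [← zero_smul ℂ (udiag R 0), ← udiag_smul]
      congr 1; ext i; simp
    rw [e1 P φ hφ', e1 Q θ hθ', e0, e0, sub_zero, sub_zero, ← smul_sub, norm_smul,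
      Complex.norm_I, one_mul] at key
    exact key
  · intro t ht
    have ht' : t ∈ Set.Icc (0 : ℝ) 1 := ⟨ht.1, ht.2.le⟩
    rw [udiag_log_deriv_sub hP hQ t
      (fun i => Complex.slitPlane_ne_zero (segment_exp_mem_slitPlane (hφ' i) ht'))
      (fun i => Complex.slitPlane_ne_zero (segment_exp_mem_slitPlane (hθ' i) ht'))]
    have h1 := norm_udiag_le hP (inv_nonneg.2 hc.le) fun i => inv_le t (hφc i)
    have h2 := norm_udiag_le hQ (inv_nonneg.2 hc.le) fun i => inv_le t (hθc i)
    calc _ ≤ _ := (norm_mul_le _ _).trans (mul_le_mul_of_nonneg_right (norm_mul_le _ _)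
          (norm_nonneg _))
      _ ≤ c⁻¹ * ‖(udiag P fun i => Complex.exp (φ i * Complex.I)) -
          udiag Q fun i => Complex.exp (θ i * Complex.I)‖ * c⁻¹ := by gcongr
      _ = _ := by rw [div_eq_mul_inv, pow_two, mul_inv, mul_comm c⁻¹, mul_assoc]

/-- Every eigenvalue of `Q diag(ν) Q†` is within `δ` of some eigenvalue of `P diag(μ) P†`. -/
theorem exists_norm_sub_le_of_norm_udiag_sub_le {P Q : Matrix ι ι ℂ}
    (hP : P ∈ Matrix.unitaryGroup ι ℂ) (hQ : Q ∈ Matrix.unitaryGroup ι ℂ) (μ ν : ι → ℂ) (j : ι) :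
    ∃ i, ‖μ i - ν j‖ ≤ ‖udiag P μ - udiag Q ν‖ := by
  -- Otherwise U - ν_j is invertible with inverse of norm at most 1/m, where m > δ is the least
  -- distance of ν_j to the μ_i. The spectral projection E for the index j then satisfies E = (U -
  -- ν_j)⁻¹ (U - V) E, so ‖E‖ ≤ (δ/m) ‖E‖ < ‖E‖.
  by_contra! hcon
  set δ := ‖udiag P μ - udiag Q ν‖ with hδ
  have hδ0 : 0 ≤ δ := norm_nonneg _
  have hne : ∀ i, μ i - ν j ≠ 0 := fun i h => by
    have := hcon i; rw [h, norm_zero] at this; linarith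
  have e1 : (udiag P fun i => (μ i - ν j)⁻¹) * (udiag P μ - ν j • 1) = 1 := by
    rw [← udiag_const hP, ← udiag_sub, udiag_mul hP, ← udiag_one hP]
    congr 1; ext i; simp [inv_mul_cancel₀ (hne i)]
  have e2 : (udiag Q ν - ν j • 1) * udiag Q (Pi.single j 1) = 0 := by
    rw [← udiag_const hQ, ← udiag_sub, udiag_mul hQ, ← zero_smul ℂ (udiag Q 0), ← udiag_smul]
    congr 1; ext i
    by_cases h : i = j
    · subst h; simp
    · simp [Pi.single_eq_of_ne h]
  obtain ⟨i₀, -, hi₀⟩ := Finset.exists_min_image Finset.univ (fun i => ‖μ i - ν j‖) ⟨j, by simp⟩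
  set m := ‖μ i₀ - ν j‖ with hm
  have hmδ : δ < m := hcon i₀
  have hm0 : 0 < m := lt_of_le_of_lt hδ0 hmδ
  set E := udiag Q (Pi.single j (1 : ℂ)) with hE
  have hE1 : ‖E‖ ≤ 1 := norm_udiag_le hQ zero_le_one fun i => by
    by_cases h : i = j
    · subst h; simp
    · simp [Pi.single_eq_of_ne h]
  have e3 : E = (udiag P fun i => (μ i - ν j)⁻¹) * (udiag P μ - udiag Q ν) * E := by
    have : (udiag P μ - udiag Q ν) * E = (udiag P μ - ν j • 1) * E := by
      rw [← sub_eq_zero, ← sub_mul]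
      have := e2
      rw [show udiag P μ - udiag Q ν - (udiag P μ - ν j • 1) = -(udiag Q ν - ν j • 1) by abel,
        neg_mul, e2, neg_zero]
    rw [mul_assoc, this, ← mul_assoc, e1, one_mul]
  have hinv : ‖udiag P fun i => (μ i - ν j)⁻¹‖ ≤ m⁻¹ :=
    norm_udiag_le hP (inv_nonneg.2 hm0.le) fun i => by
      rw [norm_inv]; exact inv_anti₀ hm0 (hi₀ i (Finset.mem_univ i))
  have hEE : E ≠ 0 := by
    intro h
    have := udiag_trace hQ (Pi.single j (1 : ℂ))
    rw [← hE, h] at this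
    simp at this
  have hEpos : 0 < ‖E‖ := norm_pos_iff.2 hEE
  have : ‖E‖ ≤ m⁻¹ * δ * ‖E‖ := by
    conv_lhs => rw [e3]
    calc _ ≤ _ := (norm_mul_le _ _).trans (mul_le_mul_of_nonneg_right (norm_mul_le _ _)
          (norm_nonneg _))
      _ ≤ _ := by gcongr
  have h2 : m⁻¹ * δ < 1 := by
    rw [inv_mul_eq_div, div_lt_one hm0]; exact hmδ
  nlinarith

end Logarithm

/-! ### The effective Hamiltonian of an approximate evolution. -/

section Simulation

open scoped Matrix.Norms.L2Operator

theorem opNorm_eq_norm {D : ℕ} (A : Matrix (Fin D) (Fin D) ℂ) : opNorm A = ‖A‖ := rfl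

theorem evolution_udiag {D : ℕ} {P : Matrix (Fin D) (Fin D) ℂ}
    (hP : P ∈ Matrix.unitaryGroup (Fin D) ℂ) (h : Fin D → ℝ) :
    evolution (udiag P fun i => (h i : ℂ))
      = udiag P fun i => Complex.exp ((2 * Real.pi * h i : ℝ) * Complex.I) := by
  rw [evolution, ← udiag_smul, exp_udiag hP]
  congr 1; ext i
  congr 1
  simp; ring

/-- π²/4 is half the length of the arc filled by the phases 2πh with h ≤ π/4. It is less than π
because π < 4, so the centred arc does not reach -1. -/
theorem cos_sq_pi_gt : 0 < 1 + Real.cos (Real.pi ^ 2 / 4) := by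
  have h1 := Real.pi_lt_four
  have h2 := Real.pi_pos
  have : Real.cos Real.pi < Real.cos (Real.pi ^ 2 / 4) :=
    Real.cos_lt_cos_of_nonneg_of_le_pi (by positivity) le_rfl (by nlinarith)
  rw [Real.cos_pi] at this
  linarith

theorem sq_norm_one_add_exp (φ : ℝ) :
    ‖1 + Complex.exp (φ * Complex.I)‖ ^ 2 = 2 * (1 + Real.cos φ) := by
  rw [← Complex.normSq_eq_norm_sq, Complex.normSq_apply]
  simp [Complex.exp_ofReal_mul_I_re, Complex.exp_ofReal_mul_I_im]
  nlinarith [Real.sin_sq_add_cos_sq φ]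

theorem exists_simulationConstant : ∃ κ > (0 : ℝ), IsSimulationConstant κ := by
  -- g is |1 + e^{iω}| with ω = π²/4: the distance from -1 to the ends of the centred arc.
  obtain ⟨g, hg0, hg⟩ : ∃ g > (0 : ℝ), g ^ 2 = 2 * (1 + Real.cos (Real.pi ^ 2 / 4)) :=
    ⟨√(2 * (1 + Real.cos (Real.pi ^ 2 / 4))), Real.sqrt_pos.2 (by linarith [cos_sq_pi_gt]),
      Real.sq_sqrt (by linarith [cos_sq_pi_gt])⟩
  have hpi := Real.pi_pos
  refine ⟨max (16 / g ^ 2) (8 / g), lt_max_of_lt_left (by positivity), ?_⟩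
  intro D H V δ ⟨hH, hspec⟩ hV hδ
  set P : Matrix (Fin D) (Fin D) ℂ := hH.eigenvectorUnitary.1
  have hP : P ∈ Matrix.unitaryGroup (Fin D) ℂ := hH.eigenvectorUnitary.2
  set h := hH.eigenvalues
  have hHd : H = udiag P fun i => (h i : ℂ) := eq_udiag_eigenvalues hH
  set ω : ℝ := Real.pi ^ 2 / 4 with hω
  set φ : Fin D → ℝ := fun i => 2 * Real.pi * h i - ω with hφdef
  have hφ : ∀ i, |φ i| ≤ ω := fun i => by
    obtain ⟨h1, h2⟩ := hspec i
    rw [abs_le]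
    constructor <;> simp only [hφdef, hω] <;> [nlinarith [mul_nonneg hpi.le h1]; nlinarith]
  have hωπ : ω ≤ Real.pi := by
    have h1 := Real.pi_lt_four
    simp only [hω]; nlinarith
  -- rotate the arc so that it is centred at `1`
  set r : ℂ := Complex.exp (((-ω : ℝ) : ℂ) * Complex.I) with hr
  have hrn : ‖r‖ = 1 := Complex.norm_exp_ofReal_mul_I _
  have hrV : r • V ∈ Matrix.unitaryGroup (Fin D) ℂ := by
    rw [Matrix.mem_unitaryGroup_iff, star_smul, smul_mul_smul_comm,
      Matrix.mem_unitaryGroup_iff.1 hV]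
    have : r * star r = 1 := by
      simp [Complex.mul_conj, Complex.normSq_eq_norm_sq, hrn]
    rw [this, one_smul]
  obtain ⟨Q, hQ, θ, hθ, hVd⟩ := exists_udiag_of_mem_unitaryGroup hrV
  have hUd : r • evolution H = udiag P fun i => Complex.exp (φ i * Complex.I) := by
    rw [hHd, evolution_udiag hP, ← udiag_smul]
    congr 1; ext i
    simp only [hr, hφdef, Pi.smul_apply, smul_eq_mul, ← Complex.exp_add]
    congr 1
    push_cast; ring
  -- Undoing the rotation by ω turns the phases of rV into energies. No branch needs to be matched
  -- with H beyond this.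
  set h' : Fin D → ℝ := fun i => (θ i + ω) / (2 * Real.pi) with hh'
  refine ⟨udiag Q fun i => (h' i : ℂ), udiag_isHermitian _ _, ?_, ?_⟩
  · rw [evolution_udiag hQ]
    have : V = r⁻¹ • (r • V) := by
      rw [smul_smul, inv_mul_cancel₀ (Complex.exp_ne_zero _), one_smul]
    rw [this, hVd, ← udiag_smul]
    congr 1; ext i
    simp only [hr, Pi.smul_apply, smul_eq_mul, ← Complex.exp_add, ← Complex.exp_neg]
    congr 1
    have : 2 * Real.pi * h' i = θ i + ω := by simp only [hh']; field_simp
    rw [this]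
    push_cast; ring
  have hdiff : H - (udiag Q fun i => (h' i : ℂ)) = ((2 * Real.pi : ℝ) : ℂ)⁻¹ •
      ((udiag P fun i => (φ i : ℂ)) - udiag Q fun i => (θ i : ℂ)) := by
    have hc : (2 * Real.pi : ℂ) ≠ 0 := by exact_mod_cast (by positivity : (2 * Real.pi : ℝ) ≠ 0)
    have e1 : H = ((2 * Real.pi : ℝ) : ℂ)⁻¹ • (udiag P fun i => (φ i : ℂ)) +
        ((ω / (2 * Real.pi) : ℝ) : ℂ) • 1 := by
      rw [hHd, ← udiag_smul, ← udiag_const hP, ← udiag_add]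
      congr 1; ext i
      simp only [hφdef, Pi.add_apply, Pi.smul_apply, smul_eq_mul]
      push_cast; field_simp; ring
    have e2 : (udiag Q fun i => (h' i : ℂ)) =
        ((2 * Real.pi : ℝ) : ℂ)⁻¹ • (udiag Q fun i => (θ i : ℂ)) +
        ((ω / (2 * Real.pi) : ℝ) : ℂ) • 1 := by
      rw [← udiag_smul, ← udiag_const hQ, ← udiag_add]
      congr 1; ext i
      simp only [hh', Pi.add_apply, Pi.smul_apply, smul_eq_mul]
      push_cast; field_simp
    rw [e2, smul_sub]
    nth_rewrite 1 [e1]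
    abel
  have hnorm : opNorm (H - udiag Q fun i => (h' i : ℂ)) ≤
      ‖(udiag P fun i => (φ i : ℂ)) - udiag Q fun i => (θ i : ℂ)‖ / 2 := by
    rw [opNorm_eq_norm, hdiff, norm_smul, norm_inv, Complex.norm_real, Real.norm_of_nonneg
      (by positivity), inv_mul_eq_div]
    gcongr
    linarith [Real.pi_gt_three]
  have hexp : ‖(udiag P fun i => Complex.exp (φ i * Complex.I)) -
        udiag Q fun i => Complex.exp (θ i * Complex.I)‖ ≤ δ := by
    rw [← hVd, ← hUd, ← smul_sub, norm_smul, hrn, one_mul]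
    exact hδ
  have hδ0 : 0 ≤ δ := (norm_nonneg _).trans hexp
  refine hnorm.trans ?_
  -- For large δ the crude bound π < 4 on all phases suffices, at the price of the constant 8/g.
  by_cases hbig : g / 2 ≤ δ
  · have h1 : ‖udiag P fun i => (φ i : ℂ)‖ ≤ 4 := norm_udiag_le hP (by norm_num) fun i => by
      simp only [Complex.norm_real, Real.norm_eq_abs]
      linarith [hφ i, Real.pi_lt_four]
    have h2 : ‖udiag Q fun i => (θ i : ℂ)‖ ≤ 4 := norm_udiag_le hQ (by norm_num) fun i => by
      simp only [Complex.norm_real, Real.norm_eq_abs]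
      linarith [hθ i, Real.pi_lt_four]
    have h3 := norm_sub_le (udiag P fun i => (φ i : ℂ)) (udiag Q fun i => (θ i : ℂ))
    have h4 := mul_le_mul_of_nonneg_right (le_max_right (16 / g ^ 2) (8 / g)) hδ0
    have h5 : 4 ≤ 8 / g * δ := by
      rw [div_mul_eq_mul_div, le_div_iff₀ hg0]; linarith
    linarith
  · push Not at hbig
    have hφc : ∀ i, (g / 4) ^ 2 ≤ (1 + Real.cos (φ i)) / 2 := fun i => by
      have : Real.cos ω ≤ Real.cos (φ i) := by
        rw [← Real.cos_abs (φ i)]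
        exact Real.cos_le_cos_of_nonneg_of_le_pi (abs_nonneg _) hωπ (hφ i)
      nlinarith [Real.cos_le_one ω]
    have hgφ : ∀ i, g ≤ ‖1 + Complex.exp (φ i * Complex.I)‖ := fun i => by
      refine le_of_pow_le_pow_left₀ two_ne_zero (norm_nonneg _) ?_
      have : Real.cos ω ≤ Real.cos (φ i) := by
        rw [← Real.cos_abs (φ i)]
        exact Real.cos_le_cos_of_nonneg_of_le_pi (abs_nonneg _) hωπ (hφ i)
      rw [sq_norm_one_add_exp, hg]
      linarith
    -- Each eigenvalue of rV is within δ < g/2 of a point at distance at least g from -1, hence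
    -- stays at distance g/2; in terms of the chord this is the constant c = g/4.
    have hθc : ∀ j, (g / 4) ^ 2 ≤ (1 + Real.cos (θ j)) / 2 := fun j => by
      obtain ⟨i, hi⟩ := exists_norm_sub_le_of_norm_udiag_sub_le hP hQ
        (fun i => Complex.exp (φ i * Complex.I)) (fun i => Complex.exp (θ i * Complex.I)) j
      have h1 : g / 2 ≤ ‖1 + Complex.exp (θ j * Complex.I)‖ := by
        have := norm_sub_norm_le (1 + Complex.exp (φ i * Complex.I))
          (1 + Complex.exp (θ j * Complex.I))
        rw [add_sub_add_left_eq_sub] at this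
        linarith [hgφ i]
      have h2 : (g / 2) ^ 2 ≤ ‖1 + Complex.exp (θ j * Complex.I)‖ ^ 2 := by gcongr
      rw [sq_norm_one_add_exp] at h2
      linarith
    have key := norm_udiag_sub_le_of_exp hP hQ (by positivity : 0 < g / 4)
      (fun i => (hφ i).trans hωπ) hθ hφc hθc
    have h1 := mul_le_mul_of_nonneg_right (le_max_left (16 / g ^ 2) (8 / g)) hδ0
    calc _ ≤ (δ / (g / 4) ^ 2) / 2 := by
          refine div_le_div_of_nonneg_right (key.trans ?_) zero_le_two
          gcongr
      _ ≤ 16 / g ^ 2 * δ := by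
          rw [show δ / (g / 4) ^ 2 / 2 = 8 / g ^ 2 * δ by field_simp; ring]
          gcongr; norm_num
      _ ≤ _ := h1

end Simulation

/-! ### Trace distance and Gibbs states -/

section Overlaps

variable {ι : Type*} [Fintype ι] [DecidableEq ι]

/-- The transition probabilities `|⟨u_i|v_j⟩|²` between two orthonormal bases. -/
noncomputable def overlap (P Q : Matrix ι ι ℂ) (i j : ι) : ℝ := ‖(Pᴴ * Q) i j‖ ^ 2

theorem overlap_nonneg (P Q : Matrix ι ι ℂ) (i j : ι) : 0 ≤ overlap P Q i j := sq_nonneg _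

theorem sum_sq_norm_row {W : Matrix ι ι ℂ} (hW : W ∈ Matrix.unitaryGroup ι ℂ) (i : ι) :
    ∑ j, ‖W i j‖ ^ 2 = 1 := by
  have h := congrFun (congrFun (mul_conjTranspose_self_of_mem hW) i) i
  rw [Matrix.mul_apply, Matrix.one_apply_eq] at h
  have h2 : ((∑ j, ‖W i j‖ ^ 2 : ℝ) : ℂ) = 1 := by
    rw [← h]
    push_cast
    exact Finset.sum_congr rfl fun j _ => by
      rw [Matrix.conjTranspose_apply, Complex.star_def, Complex.mul_conj,
        Complex.normSq_eq_norm_sq]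
      push_cast; rfl
  exact_mod_cast h2

theorem conjTranspose_mul_mem {P Q : Matrix ι ι ℂ} (hP : P ∈ Matrix.unitaryGroup ι ℂ)
    (hQ : Q ∈ Matrix.unitaryGroup ι ℂ) : Pᴴ * Q ∈ Matrix.unitaryGroup ι ℂ :=
  mul_mem (Unitary.star_mem hP) hQ

theorem sum_overlap_right {P Q : Matrix ι ι ℂ} (hP : P ∈ Matrix.unitaryGroup ι ℂ)
    (hQ : Q ∈ Matrix.unitaryGroup ι ℂ) (i : ι) : ∑ j, overlap P Q i j = 1 :=
  sum_sq_norm_row (conjTranspose_mul_mem hP hQ) i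

theorem overlap_comm (P Q : Matrix ι ι ℂ) (i j : ι) : overlap P Q i j = overlap Q P j i := by
  have : Pᴴ * Q = (Qᴴ * P)ᴴ := by simp [Matrix.conjTranspose_mul]
  rw [overlap, this, Matrix.conjTranspose_apply, norm_star, overlap]

theorem sum_overlap_left {P Q : Matrix ι ι ℂ} (hP : P ∈ Matrix.unitaryGroup ι ℂ)
    (hQ : Q ∈ Matrix.unitaryGroup ι ℂ) (j : ι) : ∑ i, overlap P Q i j = 1 := by
  simp_rw [overlap_comm P Q]
  exact sum_overlap_right hQ hP j

theorem conj_udiag_apply_self (P Q : Matrix ι ι ℂ) (g : ι → ℂ) (i : ι) :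
    (Pᴴ * udiag Q g * P) i i = ∑ j, g j * overlap P Q i j := by
  have : Pᴴ * udiag Q g * P = (Pᴴ * Q) * Matrix.diagonal g * (Pᴴ * Q)ᴴ := by
    simp only [udiag, Matrix.conjTranspose_mul, Matrix.conjTranspose_conjTranspose, mul_assoc]
  rw [this, ← udiag, udiag_apply]
  refine Finset.sum_congr rfl fun j _ => ?_
  rw [overlap, Complex.star_def, Complex.mul_conj, Complex.normSq_eq_norm_sq]

theorem trace_mul_udiag (M P : Matrix ι ι ℂ) (d : ι → ℂ) :
    (M * udiag P d).trace = ∑ i, d i * (Pᴴ * M * P) i i := by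
  rw [udiag, ← mul_assoc, ← mul_assoc, Matrix.trace_mul_comm, ← mul_assoc, ← mul_assoc,
    Matrix.trace]
  exact Finset.sum_congr rfl fun i _ => by rw [Matrix.diag_apply, Matrix.mul_diagonal, mul_comm]

theorem trace_udiag_mul_udiag (P Q : Matrix ι ι ℂ) (f g : ι → ℂ) :
    (udiag P f * udiag Q g).trace = ∑ i, ∑ j, f i * g j * overlap P Q i j := by
  rw [Matrix.trace_mul_comm, trace_mul_udiag]
  refine Finset.sum_congr rfl fun i _ => ?_
  rw [conj_udiag_apply_self, Finset.mul_sum]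
  exact Finset.sum_congr rfl fun j _ => by ring

/-- The squared Hilbert–Schmidt norm. -/
noncomputable def hsSq (X : Matrix ι ι ℂ) : ℝ := ∑ p : ι × ι, ‖X p.1 p.2‖ ^ 2

theorem hsSq_eq_trace (X : Matrix ι ι ℂ) : ((hsSq X : ℝ) : ℂ) = (Xᴴ * X).trace := by
  simp only [hsSq, Matrix.trace, Matrix.diag_apply, Matrix.mul_apply, Fintype.sum_prod_type]
  rw [Finset.sum_comm]
  push_cast
  refine Finset.sum_congr rfl fun i _ => Finset.sum_congr rfl fun j _ => ?_
  rw [Matrix.conjTranspose_apply, Complex.star_def, mul_comm, Complex.mul_conj,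
    Complex.normSq_eq_norm_sq]
  push_cast; rfl

theorem hsSq_unitary_mul {S : Matrix ι ι ℂ} (hS : S ∈ Matrix.unitaryGroup ι ℂ)
    (X : Matrix ι ι ℂ) : hsSq (S * X) = hsSq X := by
  have : ((hsSq (S * X) : ℝ) : ℂ) = (hsSq X : ℝ) := by
    rw [hsSq_eq_trace, hsSq_eq_trace, Matrix.conjTranspose_mul, mul_assoc, ← mul_assoc Sᴴ,
      conjTranspose_mul_self_of_mem hS, one_mul]
  exact_mod_cast this

/-- Cauchy–Schwarz for the Hilbert–Schmidt inner product. -/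
theorem norm_trace_mul_le (X Y : Matrix ι ι ℂ) :
    ‖(X * Y).trace‖ ≤ √(hsSq X) * √(hsSq Y) := by
  have h1 : (X * Y).trace = ∑ p : ι × ι, X p.1 p.2 * Y p.2 p.1 := by
    simp only [Matrix.trace, Matrix.diag_apply, Matrix.mul_apply, Fintype.sum_prod_type]
  have h2 : hsSq Y = ∑ p : ι × ι, ‖Y p.2 p.1‖ ^ 2 := by
    simp only [hsSq, Fintype.sum_prod_type]
    rw [Finset.sum_comm]
  rw [h1, h2, hsSq]
  refine (norm_sum_le _ _).trans ?_
  simp_rw [norm_mul]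
  exact Real.sum_mul_le_sqrt_mul_sqrt _ _ _

/-- The overlaps form a doubly stochastic matrix, so two non-commuting diagonalized matrices can be
treated as functions of two classical variables; the cross term is tr(AB). -/
theorem hsSq_udiag_add {P Q : Matrix ι ι ℂ} (hP : P ∈ Matrix.unitaryGroup ι ℂ)
    (hQ : Q ∈ Matrix.unitaryGroup ι ℂ) (f g : ι → ℝ) :
    hsSq ((udiag P fun i => (f i : ℂ)) + udiag Q fun j => (g j : ℂ))
      = ∑ i, ∑ j, (f i + g j) ^ 2 * overlap P Q i j := by
  have hf : ∑ i, ∑ j, f i ^ 2 * overlap P Q i j = ∑ i, f i ^ 2 := by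
    refine Finset.sum_congr rfl fun i _ => ?_
    rw [← Finset.mul_sum, sum_overlap_right hP hQ, mul_one]
  have hg : ∑ i, ∑ j, g j ^ 2 * overlap P Q i j = ∑ j, g j ^ 2 := by
    rw [Finset.sum_comm]
    refine Finset.sum_congr rfl fun i _ => ?_
    rw [← Finset.mul_sum, sum_overlap_left hP hQ, mul_one]
  have key : ((hsSq ((udiag P fun i => (f i : ℂ)) + udiag Q fun j => (g j : ℂ)) : ℝ) : ℂ)
      = ((∑ i, f i ^ 2 + ∑ j, g j ^ 2 + 2 * ∑ i, ∑ j, f i * g j * overlap P Q i j : ℝ) : ℂ) := by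
    rw [hsSq_eq_trace, Matrix.conjTranspose_add, (udiag_isHermitian P f).eq,
      (udiag_isHermitian Q g).eq]
    simp only [add_mul, mul_add, Matrix.trace_add]
    rw [udiag_mul hP, udiag_mul hQ, udiag_trace hP, udiag_trace hQ,
      Matrix.trace_mul_comm (udiag Q _) (udiag P _), trace_udiag_mul_udiag]
    push_cast
    simp only [Pi.mul_apply, ← sq]
    ring
  have key' := Complex.ofReal_injective key
  rw [key', ← hf, ← hg, Finset.mul_sum, ← Finset.sum_add_distrib, ← Finset.sum_add_distrib]
  refine Finset.sum_congr rfl fun i _ => ?_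
  rw [Finset.mul_sum, ← Finset.sum_add_distrib, ← Finset.sum_add_distrib]
  exact Finset.sum_congr rfl fun j _ => by ring

open scoped Matrix.Norms.L2Operator

theorem norm_entry_le_l2_opNorm (M : Matrix ι ι ℂ) (i j : ι) : ‖M i j‖ ≤ ‖M‖ := by
  have h := Matrix.l2_opNorm_mulVec M (EuclideanSpace.single j 1)
  rw [PiLp.norm_single, norm_one, mul_one] at h
  refine le_trans ?_ h
  have := PiLp.norm_apply_le ((EuclideanSpace.equiv ι ℂ).symm
    (M *ᵥ (EuclideanSpace.single j (1 : ℂ)).ofLp)) i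
  refine le_trans (le_of_eq ?_) this
  congr 1
  simp [EuclideanSpace.equiv, EuclideanSpace.single]

theorem norm_conj_entry_le {P : Matrix ι ι ℂ} (hP : P ∈ Matrix.unitaryGroup ι ℂ)
    (M : Matrix ι ι ℂ) (i j : ι) : ‖(Pᴴ * M * P) i j‖ ≤ ‖M‖ := by
  have h1 := norm_le_one_of_mem_unitaryGroup hP
  have h2 : ‖Pᴴ‖ ≤ 1 := by rwa [Matrix.l2_opNorm_conjTranspose]
  refine (norm_entry_le_l2_opNorm _ i j).trans ?_
  calc ‖Pᴴ * M * P‖ ≤ ‖Pᴴ‖ * ‖M‖ * ‖P‖ :=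
        (norm_mul_le _ _).trans (by gcongr; exact norm_mul_le _ _)
    _ ≤ 1 * ‖M‖ * 1 := by gcongr
    _ = ‖M‖ := by ring

/-- Hölder's inequality between the operator norm and the trace norm. -/
theorem norm_trace_mul_udiag_le {P : Matrix ι ι ℂ} (hP : P ∈ Matrix.unitaryGroup ι ℂ)
    (M : Matrix ι ι ℂ) (d : ι → ℂ) : ‖(M * udiag P d).trace‖ ≤ ‖M‖ * ∑ i, ‖d i‖ := by
  rw [trace_mul_udiag, Finset.mul_sum]
  refine (norm_sum_le _ _).trans (Finset.sum_le_sum fun i _ => ?_)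
  rw [norm_mul, mul_comm]
  gcongr
  exact norm_conj_entry_le hP M i i

end Overlaps

/-! ### Variational form of the trace distance, and a scalar inequality. -/

section TraceDistance

open scoped Matrix.Norms.L2Operator

variable {D : ℕ}

theorem charpoly_udiag {P : Matrix (Fin D) (Fin D) ℂ} (hP : P ∈ Matrix.unitaryGroup (Fin D) ℂ)
    (d : Fin D → ℂ) :
    (udiag P d).charpoly = ∏ i, (Polynomial.X - Polynomial.C (d i)) := by
  rw [udiag, Matrix.charpoly_mul_comm, ← mul_assoc, conjTranspose_mul_self_of_mem hP, one_mul,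
    Matrix.charpoly_diagonal]

/-- The enumeration `hA.eigenvalues` need not match the order of d, but both are the roots of the
characteristic polynomial as multisets, and a symmetric sum sees nothing else. -/
theorem sum_eigenvalues_udiag {P A : Matrix (Fin D) (Fin D) ℂ}
    (hP : P ∈ Matrix.unitaryGroup (Fin D) ℂ) (hA : A.IsHermitian) (d : Fin D → ℝ)
    (h : A = udiag P fun i => (d i : ℂ)) (f : ℝ → ℝ) :
    ∑ i, f (hA.eigenvalues i) = ∑ i, f (d i) := by
  have h1 := hA.roots_charpoly_eq_eigenvalues
  have h2 : A.charpoly.roots = Finset.univ.val.map fun i => (d i : ℂ) := by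
    rw [h, charpoly_udiag hP, Polynomial.roots_prod]
    · simp
    · simp [Finset.prod_ne_zero_iff, Polynomial.X_sub_C_ne_zero]
  have h3 := congrArg (Multiset.map fun z : ℂ => f z.re) (h1.symm.trans h2)
  rw [Multiset.map_map, Multiset.map_map] at h3
  simpa [Finset.sum] using congrArg Multiset.sum h3

/-- The trace distance of two Hermitian matrices is attained by a unitary. -/
theorem exists_traceDist_eq {ρ σ : Matrix (Fin D) (Fin D) ℂ} (hρ : ρ.IsHermitian)
    (hσ : σ.IsHermitian) :
    ∃ S ∈ Matrix.unitaryGroup (Fin D) ℂ, traceDist ρ σ = (S * (ρ - σ)).trace.re / 2 := by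
  have hX : (ρ - σ).IsHermitian := hρ.sub hσ
  set W : Matrix (Fin D) (Fin D) ℂ := hX.eigenvectorUnitary.1
  have hW : W ∈ Matrix.unitaryGroup (Fin D) ℂ := hX.eigenvectorUnitary.2
  set x := hX.eigenvalues
  have hd : ρ - σ = udiag W fun i => (x i : ℂ) := eq_udiag_eigenvalues hX
  -- The sign of ρ - σ, with value 1 on the kernel so that it remains unitary.
  refine ⟨udiag W fun i => ((if 0 ≤ x i then 1 else -1 : ℝ) : ℂ),
    udiag_mem_unitaryGroup hW fun i => by split_ifs <;> simp, ?_⟩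
  have hsq : (ρ - σ) * (ρ - σ)ᴴ = udiag W fun i => ((x i ^ 2 : ℝ) : ℂ) := by
    rw [hX.eq, hd, udiag_mul hW]
    congr 1; ext i; simp [sq]
  rw [traceDist, sum_eigenvalues_udiag hW _ (fun i => x i ^ 2) hsq Real.sqrt, hd, udiag_mul hW,
    udiag_trace hW, Complex.re_sum]
  rw [one_div_mul_eq_div]
  congr 1
  refine Finset.sum_congr rfl fun i _ => ?_
  rw [Real.sqrt_sq_eq_abs, Pi.mul_apply, ← Complex.ofReal_mul, Complex.ofReal_re]
  split_ifs with h
  · rw [abs_of_nonneg h, one_mul]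
  · rw [abs_of_neg (not_le.1 h)]; ring

/-- With t = (x - y)/2 ≥ 0 and after division by common factors this is 2(e^t - 1) ≤ (e^t + 1)t,
that is tanh(t/2) ≤ t/2. Summed over a joint distribution, it bounds a Hellinger distance by a
symmetrized relative entropy. -/
theorem four_mul_sq_sub_le (x y : ℝ) :
    4 * (Real.exp (x / 2) - Real.exp (y / 2)) ^ 2 ≤ (Real.exp x - Real.exp y) * (x - y) := by
  have key : ∀ t : ℝ, 0 ≤ t → 2 * (Real.exp t - 1) ≤ (Real.exp t + 1) * t := by
    intro t ht
    have hmono : MonotoneOn (fun t : ℝ => (Real.exp t + 1) * t - 2 * (Real.exp t - 1))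
        (Set.Ici 0) := by
      refine monotoneOn_of_deriv_nonneg (convex_Ici 0) (by fun_prop) (by fun_prop) ?_
      intro s hs
      have hd : HasDerivAt (fun t : ℝ => (Real.exp t + 1) * t - 2 * (Real.exp t - 1))
          (Real.exp s * s + (Real.exp s + 1) * 1 - 2 * Real.exp s) s :=
        (((Real.hasDerivAt_exp s).add_const 1).mul (hasDerivAt_id s)).sub
          (((Real.hasDerivAt_exp s).sub_const 1).const_mul 2)
      rw [hd.deriv]
      have h1 := Real.add_one_le_exp (-s)
      have h2 : Real.exp s * Real.exp (-s) = 1 := by rw [← Real.exp_add]; simp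
      nlinarith [Real.exp_pos s]
    have := hmono (Set.mem_Ici.2 le_rfl) (Set.mem_Ici.2 ht) ht
    simp at this
    linarith
  wlog h : y ≤ x generalizing x y
  · have := this y x (by linarith)
    nlinarith
  have ht := key ((x - y) / 2) (by linarith)
  have ex : Real.exp (x / 2) = Real.exp (y / 2) * Real.exp ((x - y) / 2) := by
    rw [← Real.exp_add]; congr 1; ring
  have e1 : Real.exp x = Real.exp (x / 2) ^ 2 := by rw [← Real.exp_nat_mul]; congr 1; push_cast; ring
  have e2 : Real.exp y = Real.exp (y / 2) ^ 2 := by rw [← Real.exp_nat_mul]; congr 1; push_cast; ring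
  rw [e1, e2, ex]
  have h1 : 1 ≤ Real.exp ((x - y) / 2) := Real.one_le_exp (by linarith)
  generalize Real.exp ((x - y) / 2) = q at *
  have hp := Real.exp_pos (y / 2)
  generalize Real.exp (y / 2) = p at *
  have h3 : 0 ≤ p ^ 2 * (q - 1) * ((q + 1) * ((x - y) / 2) - 2 * (q - 1)) :=
    mul_nonneg (mul_nonneg (sq_nonneg _) (by linarith)) (by linarith)
  nlinarith

end TraceDistance

/-! ### Perturbation of Gibbs states. -/

section Gibbs

open scoped Matrix.Norms.L2Operator

variable {D : ℕ} {P Q : Matrix (Fin D) (Fin D) ℂ}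

theorem exp_neg_smul_udiag (hP : P ∈ Matrix.unitaryGroup (Fin D) ℂ) (h : Fin D → ℝ) (β : ℝ) :
    NormedSpace.exp ((-(β : ℂ)) • udiag P fun i => (h i : ℂ))
      = udiag P fun i => ((Real.exp (-β * h i) : ℝ) : ℂ) := by
  rw [← udiag_smul, exp_udiag hP]
  congr 1; ext i
  push_cast
  rfl

theorem partitionFunction_udiag (hP : P ∈ Matrix.unitaryGroup (Fin D) ℂ) (h : Fin D → ℝ) (β : ℝ) :
    partitionFunction (udiag P fun i => (h i : ℂ)) β = ∑ i, Real.exp (-β * h i) := by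
  rw [partitionFunction, exp_neg_smul_udiag hP, udiag_trace hP, ← Complex.ofReal_sum,
    Complex.ofReal_re]

theorem gibbsState_udiag (hP : P ∈ Matrix.unitaryGroup (Fin D) ℂ) (h : Fin D → ℝ) (β : ℝ) :
    gibbsState (udiag P fun i => (h i : ℂ)) β = udiag P fun i =>
      ((Real.exp (-β * h i) / ∑ i, Real.exp (-β * h i) : ℝ) : ℂ) := by
  rw [gibbsState, exp_neg_smul_udiag hP, partitionFunction_udiag hP, ← udiag_smul]
  congr 1; ext i
  simp only [Pi.smul_apply, smul_eq_mul]
  push_cast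
  ring

/-- Pointwise form of `⟨u_i|H'|u_i⟩ ≤ h_i + ‖H - H'‖`. -/
theorem sum_overlap_mul_le (hP : P ∈ Matrix.unitaryGroup (Fin D) ℂ) {h h' : Fin D → ℝ} {η : ℝ}
    (hη : ‖(udiag P fun i => (h i : ℂ)) - udiag Q fun i => (h' i : ℂ)‖ ≤ η) (i : Fin D) :
    ∑ j, h' j * overlap P Q i j ≤ h i + η := by
  have h1 := (norm_conj_entry_le hP _ i i).trans hη
  rw [mul_sub, sub_mul, Matrix.sub_apply, conj_udiag_apply_self, conj_udiag_apply_self] at h1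
  have h2 : ∑ j, (h j : ℂ) * overlap P P i j = h i := by
    rw [Finset.sum_eq_single i]
    · rw [overlap, conjTranspose_mul_self_of_mem hP]; simp
    · intro j _ hj
      rw [overlap, conjTranspose_mul_self_of_mem hP, Matrix.one_apply_ne hj.symm]; simp
    · simp
  rw [h2] at h1
  have h3 := (Complex.abs_re_le_norm _).trans h1
  rw [abs_le] at h3
  have h4 : ((h i : ℂ) - ∑ j, (h' j : ℂ) * overlap P Q i j).re
      = h i - ∑ j, h' j * overlap P Q i j := by
    rw [← Complex.ofReal_re (h i - ∑ j, h' j * overlap P Q i j)]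
    push_cast; rfl
  rw [h4] at h3
  linarith [h3.1]

/-- The Peierls–Bogoliubov type bound `e^{-βη} Z(H) ≤ Z(H')`. -/
theorem exp_mul_sum_exp_le (hP : P ∈ Matrix.unitaryGroup (Fin D) ℂ)
    (hQ : Q ∈ Matrix.unitaryGroup (Fin D) ℂ) {h h' : Fin D → ℝ} {η β : ℝ} (hβ : 0 ≤ β)
    (hη : ‖(udiag P fun i => (h i : ℂ)) - udiag Q fun i => (h' i : ℂ)‖ ≤ η) :
    Real.exp (-(β * η)) * ∑ i, Real.exp (-β * h i) ≤ ∑ j, Real.exp (-β * h' j) := by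
  have h1 : ∑ j, Real.exp (-β * h' j) = ∑ i, ∑ j, Real.exp (-β * h' j) * overlap P Q i j := by
    rw [Finset.sum_comm]
    exact Finset.sum_congr rfl fun j _ => by
      rw [← Finset.mul_sum, sum_overlap_left hP hQ, mul_one]
  rw [h1, Finset.mul_sum]
  refine Finset.sum_le_sum fun i _ => ?_
  set x₀ := -(β * η) + -β * h i with hx
  rw [← Real.exp_add, ← hx]
  have hm := sum_overlap_mul_le hP hη i
  -- The tangent line of exp at x₀, weighted by the overlaps: Jensen's inequality for the
  -- distribution j ↦ `overlap P Q i j`.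
  have h2 : ∀ j, Real.exp x₀ * ((1 - x₀) * overlap P Q i j - β * (h' j * overlap P Q i j))
      ≤ Real.exp (-β * h' j) * overlap P Q i j := by
    intro j
    have h3 := Real.add_one_le_exp (-β * h' j - x₀)
    have h4 : Real.exp (-β * h' j) = Real.exp x₀ * Real.exp (-β * h' j - x₀) := by
      rw [← Real.exp_add]; congr 1; ring
    rw [h4, mul_assoc]
    refine mul_le_mul_of_nonneg_left ?_ (Real.exp_pos _).le
    nlinarith [mul_le_mul_of_nonneg_right h3 (overlap_nonneg P Q i j)]
  refine le_trans ?_ (Finset.sum_le_sum fun j _ => h2 j)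
  rw [← Finset.mul_sum, Finset.sum_sub_distrib, ← Finset.mul_sum, ← Finset.mul_sum,
    sum_overlap_right hP hQ, mul_one]
  have : 1 ≤ 1 - x₀ - β * ∑ j, h' j * overlap P Q i j := by
    rw [hx]; nlinarith
  exact le_mul_of_one_le_right (Real.exp_pos _).le this

/-- Nearby Hamiltonians have nearby Gibbs states, in the Hilbert–Schmidt distance of the square
roots. -/
theorem sum_overlap_sq_sub_le (hP : P ∈ Matrix.unitaryGroup (Fin D) ℂ)
    (hQ : Q ∈ Matrix.unitaryGroup (Fin D) ℂ) {h h' : Fin D → ℝ} {η β a b : ℝ} (hβ : 0 ≤ β)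
    (hη : ‖(udiag P fun i => (h i : ℂ)) - udiag Q fun i => (h' i : ℂ)‖ ≤ η)
    (ha : ∑ i, Real.exp (-β * h i - a) = 1) (hb : ∑ j, Real.exp (-β * h' j - b) = 1) :
    ∑ i, ∑ j, (Real.exp ((-β * h i - a) / 2) - Real.exp ((-β * h' j - b) / 2)) ^ 2 *
      overlap P Q i j ≤ β * η / 2 := by
  set r := fun i => Real.exp (-β * h i - a) with hr
  set s := fun j => Real.exp (-β * h' j - b) with hs
  have hη0 : 0 ≤ η := (norm_nonneg _).trans hη
  have h1 : ∀ i j, 4 * ((Real.exp ((-β * h i - a) / 2) - Real.exp ((-β * h' j - b) / 2)) ^ 2 *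
      overlap P Q i j) ≤ (r i - s j) * (β * (h' j - h i) + (b - a)) * overlap P Q i j := by
    intro i j
    have := four_mul_sq_sub_le (-β * h i - a) (-β * h' j - b)
    rw [show (-β * h i - a) - (-β * h' j - b) = β * (h' j - h i) + (b - a) by ring] at this
    rw [← mul_assoc]
    exact mul_le_mul_of_nonneg_right this (overlap_nonneg P Q i j)
  have h2 := Finset.sum_le_sum fun i (_ : i ∈ Finset.univ) =>
    Finset.sum_le_sum fun j (_ : j ∈ Finset.univ) => h1 i j
  simp_rw [← Finset.mul_sum] at h2
  have sr : ∑ i, ∑ j, r i * overlap P Q i j = 1 := by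
    rw [← ha]
    exact Finset.sum_congr rfl fun i _ => by
      rw [← Finset.mul_sum, sum_overlap_right hP hQ, mul_one]
  have ss : ∑ i, ∑ j, s j * overlap P Q i j = 1 := by
    rw [Finset.sum_comm, ← hb]
    exact Finset.sum_congr rfl fun i _ => by
      rw [← Finset.mul_sum, sum_overlap_left hP hQ, mul_one]
  have hrn : ∑ i, ‖((r i : ℝ) : ℂ)‖ = 1 := by
    rw [← ha]
    exact Finset.sum_congr rfl fun i _ => by
      rw [Complex.norm_real, Real.norm_of_nonneg (Real.exp_pos _).le]
  have hsn : ∑ i, ‖((s i : ℝ) : ℂ)‖ = 1 := by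
    rw [← hb]
    exact Finset.sum_congr rfl fun i _ => by
      rw [Complex.norm_real, Real.norm_of_nonneg (Real.exp_pos _).le]
  set M := (udiag P fun i => (h i : ℂ)) - udiag Q fun i => (h' i : ℂ) with hM
  have tr1 : (M * udiag P fun i => ((r i : ℝ) : ℂ)).trace
      = ((∑ i, ∑ j, r i * (h i - h' j) * overlap P Q i j : ℝ) : ℂ) := by
    rw [hM, sub_mul, Matrix.trace_sub, udiag_mul hP, udiag_trace hP,
      Matrix.trace_mul_comm (udiag Q _), trace_udiag_mul_udiag]
    have : ∀ i, ∑ j, r i * h i * overlap P Q i j = r i * h i := fun i => by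
      rw [← Finset.mul_sum, sum_overlap_right hP hQ, mul_one]
    simp_rw [mul_sub, sub_mul, Finset.sum_sub_distrib, this]
    push_cast
    congr 1
    exact Finset.sum_congr rfl fun i _ => mul_comm _ _
  have tr2 : (M * udiag Q fun i => ((s i : ℝ) : ℂ)).trace
      = ((∑ i, ∑ j, s j * (h i - h' j) * overlap P Q i j : ℝ) : ℂ) := by
    rw [hM, sub_mul, Matrix.trace_sub, udiag_mul hQ, udiag_trace hQ, trace_udiag_mul_udiag]
    have : ∑ i, ∑ j, s j * h' j * overlap P Q i j = ∑ j, s j * h' j := by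
      rw [Finset.sum_comm]
      exact Finset.sum_congr rfl fun i _ => by
        rw [← Finset.mul_sum, sum_overlap_left hP hQ, mul_one]
    simp_rw [mul_sub, sub_mul, Finset.sum_sub_distrib, this]
    push_cast
    congr 1
    · exact Finset.sum_congr rfl fun i _ => Finset.sum_congr rfl fun j _ => by ring
    · exact Finset.sum_congr rfl fun i _ => mul_comm _ _
  have b1 := norm_trace_mul_udiag_le hP M fun i => ((r i : ℝ) : ℂ)
  have b2 := norm_trace_mul_udiag_le hQ M fun i => ((s i : ℝ) : ℂ)
  rw [hrn, mul_one, tr1, Complex.norm_real, Real.norm_eq_abs] at b1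
  rw [hsn, mul_one, tr2, Complex.norm_real, Real.norm_eq_abs] at b2
  -- The normalizing constants a and b drop out because both distributions have total mass 1. What
  -- remains is β tr((ρ' - ρ)(H - H')), at most 2βη; division by 4 gives the claim.
  have h3 : ∑ i, ∑ j, (r i - s j) * (β * (h' j - h i) + (b - a)) * overlap P Q i j
      = β * (∑ i, ∑ j, s j * (h i - h' j) * overlap P Q i j -
          ∑ i, ∑ j, r i * (h i - h' j) * overlap P Q i j) +
        (b - a) * (∑ i, ∑ j, r i * overlap P Q i j - ∑ i, ∑ j, s j * overlap P Q i j) := by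
    simp_rw [← Finset.sum_sub_distrib, Finset.mul_sum, ← Finset.sum_add_distrib]
    exact Finset.sum_congr rfl fun i _ => Finset.sum_congr rfl fun j _ => by ring
  rw [h3, sr, ss, sub_self, mul_zero, add_zero] at h2
  have b3 := (neg_le_abs _).trans (b1.trans hη)
  have b4 := (le_abs_self _).trans (b2.trans hη)
  have h4 : β * (∑ i, ∑ j, s j * (h i - h' j) * overlap P Q i j -
          ∑ i, ∑ j, r i * (h i - h' j) * overlap P Q i j) ≤ β * (2 * η) :=
    mul_le_mul_of_nonneg_left (by linarith) hβ
  linarith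

/-- The trace-norm distance of two Gibbs states, tested against a unitary. -/
theorem re_trace_gibbs_sub_le (hP : P ∈ Matrix.unitaryGroup (Fin D) ℂ)
    (hQ : Q ∈ Matrix.unitaryGroup (Fin D) ℂ) {S : Matrix (Fin D) (Fin D) ℂ}
    (hS : S ∈ Matrix.unitaryGroup (Fin D) ℂ) {h h' : Fin D → ℝ} {η β a b : ℝ} (hβ : 0 ≤ β)
    (hη : ‖(udiag P fun i => (h i : ℂ)) - udiag Q fun i => (h' i : ℂ)‖ ≤ η)
    (ha : ∑ i, Real.exp (-β * h i - a) = 1) (hb : ∑ j, Real.exp (-β * h' j - b) = 1) :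
    (S * ((udiag P fun i => ((Real.exp (-β * h i - a) : ℝ) : ℂ)) -
        udiag Q fun j => ((Real.exp (-β * h' j - b) : ℝ) : ℂ))).trace.re
      ≤ 2 * √(β * η / 2) := by
  set f := fun i => Real.exp ((-β * h i - a) / 2) with hf
  set g := fun i => Real.exp ((-β * h' i - b) / 2) with hg
  have hf2 : ∀ i, f i ^ 2 = Real.exp (-β * h i - a) := fun i => by
    rw [hf, ← Real.exp_nat_mul]; congr 1; push_cast; ring
  have hg2 : ∀ i, g i ^ 2 = Real.exp (-β * h' i - b) := fun i => by
    rw [hg, ← Real.exp_nat_mul]; congr 1; push_cast; ring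
  have hA : (udiag P fun i => ((Real.exp (-β * h i - a) : ℝ) : ℂ))
      = (udiag P fun i => ((f i : ℝ) : ℂ)) * (udiag P fun i => ((f i : ℝ) : ℂ)) := by
    rw [udiag_mul hP]; congr 1; ext i; rw [← hf2]; simp [sq]
  have hB : (udiag Q fun i => ((Real.exp (-β * h' i - b) : ℝ) : ℂ))
      = (udiag Q fun i => ((g i : ℝ) : ℂ)) * (udiag Q fun i => ((g i : ℝ) : ℂ)) := by
    rw [udiag_mul hQ]; congr 1; ext i; rw [← hg2]; simp [sq]
  have hm : hsSq ((udiag P fun i => ((f i : ℝ) : ℂ)) - udiag Q fun i => ((g i : ℝ) : ℂ))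
      ≤ β * η / 2 := by
    have e : (udiag P fun i => ((f i : ℝ) : ℂ)) - (udiag Q fun i => ((g i : ℝ) : ℂ))
        = (udiag P fun i => ((f i : ℝ) : ℂ)) + udiag Q fun i => (((-g i) : ℝ) : ℂ) := by
      rw [sub_eq_add_neg, ← udiag_neg]; congr 2; ext i; simp
    rw [e, hsSq_udiag_add hP hQ]
    have := sum_overlap_sq_sub_le hP hQ hβ hη ha hb
    simpa only [← sub_eq_add_neg] using this
  have hp : hsSq ((udiag P fun i => ((f i : ℝ) : ℂ)) + udiag Q fun i => ((g i : ℝ) : ℂ)) ≤ 4 := by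
    rw [hsSq_udiag_add hP hQ]
    have h1 : ∀ i j, (f i + g j) ^ 2 * overlap P Q i j ≤
        2 * (f i ^ 2 * overlap P Q i j) + 2 * (g j ^ 2 * overlap P Q i j) := fun i j => by
      nlinarith [mul_nonneg (sq_nonneg (f i - g j)) (overlap_nonneg P Q i j)]
    refine (Finset.sum_le_sum fun i _ => Finset.sum_le_sum fun j _ => h1 i j).trans ?_
    simp_rw [Finset.sum_add_distrib, ← Finset.mul_sum, sum_overlap_right hP hQ]
    rw [Finset.sum_comm (f := fun i j => g j ^ 2 * overlap P Q i j)]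
    simp_rw [← Finset.mul_sum, sum_overlap_left hP hQ, mul_one, hf2, hg2]
    rw [ha, hb]; norm_num
  rw [hA, hB]
  generalize (udiag P fun i => ((f i : ℝ) : ℂ)) = A at *
  generalize (udiag Q fun i => ((g i : ℝ) : ℂ)) = B at *
  -- A² - B² is the symmetrized product of A - B and A + B, so Cauchy–Schwarz bounds it by the
  -- Hilbert–Schmidt norms √(βη/2) and 2.
  have e : S * (A * A - B * B) + S * (A * A - B * B)
      = S * (A - B) * (A + B) + S * (A + B) * (A - B) := by noncomm_ring
  have e' := congrArg (fun X => (Matrix.trace X).re) e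
  simp only [Matrix.trace_add, Complex.add_re] at e'
  have hs4 : √(hsSq (A + B)) ≤ 2 := by
    rw [show (2 : ℝ) = √4 by rw [show (4 : ℝ) = 2 ^ 2 by norm_num]; simp]
    exact Real.sqrt_le_sqrt hp
  have hsm := Real.sqrt_le_sqrt hm
  have t1 := (Complex.re_le_norm _).trans (norm_trace_mul_le (S * (A - B)) (A + B))
  have t2 := (Complex.re_le_norm _).trans (norm_trace_mul_le (S * (A + B)) (A - B))
  rw [hsSq_unitary_mul hS] at t1 t2
  have n1 := Real.sqrt_nonneg (hsSq (A + B))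
  have n2 := Real.sqrt_nonneg (hsSq (A - B))
  have m1 : √(hsSq (A - B)) * √(hsSq (A + B)) ≤ √(β * η / 2) * 2 := by gcongr
  linarith [mul_comm (√(hsSq (A - B))) (√(hsSq (A + B)))]

/-- If the weights `w` agree with the unnormalized distribution `g` up to factors in `[L, U]`, the
normalized distributions have total variation distance at most `1 - L / U`. -/
theorem sum_abs_normalized_sub_le {ι : Type*} [Fintype ι] {g w : ι → ℝ} {L U : ℝ}
    (hL : 0 ≤ L) (hU : 0 < U) (hg : ∀ j, 0 ≤ g j) (hgs : 0 < ∑ j, g j) (hws : 0 < ∑ j, w j)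
    (hlow : ∀ j, L * g j ≤ w j) (hup : ∀ j, w j ≤ U * g j) :
    ∑ j, |g j / (∑ i, g i) - w j / ∑ i, w i| ≤ 2 * (1 - L / U) := by
  have hW : ∑ i, w i ≤ U * ∑ i, g i := by
    rw [Finset.mul_sum]; exact Finset.sum_le_sum fun i _ => hup i
  have hLW : L * ∑ i, g i ≤ ∑ i, w i := by
    rw [Finset.mul_sum]; exact Finset.sum_le_sum fun i _ => hlow i
  have hLU : L / U ≤ 1 := by
    rw [div_le_one hU]
    exact le_of_mul_le_mul_right (hLW.trans hW) hgs
  have h1 : ∀ j, L / U * (g j / ∑ i, g i) ≤ w j / ∑ i, w i := fun j => by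
    rw [div_mul_div_comm]
    refine div_le_div₀ ((mul_nonneg hL (hg j)).trans (hlow j)) (hlow j) hws hW
  -- If y ≥ λx with x ≥ 0 and λ ≤ 1, then |x - y| ≤ y + (1 - 2λ)x. Summing over two probability
  -- vectors gives 2(1 - λ).
  have h2 : ∀ j, |g j / (∑ i, g i) - w j / ∑ i, w i| ≤
      (w j / ∑ i, w i) + (1 - 2 * (L / U)) * (g j / ∑ i, g i) := fun j => by
    have h3 : 0 ≤ g j / ∑ i, g i := div_nonneg (hg j) hgs.le
    have := h1 j
    rw [abs_le]
    constructor <;> nlinarith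
  refine (Finset.sum_le_sum fun j _ => h2 j).trans ?_
  rw [Finset.sum_add_distrib, ← Finset.mul_sum, ← Finset.sum_div, ← Finset.sum_div,
    div_self hgs.ne', div_self hws.ne']
  linarith

/-- Triangle inequality through the Gibbs state of the second Hamiltonian, tested against the
unitary that attains the distance. The change of eigenbasis is paid for in the first leg; the second
compares two classical distributions in the same basis Q. -/
theorem traceDist_gibbsState_udiag_le (hP : P ∈ Matrix.unitaryGroup (Fin D) ℂ)
    (hQ : Q ∈ Matrix.unitaryGroup (Fin D) ℂ) {h h' w : Fin D → ℝ} {η β L U : ℝ} (hD : 0 < D)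
    (hβ : 0 ≤ β) (hη : ‖(udiag P fun i => (h i : ℂ)) - udiag Q fun i => (h' i : ℂ)‖ ≤ η)
    (hL : 0 ≤ L) (hU : 0 < U) (hws : 0 < ∑ j, w j)
    (hlow : ∀ j, L * Real.exp (-β * h' j) ≤ w j) (hup : ∀ j, w j ≤ U * Real.exp (-β * h' j)) :
    traceDist (gibbsState (udiag P fun i => (h i : ℂ)) β)
      (udiag Q fun j => ((w j / ∑ i, w i : ℝ) : ℂ)) ≤ √(β * η / 2) + (1 - L / U) := by
  have : Nonempty (Fin D) := ⟨⟨0, hD⟩⟩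
  have pos : ∀ k : Fin D → ℝ, 0 < ∑ i, Real.exp (-β * k i) := fun k =>
    Finset.sum_pos (fun i _ => Real.exp_pos _) Finset.univ_nonempty
  have e1 : ∀ k : Fin D → ℝ, ∀ i, Real.exp (-β * k i) / ∑ i, Real.exp (-β * k i)
      = Real.exp (-β * k i - Real.log (∑ i, Real.exp (-β * k i))) := fun k i => by
    rw [Real.exp_sub, Real.exp_log (pos k)]
  have e2 : ∀ k : Fin D → ℝ,
      ∑ i, Real.exp (-β * k i - Real.log (∑ i, Real.exp (-β * k i))) = 1 := fun k => by
    simp_rw [← e1 k, ← Finset.sum_div]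
    exact div_self (pos k).ne'
  rw [gibbsState_udiag hP]
  obtain ⟨S, hS, hT⟩ := exists_traceDist_eq
    (udiag_isHermitian P fun i => Real.exp (-β * h i) / ∑ i, Real.exp (-β * h i))
    (udiag_isHermitian Q fun i => w i / ∑ i, w i)
  rw [hT]
  simp_rw [e1 h]
  have t1 := re_trace_gibbs_sub_le hP hQ hS hβ hη (e2 h) (e2 h')
  have t2 := (Complex.re_le_norm _).trans (norm_trace_mul_udiag_le hQ S fun j =>
    ((Real.exp (-β * h' j) / (∑ i, Real.exp (-β * h' i)) - w j / ∑ i, w i : ℝ) : ℂ))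
  have t3 := sum_abs_normalized_sub_le hL hU (fun j => (Real.exp_pos (-β * h' j)).le) (pos h') hws
    hlow hup
  have t4 : ‖S‖ * ∑ j, ‖((Real.exp (-β * h' j) / (∑ i, Real.exp (-β * h' i)) -
      w j / ∑ i, w i : ℝ) : ℂ)‖ ≤ 2 * (1 - L / U) := by
    simp_rw [Complex.norm_real, Real.norm_eq_abs]
    exact (mul_le_of_le_one_left (Finset.sum_nonneg fun _ _ => abs_nonneg _)
      (norm_le_one_of_mem_unitaryGroup hS)).trans t3
  have e3 : (udiag Q fun j => ((Real.exp (-β * h' j) / (∑ i, Real.exp (-β * h' i)) -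
      w j / ∑ i, w i : ℝ) : ℂ)) = (udiag Q fun j =>
        ((Real.exp (-β * h' j - Real.log (∑ i, Real.exp (-β * h' i))) : ℝ) : ℂ)) -
        udiag Q fun j => ((w j / ∑ i, w i : ℝ) : ℂ) := by
    rw [← udiag_sub]
    congr 1; ext j
    rw [e1 h']; simp
  rw [e3] at t2
  generalize (udiag Q fun j =>
        ((Real.exp (-β * h' j - Real.log (∑ i, Real.exp (-β * h' i))) : ℝ) : ℂ)) = T at *
  generalize (udiag Q fun j => ((w j / ∑ i, w i : ℝ) : ℂ)) = R at *
  generalize (udiag P fun i =>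
        ((Real.exp (-β * h i - Real.log (∑ i, Real.exp (-β * h i))) : ℝ) : ℂ)) = G at *
  have e4 : S * (G - R) = S * (G - T) + S * (T - R) := by noncomm_ring
  rw [e4, Matrix.trace_add, Complex.add_re]
  linarith

end Gibbs

/-! ### The outcome distribution of phase estimation -/

/-! ### Sums of 1/sin² by telescoping cotangents. -/

section CotangentSums

theorem cos_div_sin_le_inv {x : ℝ} (h0 : 0 < x) (hπ : x < Real.pi) :
    Real.cos x / Real.sin x ≤ 1 / x := by
  have hs := Real.sin_pos_of_pos_of_lt_pi h0 hπ
  rw [div_le_div_iff₀ hs h0, one_mul]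
  rcases lt_or_ge x (Real.pi / 2) with h | h
  · have hc := Real.cos_pos_of_mem_Ioo ⟨by linarith, h⟩
    have := Real.le_tan h0.le h
    rw [Real.tan_eq_sin_div_cos, le_div_iff₀ hc] at this
    linarith
  · have hc := Real.cos_nonpos_of_pi_div_two_le_of_le h (by linarith)
    nlinarith

/-- The right side equals sin(2h) / (sin(a-h) sin(a+h)), and sin(a-h) sin(a+h) = sin²a - sin²h ≤
sin²a. -/
theorem sin_div_sin_sq_le {a h : ℝ} (hh : 0 < h) (h0 : 0 < a - h) (hπ : a + h < Real.pi) :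
    Real.sin (2 * h) / Real.sin a ^ 2 ≤
      Real.cos (a - h) / Real.sin (a - h) - Real.cos (a + h) / Real.sin (a + h) := by
  have h1 : 0 < Real.sin (a - h) := Real.sin_pos_of_pos_of_lt_pi h0 (by linarith)
  have h2 : 0 < Real.sin (a + h) := Real.sin_pos_of_pos_of_lt_pi (by linarith) hπ
  have h3 : 0 < Real.sin (2 * h) := Real.sin_pos_of_pos_of_lt_pi (by linarith) (by linarith)
  rw [div_sub_div _ _ h1.ne' h2.ne']
  have e1 : Real.cos (a - h) * Real.sin (a + h) - Real.sin (a - h) * Real.cos (a + h)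
      = Real.sin (2 * h) := by
    rw [show 2 * h = (a + h) - (a - h) by ring, Real.sin_sub (a + h)]; ring
  have e2 : Real.sin (a - h) * Real.sin (a + h) = Real.sin a ^ 2 - Real.sin h ^ 2 := by
    rw [Real.sin_sub, Real.sin_add]
    nlinarith [Real.sin_sq_add_cos_sq a, Real.sin_sq_add_cos_sq h]
  rw [e1]
  refine div_le_div_of_nonneg_left h3.le (mul_pos h1 h2) ?_
  rw [e2]
  linarith [sq_nonneg (Real.sin h)]

/-- Each term is dominated by a cotangent difference over the unit interval centred at it, so the
sum telescopes to two end values. These are bounded by cot x ≤ 1/x, using the distance A to 0 and,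
by reflection, the distance B to N. -/
theorem sum_inv_sin_sq_le {N A B y : ℝ} (m : ℕ) (hN : 1 < N) (hA : 0 < A) (hB : 0 < B)
    (hy : A ≤ y - 1 / 2) (hm : y + m - 1 / 2 ≤ N - B) :
    ∑ i ∈ Finset.range m, 1 / (N ^ 2 * Real.sin (Real.pi * (y + i) / N) ^ 2) ≤
      1 / (Real.pi * (N * Real.sin (Real.pi / N))) * (1 / A + 1 / B) := by
  have hN0 : 0 < N := by linarith
  have hπ := Real.pi_pos
  have hs : 0 < Real.sin (Real.pi / N) :=
    Real.sin_pos_of_pos_of_lt_pi (by positivity) (div_lt_self hπ hN)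
  set F : ℝ → ℝ := fun t => Real.cos (Real.pi * t / N) / Real.sin (Real.pi * t / N) with hF
  have scale : ∀ t, 0 < t → t < N → 0 < Real.pi * t / N ∧ Real.pi * t / N < Real.pi := by
    intro t h1 h2
    refine ⟨by positivity, ?_⟩
    rw [div_lt_iff₀ hN0]
    exact mul_lt_mul_of_pos_left h2 hπ
  have hle : ∀ t, 0 < t → t < N → F t ≤ N / (Real.pi * t) := by
    intro t h1 h2
    have := cos_div_sin_le_inv (scale t h1 h2).1 (scale t h1 h2).2
    rwa [one_div_div] at this
  have hge : ∀ t, 0 < t → t < N → -F t ≤ N / (Real.pi * (N - t)) := by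
    intro t h1 h2
    have h3 := hle (N - t) (by linarith) (by linarith)
    have h4 : F (N - t) = -F t := by
      simp only [hF]
      rw [show Real.pi * (N - t) / N = Real.pi - Real.pi * t / N by field_simp, Real.cos_pi_sub,
        Real.sin_pi_sub, neg_div]
    linarith
  have hterm : ∀ i ∈ Finset.range m, 1 / (N ^ 2 * Real.sin (Real.pi * (y + i) / N) ^ 2) ≤
      1 / (N ^ 2 * Real.sin (Real.pi / N)) *
        (F (y - 1 / 2 + i) - F (y - 1 / 2 + (i + 1 : ℕ))) := by
    intro i hi
    have him : (i : ℝ) + 1 ≤ m := by exact_mod_cast Finset.mem_range.1 hi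
    have hi0 : (0 : ℝ) ≤ i := Nat.cast_nonneg i
    have key := sin_div_sin_sq_le (a := Real.pi * (y + i) / N) (h := Real.pi * (1 / 2) / N)
      (by positivity) (by rw [← sub_div, ← mul_sub]; exact (scale _ (by linarith) (by linarith)).1)
      (by rw [← add_div, ← mul_add]; exact (scale _ (by linarith) (by linarith)).2)
    rw [← sub_div, ← mul_sub, ← add_div, ← mul_add] at key
    rw [show 2 * (Real.pi * (1 / 2) / N) = Real.pi / N by ring,
      show y + (i : ℝ) - 1 / 2 = y - 1 / 2 + i by ring,
      show y + (i : ℝ) + 1 / 2 = y - 1 / 2 + (i + 1 : ℕ) by push_cast; ring] at key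
    calc 1 / (N ^ 2 * Real.sin (Real.pi * (y + i) / N) ^ 2)
        = 1 / (N ^ 2 * Real.sin (Real.pi / N)) *
          (Real.sin (Real.pi / N) / Real.sin (Real.pi * (y + i) / N) ^ 2) := by field_simp
      _ ≤ _ := mul_le_mul_of_nonneg_left key (by positivity)
  refine (Finset.sum_le_sum hterm).trans ?_
  rw [← Finset.mul_sum, Finset.sum_range_sub' (fun i : ℕ => F (y - 1 / 2 + i))]
  rcases Nat.eq_zero_or_pos m with rfl | hm0
  · simp; positivity
  have hm1 : (1 : ℝ) ≤ m := by exact_mod_cast hm0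
  have b1 := hle (y - 1 / 2) (by linarith) (by linarith)
  have b2 := hge (y - 1 / 2 + m) (by linarith) (by linarith)
  have b3 : N / (Real.pi * (y - 1 / 2)) ≤ N / Real.pi * (1 / A) := by
    rw [← div_div, div_eq_mul_one_div (N / Real.pi)]
    gcongr
  have b4 : N / (Real.pi * (N - (y - 1 / 2 + m))) ≤ N / Real.pi * (1 / B) := by
    rw [← div_div, div_eq_mul_one_div (N / Real.pi)]
    gcongr
    linarith
  calc 1 / (N ^ 2 * Real.sin (Real.pi / N)) * (F (y - 1 / 2 + (0 : ℕ)) - F (y - 1 / 2 + m))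
      ≤ 1 / (N ^ 2 * Real.sin (Real.pi / N)) * (N / Real.pi * (1 / A) + N / Real.pi * (1 / B)) := by
        refine mul_le_mul_of_nonneg_left ?_ (by positivity)
        rw [Nat.cast_zero, add_zero]
        linarith
    _ = _ := by field_simp

/-- As N grows the product tends to π² ≈ 9.87; N ≥ 32 already gives 9.8. -/
theorem pi_mul_mul_sin_ge {N : ℝ} (hN : 32 ≤ N) :
    9.8 ≤ Real.pi * (N * Real.sin (Real.pi / N)) := by
  have h1 := Real.pi_gt_d2
  have h2 := Real.pi_lt_d2
  have hN0 : 0 < N := by linarith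
  have hx : Real.pi / N ≤ 0.1 := by rw [div_le_iff₀ hN0]; nlinarith
  have hx0 : 0 < Real.pi / N := by positivity
  have hs := Real.sin_gt_sub_cube hx0
  have hb : 0.9975 * (Real.pi / N) ≤ Real.sin (Real.pi / N) := by
    have : (Real.pi / N) ^ 2 ≤ 0.01 := by nlinarith
    nlinarith
  have h3 : 0.9975 * Real.pi ≤ N * Real.sin (Real.pi / N) := by
    calc 0.9975 * Real.pi = N * (0.9975 * (Real.pi / N)) := by field_simp
      _ ≤ _ := by gcongr
  have h4 := Real.pi_gt_d4
  nlinarith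

/-- Compensates the factor 1/(x + 1/2) caused by outcomes that wrap around modulo 2^n. The range
goes below 0 because the perturbed Hamiltonian may have slightly negative energies. -/
theorem sin_sq_pi_mul_le {δ : ℝ} (h : -0.01 ≤ δ) :
    Real.sin (Real.pi * δ) ^ 2 ≤ 1.08 * (δ + 1 / 2) := by
  have hπ := Real.pi_pos
  rcases le_total (1 / 2) δ with h1 | h1
  · have := Real.sin_sq_le_one (Real.pi * δ)
    linarith
  rcases le_total 0 δ with h2 | h2
  · have e : Real.sin (Real.pi * δ) = Real.cos (Real.pi * (1 / 2 - δ)) := by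
      rw [← Real.cos_pi_div_two_sub]; congr 1; ring
    have hs := Real.mul_le_sin (x := Real.pi * (1 / 2 - δ)) (by apply mul_nonneg <;> linarith)
      (by nlinarith)
    have e2 : 2 / Real.pi * (Real.pi * (1 / 2 - δ)) = 1 - 2 * δ := by field_simp
    rw [e2] at hs
    rw [e]
    have := Real.sin_sq_add_cos_sq (Real.pi * (1 / 2 - δ))
    nlinarith [sq_nonneg (8 * (1 / 2 - δ) - 1.08)]
  · have h3 := Real.abs_sin_le_one (Real.pi * δ)
    have h4 : |Real.sin (Real.pi * δ)| ≤ |Real.pi * δ| := Real.abs_sin_le_abs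
    rw [abs_mul, abs_of_pos hπ, abs_of_nonpos h2] at h4
    have h5 : |Real.sin (Real.pi * δ)| ≤ 0.04 := by nlinarith [Real.pi_lt_four]
    rw [← sq_abs]
    nlinarith [abs_nonneg (Real.sin (Real.pi * δ))]

end CotangentSums

/-! ### The distribution of a single phase estimate and its tails. -/

section Distribution

variable {n : ℕ}

/-- The state of an energy register before the inverse Fourier transform. -/
noncomputable def phaseVec (n : ℕ) (θ : ℝ) (c : Fin (2 ^ n)) : ℂ :=
  Complex.exp (2 * Real.pi * Complex.I * θ * (c.val : ℂ)) / ((Real.sqrt (2 ^ n) : ℝ) : ℂ)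

/-- The state of an energy register after phase estimation of the phase `θ`. -/
noncomputable def phaseAmp (n : ℕ) (θ : ℝ) : Fin (2 ^ n) → ℂ := inverseQFT n *ᵥ phaseVec n θ

/-- The probability of the estimate `b` in phase estimation of the phase `θ`. -/
noncomputable def phaseProb (n : ℕ) (θ : ℝ) (b : Fin (2 ^ n)) : ℝ := ‖phaseAmp n θ b‖ ^ 2

theorem phaseProb_nonneg (θ : ℝ) (b : Fin (2 ^ n)) : 0 ≤ phaseProb n θ b := sq_nonneg _

theorem sqrt_two_pow_mul_self (n : ℕ) :
    ((Real.sqrt (2 ^ n) : ℝ) : ℂ) * ((Real.sqrt (2 ^ n) : ℝ) : ℂ) = 2 ^ n := by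
  rw [← Complex.ofReal_mul, Real.mul_self_sqrt (by positivity)]
  push_cast; rfl

theorem inverseQFT_mem_unitaryGroup (n : ℕ) :
    inverseQFT n ∈ Matrix.unitaryGroup (Fin (2 ^ n)) ℂ := by
  rw [Matrix.mem_unitaryGroup_iff]
  ext b b'
  have hN : (2 ^ n : ℂ) ≠ 0 := by positivity
  have hstar : ∀ c : Fin (2 ^ n), inverseQFT n b c * star (inverseQFT n b' c) =
      Complex.exp (2 * Real.pi * Complex.I * (((b'.val : ℤ) - (b.val : ℤ) : ℤ) : ℂ) / 2 ^ n)
        ^ (c.val) / 2 ^ n := by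
    intro c
    simp only [inverseQFT, Complex.star_def, map_div₀, Complex.conj_ofReal, ← Complex.exp_conj]
    rw [div_mul_div_comm, sqrt_two_pow_mul_self, ← Complex.exp_add, ← Complex.exp_nat_mul]
    congr 2
    have h2c : (starRingEnd ℂ) 2 = 2 := map_ofNat _ 2
    simp [h2c]
    field_simp
    ring
  rw [Matrix.mul_apply]
  simp_rw [Matrix.star_apply, hstar]
  rw [← Finset.sum_div, Fin.sum_univ_eq_sum_range (fun c =>
    Complex.exp (2 * Real.pi * Complex.I * (((b'.val : ℤ) - (b.val : ℤ) : ℤ) : ℂ) / 2 ^ n) ^ c)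
    (2 ^ n)]
  by_cases h : b = b'
  · subst h
    simp
  · rw [Matrix.one_apply_ne h]
    set w := Complex.exp (2 * Real.pi * Complex.I * (((b'.val : ℤ) - (b.val : ℤ) : ℤ) : ℂ) / 2 ^ n)
      with hw
    have hw1 : w ≠ 1 := by
      rw [hw, Ne, Complex.exp_eq_one_iff]
      rintro ⟨m, hm⟩
      have h2 : (((b'.val : ℤ) - (b.val : ℤ) : ℤ) : ℂ) = ((m * 2 ^ n : ℤ) : ℂ) := by
        have hI : (2 * Real.pi * Complex.I : ℂ) ≠ 0 := Complex.two_pi_I_ne_zero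
        rw [mul_div_assoc, mul_comm (m : ℂ)] at hm
        have := mul_left_cancel₀ hI hm
        rw [div_eq_iff hN] at this
        rw [this]; push_cast; rfl
      have h3 : (b'.val : ℤ) - b.val = m * 2 ^ n := by exact_mod_cast h2
      have hb : (b.val : ℤ) < 2 ^ n := by exact_mod_cast b.2
      have hb' : (b'.val : ℤ) < 2 ^ n := by exact_mod_cast b'.2
      have hpos : (0 : ℤ) < 2 ^ n := by positivity
      have hm0 : m = 0 := by
        by_contra hne
        rcases lt_or_gt_of_ne hne with h4 | h4
        · nlinarith
        · nlinarith
      rw [hm0, zero_mul] at h3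
      exact h (Fin.ext (by omega))
    have hwN : w ^ (2 ^ n) = 1 := by
      rw [hw, ← Complex.exp_nat_mul, Complex.exp_eq_one_iff]
      refine ⟨(b'.val : ℤ) - (b.val : ℤ), ?_⟩
      push_cast; field_simp
    rw [geom_sum_eq hw1, hwN, sub_self, zero_div, zero_div]

theorem sum_sq_norm_unitary_mulVec {ι : Type*} [Fintype ι] [DecidableEq ι] {W : Matrix ι ι ℂ}
    (hW : W ∈ Matrix.unitaryGroup ι ℂ) (x : ι → ℂ) :
    ∑ i, ‖(W *ᵥ x) i‖ ^ 2 = ∑ i, ‖x i‖ ^ 2 := by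
  have h1 : ∀ y : ι → ℂ, ((∑ i, ‖y i‖ ^ 2 : ℝ) : ℂ) = star y ⬝ᵥ y := by
    intro y
    simp only [dotProduct, Pi.star_apply]
    push_cast
    refine Finset.sum_congr rfl fun i _ => ?_
    rw [Complex.star_def, mul_comm, Complex.mul_conj, Complex.normSq_eq_norm_sq]
    push_cast; rfl
  have h2 : ((∑ i, ‖(W *ᵥ x) i‖ ^ 2 : ℝ) : ℂ) = ((∑ i, ‖x i‖ ^ 2 : ℝ) : ℂ) := by
    rw [h1, h1, Matrix.star_mulVec, Matrix.dotProduct_mulVec, Matrix.vecMul_vecMul,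
      conjTranspose_mul_self_of_mem hW, Matrix.vecMul_one]
  exact_mod_cast h2

theorem sum_phaseProb (n : ℕ) (θ : ℝ) : ∑ b, phaseProb n θ b = 1 := by
  simp only [phaseProb, phaseAmp]
  rw [sum_sq_norm_unitary_mulVec (inverseQFT_mem_unitaryGroup n)]
  have h : ∀ c, ‖phaseVec n θ c‖ ^ 2 = 1 / 2 ^ n := fun c => by
    rw [phaseVec, norm_div, div_pow, Complex.norm_real, Real.norm_of_nonneg (Real.sqrt_nonneg _),
      Real.sq_sqrt (by positivity), show (2 * Real.pi * Complex.I * θ * (c.val : ℂ))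
      = ((2 * Real.pi * θ * c.val : ℝ) : ℂ) * Complex.I by push_cast; ring,
      Complex.norm_exp_ofReal_mul_I, one_pow]
  simp_rw [h]
  simp

theorem sq_norm_one_sub_exp (x : ℝ) :
    ‖1 - Complex.exp ((2 * Real.pi * x : ℝ) * Complex.I)‖ ^ 2 = 4 * Real.sin (Real.pi * x) ^ 2 := by
  rw [← Complex.normSq_eq_norm_sq, Complex.normSq_apply]
  simp only [Complex.sub_re, Complex.sub_im, Complex.one_re, Complex.one_im,
    Complex.exp_ofReal_mul_I_re, Complex.exp_ofReal_mul_I_im]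
  rw [show 2 * Real.pi * x = 2 * (Real.pi * x) by ring, Real.cos_two_mul, Real.sin_two_mul]
  have := Real.sin_sq_add_cos_sq (Real.pi * x)
  have e : Real.cos (Real.pi * x) ^ 2 = 1 - Real.sin (Real.pi * x) ^ 2 := by linarith
  ring_nf
  rw [show Real.cos (Real.pi * x) ^ 4 = (Real.cos (Real.pi * x) ^ 2) ^ 2 by ring, e]
  ring

/-- The amplitude is a geometric sum with ratio w = e^{2πi(θ - b/2^n)}. Stated without division, so
that it also holds when w = 1. -/
theorem phaseProb_mul (θ : ℝ) (b : Fin (2 ^ n)) :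
    phaseProb n θ b * ((2 ^ n) ^ 2 * Real.sin (Real.pi * (θ - b.val / 2 ^ n)) ^ 2)
      = Real.sin (Real.pi * (2 ^ n * θ)) ^ 2 := by
  set w := Complex.exp ((2 * Real.pi * (θ - b.val / 2 ^ n) : ℝ) * Complex.I) with hw
  have hN : (2 ^ n : ℂ) ≠ 0 := by positivity
  have hamp : phaseAmp n θ b = (∑ c ∈ Finset.range (2 ^ n), w ^ c) / 2 ^ n := by
    rw [phaseAmp, Matrix.mulVec, dotProduct, ← Fin.sum_univ_eq_sum_range, Finset.sum_div]
    refine Finset.sum_congr rfl fun c _ => ?_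
    rw [inverseQFT, phaseVec, div_mul_div_comm, sqrt_two_pow_mul_self, ← Complex.exp_add, hw,
      ← Complex.exp_nat_mul]
    congr 2
    push_cast
    ring
  have h1 : phaseAmp n θ b * 2 ^ n * (1 - w) = 1 - w ^ (2 ^ n) := by
    rw [hamp, div_mul_cancel₀ _ hN, geom_sum_mul_neg]
  have h2 : w ^ (2 ^ n) = Complex.exp ((2 * Real.pi * (2 ^ n * θ) : ℝ) * Complex.I) := by
    rw [hw, ← Complex.exp_nat_mul]
    rw [Complex.exp_eq_exp_iff_exists_int]
    refine ⟨-b.val, ?_⟩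
    push_cast; field_simp; ring
  have h3 := congrArg (fun z => ‖z‖ ^ 2) h1
  simp only [norm_mul, mul_pow, norm_pow, Complex.norm_ofNat] at h3
  rw [h2, sq_norm_one_sub_exp, sq_norm_one_sub_exp] at h3
  rw [phaseProb]
  linarith

theorem phaseProb_eq_of_abs {θ : ℝ} (b : Fin (2 ^ n)) {y : ℝ}
    (hy : y = 2 ^ n * θ - b.val ∨ y = b.val - 2 ^ n * θ) (h0 : 0 < y) (hN : y < 2 ^ n) :
    phaseProb n θ b = Real.sin (Real.pi * (2 ^ n * θ)) ^ 2 *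
      (1 / ((2 ^ n) ^ 2 * Real.sin (Real.pi * y / 2 ^ n) ^ 2)) := by
  have hp : (0 : ℝ) < 2 ^ n := by positivity
  have hs : Real.sin (Real.pi * (θ - b.val / 2 ^ n)) ^ 2 = Real.sin (Real.pi * y / 2 ^ n) ^ 2 := by
    rcases hy with rfl | rfl
    · congr 2; field_simp
    · rw [show Real.pi * (b.val - 2 ^ n * θ) / 2 ^ n = -(Real.pi * (θ - b.val / 2 ^ n)) by
        field_simp; ring, Real.sin_neg, neg_sq]
  have hpos : 0 < Real.sin (Real.pi * y / 2 ^ n) := by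
    refine Real.sin_pos_of_pos_of_lt_pi (by have := Real.pi_pos; positivity) ?_
    rw [div_lt_iff₀ hp]
    exact mul_lt_mul_of_pos_left hN Real.pi_pos
  have := phaseProb_mul θ b
  rw [hs] at this
  rw [← this]
  field_simp

/-- For θ near 0 the largest outcomes are close to θ modulo 1, so the far end contributes 1/(x +
1/2). There the numerator sin²(πx) is small as well, and the product is at most 1.08. The near end
contributes 1/3.5, the offset 4 less half a step. -/
theorem sum_phaseProb_high_le {θ : ℝ} (hN : (32 : ℝ) ≤ 2 ^ n) (h0 : -0.01 ≤ 2 ^ n * θ) :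
    ∑ b : Fin (2 ^ n), (if 2 ^ n * θ + 4 < (b.val : ℝ) then phaseProb n θ b else 0) ≤ 0.14 := by
  set x := 2 ^ n * θ with hx
  have hp : (0 : ℝ) < 2 ^ n := by positivity
  set f : ℕ → ℝ := fun b => 1 / ((2 ^ n) ^ 2 * Real.sin (Real.pi * (b - x) / 2 ^ n) ^ 2) with hf
  have h1 : ∀ b : Fin (2 ^ n), (if x + 4 < (b.val : ℝ) then phaseProb n θ b else 0)
      = Real.sin (Real.pi * x) ^ 2 * (if x + 4 < (b.val : ℝ) then f b.val else 0) := by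
    intro b
    split_ifs with h
    · have hb : (b.val : ℝ) + 1 ≤ 2 ^ n := by exact_mod_cast b.2
      exact phaseProb_eq_of_abs b (Or.inr rfl) (by linarith) (by linarith)
    · simp
  simp_rw [h1]
  rw [← Finset.mul_sum, Fin.sum_univ_eq_sum_range (fun b => if x + 4 < (b : ℝ) then f b else 0),
    ← Finset.sum_filter]
  have h2 : (Finset.range (2 ^ n)).filter (fun b : ℕ => x + 4 < (b : ℝ))
      = Finset.Ico (⌊x + 4⌋₊ + 1) (2 ^ n) := by
    ext b
    simp only [Finset.mem_filter, Finset.mem_range, Finset.mem_Ico, Nat.succ_le_iff,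
      Nat.floor_lt (show 0 ≤ x + 4 by linarith)]
    tauto
  rw [h2, Finset.sum_Ico_eq_sum_range]
  set p := ⌊x + 4⌋₊ + 1 with hpdef
  have hpx : x + 4 < p := by rw [hpdef]; push_cast; exact Nat.lt_floor_add_one _
  have h3 : ∑ i ∈ Finset.range (2 ^ n - p), f (p + i) ≤
      1 / (Real.pi * (2 ^ n * Real.sin (Real.pi / 2 ^ n))) * (1 / 3.5 + 1 / (x + 1 / 2)) := by
    rcases le_total p (2 ^ n) with hle | hle
    · have := sum_inv_sin_sq_le (N := 2 ^ n) (A := 3.5) (B := x + 1 / 2) (y := p - x) (2 ^ n - p)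
        (by linarith) (by norm_num) (by linarith) (by linarith)
        (by rw [Nat.cast_sub hle]; push_cast; linarith)
      refine le_trans (le_of_eq ?_) this
      refine Finset.sum_congr rfl fun i _ => ?_
      simp only [hf]
      push_cast
      congr 5
      ring
    · rw [Nat.sub_eq_zero_of_le hle, Finset.sum_range_zero]
      have := pi_mul_mul_sin_ge hN
      have h5 : 0 < x + 1 / 2 := by linarith
      positivity
  have h4 : 1 / (Real.pi * (2 ^ n * Real.sin (Real.pi / 2 ^ n))) ≤ 1 / 9.8 :=
    one_div_le_one_div_of_le (by norm_num) (pi_mul_mul_sin_ge hN)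
  have h5 : 0 < x + 1 / 2 := by linarith
  have h6 := sin_sq_pi_mul_le h0
  have h7 := Real.sin_sq_le_one (Real.pi * x)
  calc _ ≤ Real.sin (Real.pi * x) ^ 2 * (1 / 9.8 * (1 / 3.5 + 1 / (x + 1 / 2))) := by
        refine mul_le_mul_of_nonneg_left (h3.trans ?_) (sq_nonneg _)
        gcongr
    _ = 1 / 9.8 * (Real.sin (Real.pi * x) ^ 2 * (1 / 3.5) +
          Real.sin (Real.pi * x) ^ 2 / (x + 1 / 2)) := by ring
    _ ≤ 1 / 9.8 * (1 * (1 / 3.5) + 1.08) := by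
        gcongr
        rw [div_le_iff₀ h5]; exact h6
    _ ≤ 0.14 := by norm_num

/-- Here wrapping is harmless: θ ≤ 0.79 and 2^n ≥ 32 leave a gap of at least 0.21 · 32 = 6.72 to the
top of the register, which after half a step gives 6.2. The numerator sin² can be bounded by 1. -/
theorem sum_phaseProb_low_le {θ : ℝ} (hN : (32 : ℝ) ≤ 2 ^ n) (h1 : θ ≤ 0.79) :
    ∑ b : Fin (2 ^ n), (if (b.val : ℝ) < 2 ^ n * θ - 4 then phaseProb n θ b else 0) ≤ 0.046 := by
  set x := 2 ^ n * θ with hx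
  have hp : (0 : ℝ) < 2 ^ n := by positivity
  have hxN : x + 6.72 ≤ 2 ^ n := by
    rw [hx]; nlinarith
  set f : ℕ → ℝ := fun b => 1 / ((2 ^ n) ^ 2 * Real.sin (Real.pi * (x - b) / 2 ^ n) ^ 2) with hf
  have hf0 : ∀ b, 0 ≤ f b := fun b => by positivity
  have h2 : ∀ b : Fin (2 ^ n), (if (b.val : ℝ) < x - 4 then phaseProb n θ b else 0)
      ≤ (if (b.val : ℝ) < x - 4 then f b.val else 0) := by
    intro b
    split_ifs with h
    · have hb : (0 : ℝ) ≤ b.val := Nat.cast_nonneg _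
      rw [phaseProb_eq_of_abs b (Or.inl rfl) (by linarith) (by linarith)]
      exact mul_le_of_le_one_left (hf0 _) (Real.sin_sq_le_one _)
    · exact le_rfl
  refine (Finset.sum_le_sum fun b _ => h2 b).trans ?_
  rw [Fin.sum_univ_eq_sum_range (fun b => if (b : ℝ) < x - 4 then f b else 0),
    ← Finset.sum_filter]
  have h3 : (Finset.range (2 ^ n)).filter (fun b : ℕ => (b : ℝ) < x - 4)
      = Finset.range ⌈x - 4⌉₊ := by
    ext b
    simp only [Finset.mem_filter, Finset.mem_range, Nat.lt_ceil]
    refine ⟨fun h => h.2, fun h => ⟨?_, h⟩⟩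
    have : (b : ℝ) < 2 ^ n := by linarith
    exact_mod_cast this
  rw [h3]
  rcases Nat.eq_zero_or_pos ⌈x - 4⌉₊ with hq | hq
  · rw [hq]; norm_num
  obtain ⟨q, hqe⟩ := Nat.exists_eq_succ_of_ne_zero hq.ne'
  have hqx : (q : ℝ) < x - 4 := Nat.lt_ceil.1 (by omega)
  -- Reversed, so that the distance to x increases along the sum as the telescoping bound requires.
  rw [hqe, ← Finset.sum_range_reflect]
  have key := sum_inv_sin_sq_le (N := 2 ^ n) (A := 3.5) (B := 6.2) (y := x - q) (q + 1)
        (by linarith) (by norm_num) (by linarith) (by linarith) (by push_cast; linarith)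
  have h4 : 1 / (Real.pi * (2 ^ n * Real.sin (Real.pi / 2 ^ n))) ≤ 1 / 9.8 :=
    one_div_le_one_div_of_le (by norm_num) (pi_mul_mul_sin_ge hN)
  calc _ = ∑ i ∈ Finset.range (q + 1),
        1 / ((2 ^ n) ^ 2 * Real.sin (Real.pi * (x - q + i) / 2 ^ n) ^ 2) := by
        refine Finset.sum_congr rfl fun i hi => ?_
        have hiq : i ≤ q := Nat.lt_succ_iff.1 (Finset.mem_range.1 hi)
        simp only [hf]
        rw [show q.succ - 1 - i = q - i by omega, Nat.cast_sub hiq,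
          show x - ((q : ℝ) - i) = x - q + i by ring]
    _ ≤ _ := key
    _ ≤ 1 / 9.8 * (1 / 3.5 + 1 / 6.2) := by gcongr
    _ ≤ 0.046 := by norm_num

end Distribution

/-! ### The median of independent estimates -/

section Median

theorem sum_prod_eq_pow {α : Type*} [Fintype α] [DecidableEq α] (k : ℕ) (f : α → ℝ) :
    ∑ e : Fin k → α, ∏ l, f (e l) = (∑ b, f b) ^ k := by
  have := Finset.prod_univ_sum (fun _ : Fin k => (Finset.univ : Finset α)) (fun _ b => f b)
  rw [Fintype.piFinset_univ] at this
  rw [← this, Finset.prod_const, Finset.card_univ, Fintype.card_fin]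

/-- A Chernoff bound: the probability that at least half of `k` independent samples fall into a
set of probability at most `q`. -/
theorem chernoff_half {α : Type*} [Fintype α] [DecidableEq α] (k : ℕ) (p : α → ℝ)
    (hp : ∀ b, 0 ≤ p b) (hp1 : ∑ b, p b = 1) (S : α → Prop) [DecidablePred S] {q s : ℝ}
    (hs : 1 ≤ s) (hq : ∑ b, (if S b then p b else 0) ≤ q) :
    ∑ e : Fin k → α, (∏ l, p (e l)) *
        (if k ≤ 2 * (Finset.univ.filter fun l => S (e l)).card then 1 else 0)
      ≤ ((1 + (s ^ 2 - 1) * q) / s) ^ k := by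
  have hs0 : 0 < s := by linarith
  -- Exponential tilting: each sample contributes s if it lies in S and 1/s if not, so the product
  -- is at least 1 when at least half of them lie in S.
  have h1 : ∀ e : Fin k → α, (∏ l, p (e l)) *
        (if k ≤ 2 * (Finset.univ.filter fun l => S (e l)).card then 1 else 0)
      ≤ ∏ l, (p (e l) * ((if S (e l) then s ^ 2 else 1) / s)) := by
    intro e
    rw [Finset.prod_mul_distrib, Finset.prod_div_distrib, Finset.prod_const, Finset.card_univ,
      Fintype.card_fin, Finset.prod_ite, Finset.prod_const, Finset.prod_const_one, mul_one,
      ← pow_mul]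
    refine mul_le_mul_of_nonneg_left ?_ (Finset.prod_nonneg fun l _ => hp _)
    split_ifs with h
    · rw [one_le_div (by positivity)]
      exact pow_le_pow_right₀ hs h
    · positivity
  refine (Finset.sum_le_sum fun e _ => h1 e).trans ?_
  rw [sum_prod_eq_pow k fun b => p b * ((if S b then s ^ 2 else 1) / s)]
  have h2 : ∀ b, p b * ((if S b then s ^ 2 else 1) / s)
      = (p b + (s ^ 2 - 1) * (if S b then p b else 0)) / s := by
    intro b; split_ifs <;> ring
  simp_rw [h2]
  rw [← Finset.sum_div, Finset.sum_add_distrib, hp1, ← Finset.mul_sum]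
  have h3 : 0 ≤ ∑ b, (if S b then p b else 0) :=
    Finset.sum_nonneg fun b _ => by split_ifs <;> [exact hp b; exact le_rfl]
  have h4 : 0 ≤ s ^ 2 - 1 := by nlinarith
  gcongr

variable {n k : ℕ}

theorem card_filter_comp_perm {α : Type*} (e : Fin k → α) (σ : Equiv.Perm (Fin k)) (S : α → Prop)
    [DecidablePred S] : (Finset.univ.filter fun l => S (e (σ l))).card
      = (Finset.univ.filter fun l => S (e l)).card := by
  refine Finset.card_bij (fun l _ => σ l) ?_ ?_ ?_
  · intro l hl; simpa using hl
  · intro a _ b _ h; exact σ.injective h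
  · intro b hb; exact ⟨σ.symm b, by simpa using hb, by simp⟩

/-- After sorting, all positions from ⌊k/2⌋ on exceed x, which makes at least half of them. In the
mirrored lemma the positions 0, …, ⌊k/2⌋ do the same. For k = 0 there is nothing to count. -/
theorem le_two_mul_card_of_lt_median (e : Fin k → Fin (2 ^ n)) (x : ℝ)
    (h : x < ((median e).val : ℝ)) :
    k ≤ 2 * (Finset.univ.filter fun l => x < ((e l).val : ℝ)).card := by
  rcases Nat.eq_zero_or_pos k with rfl | hk
  · simp
  rw [median, dif_pos hk] at h
  set i₀ : Fin k := ⟨k / 2, Nat.div_lt_self hk one_lt_two⟩ with hi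
  rw [← card_filter_comp_perm e (Tuple.sort e) fun b => x < (b.val : ℝ)]
  have hsub : Finset.Ici i₀ ⊆ Finset.univ.filter fun l => x < ((e (Tuple.sort e l)).val : ℝ) := by
    intro i hi'
    have hm := Tuple.monotone_sort e (Finset.mem_Ici.1 hi')
    rw [Finset.mem_filter]
    refine ⟨Finset.mem_univ _, h.trans_le ?_⟩
    exact_mod_cast hm
  have := Finset.card_le_card hsub
  rw [Fin.card_Ici] at this
  simp only [hi] at this
  omega

theorem le_two_mul_card_of_median_lt (e : Fin k → Fin (2 ^ n)) (x : ℝ)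
    (h : ((median e).val : ℝ) < x) :
    k ≤ 2 * (Finset.univ.filter fun l => ((e l).val : ℝ) < x).card := by
  rcases Nat.eq_zero_or_pos k with rfl | hk
  · simp
  rw [median, dif_pos hk] at h
  set i₀ : Fin k := ⟨k / 2, Nat.div_lt_self hk one_lt_two⟩ with hi
  rw [← card_filter_comp_perm e (Tuple.sort e) fun b => (b.val : ℝ) < x]
  have hsub : Finset.Iic i₀ ⊆ Finset.univ.filter fun l => ((e (Tuple.sort e l)).val : ℝ) < x := by
    intro i hi'
    have hm := Tuple.monotone_sort e (Finset.mem_Iic.1 hi')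
    rw [Finset.mem_filter]
    refine ⟨Finset.mem_univ _, lt_of_le_of_lt ?_ h⟩
    exact_mod_cast hm
  have := Finset.card_le_card hsub
  rw [Fin.card_Iic] at this
  simp only [hi] at this
  omega

/-- The probability of the estimates `e`. -/
noncomputable def estimateProb (n k : ℕ) (θ : ℝ) (e : Fin k → Fin (2 ^ n)) : ℝ :=
  ∏ l, phaseProb n θ (e l)

theorem estimateProb_nonneg (θ : ℝ) (e : Fin k → Fin (2 ^ n)) : 0 ≤ estimateProb n k θ e :=
  Finset.prod_nonneg fun _ _ => phaseProb_nonneg _ _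

theorem sum_estimateProb (n k : ℕ) (θ : ℝ) : ∑ e, estimateProb n k θ e = 1 := by
  simp only [estimateProb]
  rw [sum_prod_eq_pow, sum_phaseProb, one_pow]

/-- The probability that an eigenstate of phase `θ` is accepted by the preparation: the expectation
of the Boltzmann factor of the median estimate. -/
noncomputable def weight (n k : ℕ) (β θ : ℝ) : ℝ :=
  ∑ e : Fin k → Fin (2 ^ n), estimateProb n k θ e * Real.exp (-β * ((median e).val / 2 ^ n))

theorem median_div_le_one (e : Fin k → Fin (2 ^ n)) : ((median e).val : ℝ) / 2 ^ n ≤ 1 := by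
  rw [div_le_one (by positivity)]
  exact_mod_cast (median e).2.le

theorem weight_le_one {β : ℝ} (hβ : 0 ≤ β) (θ : ℝ) : weight n k β θ ≤ 1 := by
  rw [← sum_estimateProb n k θ, weight]
  refine Finset.sum_le_sum fun e _ => mul_le_of_le_one_right (estimateProb_nonneg _ _) ?_
  rw [Real.exp_le_one_iff]
  have : 0 ≤ ((median e).val : ℝ) / 2 ^ n := by positivity
  nlinarith

theorem exp_neg_le_weight {β : ℝ} (hβ : 0 ≤ β) (θ : ℝ) : Real.exp (-β) ≤ weight n k β θ := by
  calc Real.exp (-β) = ∑ e, estimateProb n k θ e * Real.exp (-β) := by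
        rw [← Finset.sum_mul, sum_estimateProb, one_mul]
    _ ≤ _ := by
        refine Finset.sum_le_sum fun e _ =>
          mul_le_mul_of_nonneg_left ?_ (estimateProb_nonneg _ _)
        rw [Real.exp_le_exp]
        nlinarith [median_div_le_one e]

/-- The tilt 2.5 is near the optimum √((1-q)/q) for q = 0.14 and gives 0.694. What matters later is
0.7² ≤ 1/2. -/
theorem prob_median_high_le {θ : ℝ} (hN : (32 : ℝ) ≤ 2 ^ n) (h0 : -0.01 ≤ 2 ^ n * θ) :
    ∑ e : Fin k → Fin (2 ^ n), estimateProb n k θ e *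
      (if 2 ^ n * θ + 4 < ((median e).val : ℝ) then 1 else 0) ≤ 0.7 ^ k := by
  have h1 := chernoff_half k (phaseProb n θ) (phaseProb_nonneg θ) (sum_phaseProb n θ)
    (fun b => 2 ^ n * θ + 4 < (b.val : ℝ)) (s := 2.5) (by norm_num) (sum_phaseProb_high_le hN h0)
  refine le_trans (Finset.sum_le_sum fun e _ =>
    mul_le_mul_of_nonneg_left ?_ (estimateProb_nonneg _ _)) (h1.trans ?_)
  · split_ifs with h h2 h2
    · exact le_rfl
    · exact absurd (le_two_mul_card_of_lt_median e _ h) h2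
    · exact zero_le_one
    · exact le_rfl
  · gcongr
    norm_num

theorem prob_median_low_le {θ : ℝ} (hN : (32 : ℝ) ≤ 2 ^ n) (h0 : θ ≤ 0.79) :
    ∑ e : Fin k → Fin (2 ^ n), estimateProb n k θ e *
      (if ((median e).val : ℝ) < 2 ^ n * θ - 4 then 1 else 0) ≤ (1 / 2) ^ k := by
  have h1 := chernoff_half k (phaseProb n θ) (phaseProb_nonneg θ) (sum_phaseProb n θ)
    (fun b => (b.val : ℝ) < 2 ^ n * θ - 4) (s := 4) (by norm_num) (sum_phaseProb_low_le hN h0)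
  refine le_trans (Finset.sum_le_sum fun e _ =>
    mul_le_mul_of_nonneg_left ?_ (estimateProb_nonneg _ _)) (h1.trans ?_)
  · split_ifs with h h2 h2
    · exact le_rfl
    · exact absurd (le_two_mul_card_of_median_lt e _ h) h2
    · exact zero_le_one
    · exact le_rfl
  · exact pow_le_pow_left₀ (by norm_num) (by norm_num) k

/-- When the median is too high the Boltzmann factor is still at least e^{-β}, since encoded
energies are below 1. Keeping this floor allows a failure probability of order e^{-β/2} only. -/
theorem weight_ge {β θ : ℝ} (hβ : 0 ≤ β) (hN : (32 : ℝ) ≤ 2 ^ n) (h0 : -0.01 ≤ 2 ^ n * θ) :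
    ∃ p, 0 ≤ p ∧ p ≤ 0.7 ^ k ∧
      (1 - p) * (Real.exp (-β * θ) * Real.exp (-(4 * β / 2 ^ n))) + p * Real.exp (-β)
        ≤ weight n k β θ := by
  have hp : (0 : ℝ) < 2 ^ n := by positivity
  refine ⟨_, Finset.sum_nonneg fun e _ => mul_nonneg (estimateProb_nonneg θ e)
    (by split_ifs <;> norm_num), prob_median_high_le hN h0, ?_⟩
  nth_rewrite 1 [← sum_estimateProb n k θ]
  rw [← Finset.sum_sub_distrib, Finset.sum_mul, Finset.sum_mul, ← Finset.sum_add_distrib]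
  refine Finset.sum_le_sum fun e _ => ?_
  rw [show ∀ P i x y : ℝ, (P - P * i) * x + P * i * y = P * ((1 - i) * x + i * y) by
    intros; ring]
  refine mul_le_mul_of_nonneg_left ?_ (estimateProb_nonneg _ _)
  split_ifs with h
  · rw [sub_self, zero_mul, zero_add, one_mul, Real.exp_le_exp]
    nlinarith [median_div_le_one e]
  · rw [sub_zero, one_mul, zero_mul, add_zero, ← Real.exp_add, Real.exp_le_exp]
    push Not at h
    have : ((median e).val : ℝ) / 2 ^ n ≤ θ + 4 / 2 ^ n := by
      rw [div_le_iff₀ hp, add_mul, div_mul_cancel₀ _ hp.ne']; linarith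
    have e1 : 4 * β / 2 ^ n = β * (4 / 2 ^ n) := by ring
    rw [e1]
    nlinarith

/-- A median that is too low can make the Boltzmann factor as large as 1, so its probability enters
undiminished and has to be compared with e^{-β}. -/
theorem weight_le {β θ : ℝ} (hβ : 0 ≤ β) (hN : (32 : ℝ) ≤ 2 ^ n) (h0 : θ ≤ 0.79) :
    weight n k β θ ≤ Real.exp (-β * θ) * Real.exp (4 * β / 2 ^ n) + (1 / 2) ^ k := by
  have hp : (0 : ℝ) < 2 ^ n := by positivity
  refine le_trans ?_ (add_le_add_right (prob_median_low_le (k := k) hN h0) _)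
  nth_rewrite 1 [← one_mul (Real.exp (-β * θ))]
  nth_rewrite 1 [← sum_estimateProb n k θ]
  rw [mul_assoc, Finset.sum_mul, ← Finset.sum_add_distrib]
  refine Finset.sum_le_sum fun e _ => ?_
  rw [← mul_add]
  refine mul_le_mul_of_nonneg_left ?_ (estimateProb_nonneg _ _)
  split_ifs with h
  · have h1 : Real.exp (-β * ((median e).val / 2 ^ n)) ≤ 1 := by
      rw [Real.exp_le_one_iff]
      have : 0 ≤ ((median e).val : ℝ) / 2 ^ n := by positivity
      nlinarith
    have := Real.exp_pos (-β * θ)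
    have := Real.exp_pos (4 * β / 2 ^ n)
    nlinarith
  · rw [add_zero, ← Real.exp_add, Real.exp_le_exp]
    push Not at h
    have : θ - 4 / 2 ^ n ≤ ((median e).val : ℝ) / 2 ^ n := by
      rw [le_div_iff₀ hp, sub_mul, div_mul_cancel₀ _ hp.ne']; linarith
    have e1 : 4 * β / 2 ^ n = β * (4 / 2 ^ n) := by ring
    rw [e1]
    nlinarith

end Median

/-! ### The choice of precision and number of repetitions. -/

section Parameters

theorem le_two_pow_ceil_logb {x : ℝ} (hx : 0 < x) : x ≤ 2 ^ ⌈Real.logb 2 x⌉₊ := by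
  have h := Nat.le_ceil (Real.logb 2 x)
  rw [Real.logb_le_iff_le_rpow one_lt_two hx, Real.rpow_natCast] at h
  exact h

theorem two_pow_ceil_logb_le {x : ℝ} (hx : 1 ≤ x) : (2 : ℝ) ^ ⌈Real.logb 2 x⌉₊ ≤ 2 * x := by
  have h0 : 0 < x := by linarith
  have h := (Nat.ceil_lt_add_one (Real.logb_nonneg one_lt_two hx)).le
  have h1 : Real.logb 2 x + 1 = Real.logb 2 (x * 2) := by
    rw [Real.logb_mul h0.ne' two_ne_zero, Real.logb_self_eq_one one_lt_two]
  rw [h1, Real.le_logb_iff_rpow_le one_lt_two (by linarith), Real.rpow_natCast] at h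
  linarith

set_option maxHeartbeats 1000000 in
/-- Up to factors `L ≤ U` with `1 - L / U < ε`, the acceptance probability of an eigenstate is its
Boltzmann factor. -/
theorem exists_weight_bounds {β ε η : ℝ} (hβ : 0 < β) (hε : 0 < ε) (hε1 : ε < 1)
    (hη0 : 0 ≤ η) (hη : β * η ≤ 0.0001 * ε ^ 2) :
    ∃ L U : ℝ, 0.4 ≤ L ∧ 0 < U ∧ 1 - L / U ≤ 0.98 * ε ∧
      ∀ θ, -η ≤ θ → θ ≤ Real.pi / 4 + η →
        L * Real.exp (-β * θ) ≤
            weight (precisionQubits (ε / (32 * β))) (repetitions (Real.exp (-β) * ε ^ 2)) β θ ∧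
          weight (precisionQubits (ε / (32 * β))) (repetitions (Real.exp (-β) * ε ^ 2)) β θ ≤
            U * Real.exp (-β * θ) := by
  have hπ := Real.pi_lt_d4
  have hπ3 := Real.pi_gt_three
  have hη' : β * η ≤ 0.0001 * ε := by nlinarith
  set n := precisionQubits (ε / (32 * β)) with hn
  set k := repetitions (Real.exp (-β) * ε ^ 2) with hk
  have hx0 : 0 < 1 / (ε / (32 * β)) := by positivity
  have hxe : 1 / (ε / (32 * β)) = 32 * β / ε := one_div_div _ _
  have hn1 : 32 * β / ε ≤ 2 ^ n := by
    rw [← hxe]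
    exact le_two_pow_ceil_logb hx0
  have hn2 : ε / 2 < β → (2 : ℝ) ^ n ≤ 2 * (32 * β / ε) := by
    intro h
    rw [← hxe]
    refine two_pow_ceil_logb_le ?_
    rw [hxe, one_le_div hε]; linarith
  have hkk : (1 / 2 : ℝ) ^ k ≤ Real.exp (-β) * ε ^ 2 := by
    have h0 : 0 < Real.exp (-β) * ε ^ 2 := by positivity
    have := le_two_pow_ceil_logb (one_div_pos.2 h0)
    rw [one_div_pow]
    rw [one_div_le (by positivity) h0]
    exact this
  clear_value n k
  -- For β ≤ ε/2 the register may be too short for the tail bounds, but then every weight lies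
  -- between e^{-β} and 1, which is close enough. Otherwise 32β/ε > 16 forces n ≥ 5.
  rcases le_or_gt β (ε / 2) with hsmall | hlarge
  · refine ⟨Real.exp (-(β + β * η)), Real.exp (β * (Real.pi / 4 + η)), ?_, Real.exp_pos _, ?_, ?_⟩
    · have := Real.add_one_le_exp (-(β + β * η))
      norm_num at *
      linarith
    · rw [← Real.exp_sub]
      have := Real.add_one_le_exp (-(β + β * η) - β * (Real.pi / 4 + η))
      nlinarith
    · intro θ h1 h2
      constructor
      · refine le_trans ?_ (exp_neg_le_weight hβ.le θ)
        rw [← Real.exp_add, Real.exp_le_exp]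
        nlinarith
      · refine (weight_le_one hβ.le θ).trans ?_
        rw [← Real.exp_add]
        apply Real.one_le_exp
        nlinarith
  · have hp : (0 : ℝ) < 2 ^ n := by positivity
    have h16 : (16 : ℝ) < 2 ^ n := lt_of_lt_of_le (by rw [lt_div_iff₀ hε]; linarith) hn1
    have hn5 : 5 ≤ n := by
      by_contra hcon
      have h4 : n ≤ 4 := by omega
      have : (2 : ℝ) ^ n ≤ 2 ^ 4 := pow_le_pow_right₀ (by norm_num) h4
      norm_num at this
      linarith
    have hN : (32 : ℝ) ≤ 2 ^ n := by
      have : (2 : ℝ) ^ 5 ≤ 2 ^ n := pow_le_pow_right₀ (by norm_num) hn5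
      norm_num at this
      exact this
    have hn2 : 2 ^ n * ε ≤ 64 * β := by
      calc 2 ^ n * ε ≤ 2 * (32 * β / ε) * ε := by gcongr; exact hn2 hlarge
        _ = 64 * β := by field_simp; ring
    -- Since β > ε/2, the bound on βη also makes η small compared with one step 2^{-n} of the
    -- register, so energies in [-η, π/4 + η] satisfy the hypotheses of the tail bounds.
    have hηs : η ≤ 0.0002 := by nlinarith
    have hNη : 2 ^ n * η ≤ 0.01 := by
      have h1 : (2 ^ n * ε) * η ≤ 64 * β * η := by gcongr
      have h2 : ε * (2 ^ n * η) ≤ ε * 0.01 := by nlinarith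
      exact le_of_mul_le_mul_left h2 hε
    have hshift : 4 * β / 2 ^ n ≤ ε / 8 := by
      rw [div_le_iff₀ hp]
      rw [div_le_iff₀ hε] at hn1
      linarith
    have hshift0 : 0 ≤ 4 * β / 2 ^ n := by positivity
    -- 0.7² ≤ 1/2, so this failure probability is at most the square root of ε_fail = e^{-β}ε².
    have h7 : (0.7 : ℝ) ^ k ≤ ε * Real.exp (-β / 2) := by
      refine le_of_pow_le_pow_left₀ two_ne_zero (by positivity) ?_
      rw [← pow_mul, mul_comm k 2, pow_mul, mul_pow, ← Real.exp_nat_mul]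
      calc (0.7 ^ 2 : ℝ) ^ k ≤ (1 / 2) ^ k := by gcongr; norm_num
        _ ≤ _ := hkk
        _ = _ := by rw [mul_comm]; congr 2; push_cast; ring
    -- 0.525 = 1/8 + 0.4 collects the discretization shift and the loss from high medians. In the
    -- upper bound 0.141ε dominates e^{ε/8} - 1, and ε² is the contribution of low medians.
    refine ⟨1 - 0.525 * ε, 1 + 0.141 * ε + ε ^ 2, by norm_num; linarith, by positivity, ?_, ?_⟩
    · have hU : 0 < 1 + 0.141 * ε + ε ^ 2 := by positivity
      rw [sub_le_iff_le_add, ← sub_le_iff_le_add', le_div_iff₀ hU]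
      nlinarith [mul_nonneg hε.le (sq_nonneg (ε - 0.44))]
    · intro θ h1 h2
      have hg := Real.exp_pos (-β * θ)
      constructor
      · obtain ⟨p, hp0, hp7, hw⟩ := weight_ge (k := k) (β := β) (θ := θ) hβ.le hN (by nlinarith)
        refine le_trans ?_ hw
        have e1 := Real.add_one_le_exp (-(4 * β / 2 ^ n))
        have e2 : Real.exp (-β * θ) * Real.exp (-(β + β * η)) ≤ Real.exp (-β) := by
          rw [← Real.exp_add, Real.exp_le_exp]; nlinarith
        set t := Real.exp (-β / 2) with ht
        have ht0 : 0 < t := Real.exp_pos _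
        have ht1 : t ≤ 1 := by rw [ht, Real.exp_le_one_iff]; linarith
        have e3 : t ^ 2 * (1 - 0.0001) ≤ Real.exp (-(β + β * η)) := by
          have e4 : Real.exp (-(β + β * η)) = t ^ 2 * Real.exp (-(β * η)) := by
            rw [ht, ← Real.exp_nat_mul, ← Real.exp_add]; congr 1; push_cast; ring
          rw [e4]
          have := Real.add_one_le_exp (-(β * η))
          gcongr
          linarith
        have hpt := hp7.trans h7
        have hp1 : p ≤ 1 := hpt.trans (by nlinarith)
        have e5 : p * (1 - t ^ 2 * (1 - 0.0001)) ≤ 0.4 * ε := by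
          have h3 : 0 ≤ 1 - t ^ 2 * (1 - 0.0001) := by nlinarith
          -- The maximum of t(1 - t²) on [0, 1] is 2/(3√3) ≈ 0.385, attained at t ≈ 0.577.
          have h4 : t * (1 - t ^ 2 * (1 - 0.0001)) ≤ 0.4 := by
            nlinarith [mul_nonneg (sq_nonneg (t - 0.58)) (by linarith : 0 ≤ t + 1.16)]
          calc p * (1 - t ^ 2 * (1 - 0.0001)) ≤ ε * t * (1 - t ^ 2 * (1 - 0.0001)) := by gcongr
            _ = ε * (t * (1 - t ^ 2 * (1 - 0.0001))) := by ring
            _ ≤ ε * 0.4 := by gcongr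
            _ = _ := by ring
        have e6 : (1 - p) * (1 - ε / 8) + p * (t ^ 2 * (1 - 0.0001)) ≤
            (1 - p) * Real.exp (-(4 * β / 2 ^ n)) + p * Real.exp (-(β + β * η)) := by
          have : 0 ≤ 1 - p := by linarith
          gcongr
          linarith
        have e7 : 1 - 0.525 * ε ≤ (1 - p) * (1 - ε / 8) + p * (t ^ 2 * (1 - 0.0001)) := by
          have h3 := mul_nonneg hp0 hε.le
          have h4 : (1 - p) * (1 - ε / 8) + p * (t ^ 2 * (1 - 0.0001)) =
            1 - ε / 8 + p * ε / 8 - p * (1 - t ^ 2 * (1 - 0.0001)) := by ring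
          rw [h4]
          linarith
        calc (1 - 0.525 * ε) * Real.exp (-β * θ)
            ≤ ((1 - p) * Real.exp (-(4 * β / 2 ^ n)) + p * Real.exp (-(β + β * η))) *
              Real.exp (-β * θ) := mul_le_mul_of_nonneg_right (e7.trans e6) hg.le
          _ = (1 - p) * (Real.exp (-β * θ) * Real.exp (-(4 * β / 2 ^ n))) +
              p * (Real.exp (-β * θ) * Real.exp (-(β + β * η))) := by ring
          _ ≤ _ := by gcongr
      · refine (weight_le (k := k) hβ.le hN (by norm_num at *; linarith)).trans ?_
        have e1 : Real.exp (4 * β / 2 ^ n) ≤ 1 + 0.141 * ε := by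
          have h3 := Real.abs_exp_sub_one_sub_id_le (x := ε / 8) (by
            rw [abs_of_pos (by positivity)]; linarith)
          have h4 := (abs_le.1 h3).2
          have h5 : Real.exp (4 * β / 2 ^ n) ≤ Real.exp (ε / 8) := Real.exp_le_exp.2 hshift
          nlinarith
        have e2 : (1 / 2 : ℝ) ^ k ≤ ε ^ 2 * Real.exp (-β * θ) := by
          refine hkk.trans ?_
          rw [mul_comm]
          gcongr
          nlinarith
        nlinarith

end Parameters

/-! ### The preparation circuit -/

section Gates

variable {D n k : ℕ}

/-- A basis state with the content of the `l`-th energy register replaced. -/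
def setEnergy (x : Basis D n k) (l : Fin k) (b : Fin (2 ^ n)) : Basis D n k :=
  (x.1, (x.2.1, Function.update x.2.2.1 l b, x.2.2.2))

/-- A basis state with the content of the median register replaced. -/
def setMed (x : Basis D n k) (m : Fin (2 ^ n)) : Basis D n k :=
  (x.1, (x.2.1, x.2.2.1, m, x.2.2.2.2))

/-- A basis state with the content of the ancilla replaced. -/
def setAnc (x : Basis D n k) (c : Fin 2) : Basis D n k :=
  (x.1, (x.2.1, x.2.2.1, x.2.2.2.1, c))

/-- A row of a local gate is supported on the basis states that differ only in the register acted
on. This and the next lemmas reduce sums over the whole basis to sums over that register. -/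
theorem sum_onEnergy_mul (l : Fin k) (W : Matrix (Fin (2 ^ n)) (Fin (2 ^ n)) ℂ)
    (x : Basis D n k) (f : Basis D n k → ℂ) :
    ∑ y, onEnergy l W x y * f y = ∑ b, W (energy x l) b * f (setEnergy x l b) := by
  symm
  refine Fintype.sum_of_injective (setEnergy x l) ?_ _ _ ?_ ?_
  · intro b b' h
    have := congrFun (congrArg (fun y : Basis D n k => y.2.2.1) h) l
    simpa [setEnergy] using this
  · intro y hy
    rw [onEnergy, if_neg, zero_mul]
    rintro ⟨h1, h2, h3, h4, h5⟩
    refine hy ⟨energy y l, ?_⟩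
    refine Prod.ext h1 (Prod.ext h2 (Prod.ext ?_ (Prod.ext h3 h4)))
    funext l'
    by_cases hl : l' = l
    · subst hl; simp [setEnergy, energy]
    · simpa [setEnergy, energy, hl] using h5 l' hl
  · intro b
    rw [onEnergy, if_pos]
    · simp [setEnergy, energy]
    · refine ⟨rfl, rfl, rfl, rfl, fun l' hl => ?_⟩
      simp [setEnergy, energy, hl]

theorem sum_controlledU_mul (U : Matrix (Fin D) (Fin D) ℂ) (l : Fin k) (j : Fin n)
    (x : Basis D n k) (f : Basis D n k → ℂ) :
    ∑ y, controlledU U l j x y * f y = ∑ a, (if (energy x l).val.testBit j.val then U x.1 a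
      else (1 : Matrix _ _ ℂ) x.1 a) * f (a, x.2) := by
  symm
  refine Fintype.sum_of_injective (fun a => ((a, x.2) : Basis D n k)) ?_ _ _ ?_ ?_
  · intro b b' h
    exact congrArg Prod.fst h
  · intro y hy
    rw [controlledU, if_neg, zero_mul]
    intro h
    exact hy ⟨y.1, Prod.ext rfl h⟩
  · intro b
    rw [controlledU, if_pos rfl]

theorem sum_medianGate_mul (x : Basis D n k) (f : Basis D n k → ℂ) :
    ∑ y, medianGate D n k x y * f y = f (setMed x (med x - median (energy x))) := by
  rw [Finset.sum_eq_single (setMed x (med x - median (energy x)))]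
  · rw [medianGate, if_pos, one_mul]
    exact ⟨rfl, rfl, rfl, rfl, by simp [setMed, med, energy]⟩
  · intro y _ hy
    rw [medianGate, if_neg, zero_mul]
    rintro ⟨h1, h2, h3, h4, h5⟩
    refine hy ?_
    refine Prod.ext h1.symm (Prod.ext h2.symm (Prod.ext h3.symm (Prod.ext ?_ h4.symm)))
    change med y = med x - median (energy x)
    rw [h5, h3, add_sub_cancel_right]
  · intro h; exact absurd (Finset.mem_univ _) h

theorem sum_rotationGate_mul (β : ℝ) (x : Basis D n k) (f : Basis D n k → ℂ) :
    ∑ y, rotationGate D n k β x y * f y =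
      ∑ c, ((rotation β ((med x).val / 2 ^ n) (anc x) c : ℝ) : ℂ) * f (setAnc x c) := by
  symm
  refine Fintype.sum_of_injective (setAnc x) ?_ _ _ ?_ ?_
  · intro b b' h
    exact congrArg (fun y : Basis D n k => y.2.2.2.2) h
  · intro y hy
    rw [rotationGate, if_neg, zero_mul]
    rintro ⟨h1, h2, h3, h4⟩
    exact hy ⟨anc y, Prod.ext h1 (Prod.ext h2 (Prod.ext h3 (Prod.ext h4 rfl)))⟩
  · intro b
    rw [rotationGate, if_pos ⟨rfl, rfl, rfl, rfl⟩]
    rfl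

theorem onEnergy_mem_unitaryGroup (l : Fin k) {W : Matrix (Fin (2 ^ n)) (Fin (2 ^ n)) ℂ}
    (hW : W ∈ Matrix.unitaryGroup (Fin (2 ^ n)) ℂ) :
    (onEnergy l W : Matrix (Basis D n k) (Basis D n k) ℂ) ∈
      Matrix.unitaryGroup (Basis D n k) ℂ := by
  rw [Matrix.mem_unitaryGroup_iff]
  ext x z
  rw [Matrix.mul_apply, sum_onEnergy_mul l W x fun y => (star (onEnergy l W)) y z]
  simp only [Matrix.star_apply]
  by_cases h : z.1 = x.1 ∧ regB z = regB x ∧ med z = med x ∧ anc z = anc x ∧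
      (∀ l', l' ≠ l → energy z l' = energy x l')
  · have h1 : ∀ b, onEnergy l W z (setEnergy x l b) = W (energy z l) b := by
      intro b
      rw [onEnergy, if_pos]
      · simp [setEnergy, energy]
      · refine ⟨h.1, h.2.1, h.2.2.1, h.2.2.2.1, fun l' hl => ?_⟩
        rw [h.2.2.2.2 l' hl]
        simp [setEnergy, energy, hl]
    simp_rw [h1]
    have h2 := congrFun (congrFun (Matrix.mem_unitaryGroup_iff.1 hW) (energy x l)) (energy z l)
    rw [Matrix.mul_apply] at h2
    simp only [Matrix.star_apply] at h2
    rw [h2, Matrix.one_apply, Matrix.one_apply]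
    congr 1
    refine propext ⟨fun he => ?_, fun he => by rw [he]⟩
    refine Prod.ext h.1.symm (Prod.ext h.2.1.symm (Prod.ext ?_
      (Prod.ext h.2.2.1.symm h.2.2.2.1.symm)))
    funext l'
    by_cases hl : l' = l
    · subst hl; exact he
    · exact (h.2.2.2.2 l' hl).symm
  · have h1 : ∀ b, onEnergy l W z (setEnergy x l b) = 0 := by
      intro b
      rw [onEnergy, if_neg]
      rintro ⟨h1, h2, h3, h4, h5⟩
      refine h ⟨h1, h2, h3, h4, fun l' hl => ?_⟩
      rw [h5 l' hl]
      simp [setEnergy, energy, hl]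
    simp_rw [h1]
    rw [Matrix.one_apply_ne]
    · simp
    · rintro rfl
      exact h ⟨rfl, rfl, rfl, rfl, fun _ _ => rfl⟩

theorem controlledU_mem_unitaryGroup {U : Matrix (Fin D) (Fin D) ℂ}
    (hU : U ∈ Matrix.unitaryGroup (Fin D) ℂ) (l : Fin k) (j : Fin n) :
    (controlledU U l j : Matrix (Basis D n k) (Basis D n k) ℂ) ∈
      Matrix.unitaryGroup (Basis D n k) ℂ := by
  rw [Matrix.mem_unitaryGroup_iff]
  ext x z
  rw [Matrix.mul_apply, sum_controlledU_mul U l j x fun y => (star (controlledU U l j)) y z]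
  simp only [Matrix.star_apply]
  by_cases h : z.2 = x.2
  · have hz : energy z l = energy x l := congrArg (fun r : Env D n k => r.2.1 l) h
    have h1 : ∀ a, controlledU U l j z (a, x.2) = if (energy x l).val.testBit j.val then U z.1 a
        else (1 : Matrix _ _ ℂ) z.1 a := by
      intro a
      rw [controlledU, if_pos h, hz]
    simp_rw [h1]
    have hxz : (x = z) ↔ x.1 = z.1 := ⟨fun e => by rw [e], fun e => Prod.ext e h.symm⟩
    by_cases hb : (energy x l).val.testBit j.val
    · simp only [hb, if_true]
      have h2 := congrFun (congrFun (Matrix.mem_unitaryGroup_iff.1 hU) x.1) z.1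
      rw [Matrix.mul_apply] at h2
      simp only [Matrix.star_apply] at h2
      rw [h2, Matrix.one_apply, Matrix.one_apply]
      simp only [hxz]
    · simp only [hb, if_false, Bool.false_eq_true]
      simp only [Matrix.one_apply, hxz]
      simp [eq_comm]
  · have h1 : ∀ a, controlledU U l j z (a, x.2) = 0 := fun a => by rw [controlledU, if_neg h]
    simp_rw [h1]
    rw [Matrix.one_apply_ne]
    · simp
    · rintro rfl; exact h rfl

theorem medianGate_mem_unitaryGroup :
    medianGate D n k ∈ Matrix.unitaryGroup (Basis D n k) ℂ := by
  rw [Matrix.mem_unitaryGroup_iff]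
  ext x z
  rw [Matrix.mul_apply, sum_medianGate_mul x fun y => (star (medianGate D n k)) y z]
  simp only [Matrix.star_apply, medianGate, Matrix.one_apply]
  by_cases h : x = z
  · subst h
    rw [if_pos, if_pos rfl, star_one]
    exact ⟨rfl, rfl, rfl, rfl, by simp [setMed, med, energy]⟩
  · rw [if_neg, if_neg h, star_zero]
    rintro ⟨h1, h2, h3, h4, h5⟩
    refine h (Prod.ext h1.symm (Prod.ext h2.symm (Prod.ext h3.symm (Prod.ext ?_ h4.symm))))
    have : med z = med x := by
      rw [h5]; simp [setMed, med, energy]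
    exact this.symm

theorem rotation_mul_transpose {β E : ℝ} (h : 0 ≤ β * E) :
    rotation β E * (rotation β E)ᵀ = 1 := by
  have h1 : Real.exp (-β * E) ≤ 1 := by rw [Real.exp_le_one_iff]; linarith
  have e1 := Real.mul_self_sqrt (Real.exp_pos (-β * E)).le
  have e2 := Real.mul_self_sqrt (sub_nonneg.2 h1)
  ext i j
  fin_cases i <;> fin_cases j <;> simp [rotation, Matrix.mul_apply] at * <;> linarith

theorem rotationGate_mem_unitaryGroup {β : ℝ} (hβ : 0 ≤ β) :
    rotationGate D n k β ∈ Matrix.unitaryGroup (Basis D n k) ℂ := by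
  rw [Matrix.mem_unitaryGroup_iff]
  ext x z
  rw [Matrix.mul_apply, sum_rotationGate_mul β x fun y => (star (rotationGate D n k β)) y z]
  simp only [Matrix.star_apply]
  by_cases h : z.1 = x.1 ∧ regB z = regB x ∧ energy z = energy x ∧ med z = med x
  · have h1 : ∀ c, rotationGate D n k β z (setAnc x c) =
        ((rotation β ((med x).val / 2 ^ n) (anc z) c : ℝ) : ℂ) := by
      intro c
      exact (if_pos h).trans (by rw [h.2.2.2]; rfl)
    simp_rw [h1]
    have hE : 0 ≤ β * (((med x).val : ℝ) / 2 ^ n) := by positivity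
    have h2 := congrFun (congrFun (rotation_mul_transpose hE) (anc x)) (anc z)
    rw [Matrix.mul_apply] at h2
    simp only [Matrix.transpose_apply] at h2
    have h3 := congrArg Complex.ofReal h2
    rw [Complex.ofReal_sum] at h3
    simp only [Complex.ofReal_mul] at h3
    simp only [Complex.star_def, Complex.conj_ofReal]
    rw [h3, Matrix.one_apply, Matrix.one_apply]
    have hxz : (x = z) ↔ anc x = anc z := ⟨fun e => by rw [e], fun e =>
      Prod.ext h.1.symm (Prod.ext h.2.1.symm (Prod.ext h.2.2.1.symm (Prod.ext h.2.2.2.symm e)))⟩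
    simp only [hxz]
    split_ifs <;> simp
  · have h1 : ∀ c, rotationGate D n k β z (setAnc x c) = 0 := fun c => if_neg h
    simp_rw [h1]
    rw [Matrix.one_apply_ne]
    · simp
    · rintro rfl; exact h ⟨rfl, rfl, rfl, rfl⟩

end Gates

/-! ### Binary digits and the Hadamard transform. -/

section HadamardTransform

/-- The phase that |b⟩ collects from the controlled powers of an eigenvalue μ. Induction strips the
lowest bit and replaces μ by μ². -/
theorem prod_testBit_pow (n : ℕ) : ∀ (b : ℕ), b < 2 ^ n → ∀ μ : ℂ,
    ∏ j : Fin n, (if b.testBit j.val then μ else 1) ^ (2 ^ j.val) = μ ^ b := by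
  induction n with
  | zero =>
    intro b hb μ
    have : b = 0 := by simpa using hb
    simp [this]
  | succ n ih =>
    intro b hb μ
    rw [Fin.prod_univ_succ]
    have h1 : ∀ j : Fin n, (if b.testBit (j.succ).val then μ else 1) ^ (2 ^ (j.succ).val)
        = (if (b / 2).testBit j.val then μ ^ 2 else 1) ^ (2 ^ j.val) := by
      intro j
      rw [Fin.val_succ, Nat.testBit_succ, pow_succ, mul_comm, pow_mul]
      split_ifs <;> simp
    simp_rw [h1]
    rw [ih (b / 2) (by rw [pow_succ] at hb; omega) (μ ^ 2), ← pow_mul]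
    have h2 : (if b.testBit (0 : Fin (n + 1)).val then μ else 1) ^ 2 ^ (0 : Fin (n + 1)).val
        = μ ^ (b % 2) := by
      simp only [Fin.val_zero, pow_zero, pow_one, Nat.testBit_zero]
      rcases Nat.mod_two_eq_zero_or_one b with h | h <;> simp [h]
    rw [h2, ← pow_add, Nat.mod_add_div]

theorem prod_one_div_sqrt_two (n : ℕ) :
    ∏ _j : Fin n, (1 : ℂ) / ((Real.sqrt 2 : ℝ) : ℂ) = 1 / ((Real.sqrt (2 ^ n) : ℝ) : ℂ) := by
  rw [Finset.prod_const, Finset.card_univ, Fintype.card_fin, div_pow, one_pow,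
    ← Complex.ofReal_pow]
  congr 2
  rw [eq_comm, Real.sqrt_eq_iff_mul_self_eq (by positivity) (by positivity), ← mul_pow,
    Real.mul_self_sqrt zero_le_two]

theorem hadamard_apply_zero (n : ℕ) (b : Fin (2 ^ n)) :
    hadamard n b 0 = 1 / ((Real.sqrt (2 ^ n) : ℝ) : ℂ) := by
  rw [hadamard, ← prod_one_div_sqrt_two]
  refine Finset.prod_congr rfl fun j _ => ?_
  simp

/-- Distributivity over bit strings. It factorizes the inner product of two Hadamard rows, and a bit
in which the rows differ contributes the factor 0. -/
theorem sum_range_two_pow_prod_testBit (n : ℕ) : ∀ g : Fin n → Bool → ℂ,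
    ∑ c ∈ Finset.range (2 ^ n), ∏ j : Fin n, g j (c.testBit j.val)
      = ∏ j, (g j false + g j true) := by
  induction n with
  | zero => intro g; simp
  | succ n ih =>
    intro g
    have hsplit : ∀ (m : ℕ) (f : ℕ → ℂ), ∑ c ∈ Finset.range (m * 2), f c
        = ∑ c ∈ Finset.range m, (f (2 * c) + f (2 * c + 1)) := by
      intro m f
      induction m with
      | zero => simp
      | succ m ihm =>
        rw [Nat.succ_mul, Finset.sum_range_succ, Finset.sum_range_succ, ihm,
          Finset.sum_range_succ, mul_comm m 2, add_assoc]
    rw [pow_succ, hsplit, Fin.prod_univ_succ, ← ih fun j => g j.succ, Finset.mul_sum]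
    refine Finset.sum_congr rfl fun c _ => ?_
    rw [Fin.prod_univ_succ, Fin.prod_univ_succ, add_mul]
    have h0 : (2 * c) / 2 = c := by omega
    have h1 : (2 * c + 1) / 2 = c := by omega
    simp [Nat.testBit_succ, Nat.testBit_zero, h0, h1]

theorem hadamard_mem_unitaryGroup (n : ℕ) :
    hadamard n ∈ Matrix.unitaryGroup (Fin (2 ^ n)) ℂ := by
  rw [Matrix.mem_unitaryGroup_iff]
  ext b b'
  set g : Fin n → Bool → ℂ := fun j t =>
    ((if b.val.testBit j.val ∧ t = true then (-1 : ℂ) else 1) *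
      (if b'.val.testBit j.val ∧ t = true then (-1 : ℂ) else 1)) / 2 with hg
  have h2 : ((Real.sqrt 2 : ℝ) : ℂ) * ((Real.sqrt 2 : ℝ) : ℂ) = 2 := by
    rw [← Complex.ofReal_mul, Real.mul_self_sqrt zero_le_two]; simp
  have h1 : ∀ c : Fin (2 ^ n), hadamard n b c * star (hadamard n b' c)
      = ∏ j : Fin n, g j (c.val.testBit j.val) := by
    intro c
    simp only [hadamard, Complex.star_def]
    rw [map_prod, ← Finset.prod_mul_distrib]
    refine Finset.prod_congr rfl fun j _ => ?_
    rw [map_div₀, Complex.conj_ofReal, div_mul_div_comm, h2, hg]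
    congr 2
    split_ifs <;> simp
  rw [Matrix.mul_apply]
  simp only [Matrix.star_apply]
  simp_rw [h1]
  rw [Fin.sum_univ_eq_sum_range (fun c => ∏ j : Fin n, g j (c.testBit j.val)) (2 ^ n),
    sum_range_two_pow_prod_testBit]
  by_cases h : b = b'
  · subst h
    rw [Matrix.one_apply_eq]
    refine Finset.prod_eq_one fun j _ => ?_
    simp only [hg]
    split_ifs <;> norm_num
  · rw [Matrix.one_apply_ne h]
    obtain ⟨j, hj⟩ : ∃ j : Fin n, b.val.testBit j.val ≠ b'.val.testBit j.val := by
      by_contra! hcon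
      refine h (Fin.ext (Nat.eq_of_testBit_eq fun i => ?_))
      rcases lt_or_ge i n with hi | hi
      · exact hcon ⟨i, hi⟩
      · have hle : 2 ^ n ≤ 2 ^ i := Nat.pow_le_pow_right two_pos hi
        rw [Nat.testBit_lt_two_pow (b.2.trans_le hle), Nat.testBit_lt_two_pow (b'.2.trans_le hle)]
    refine Finset.prod_eq_zero (Finset.mem_univ j) ?_
    simp only [hg]
    cases hb : b.val.testBit j.val <;> cases hb' : b'.val.testBit j.val <;>
      first | exact absurd (hb.trans hb'.symm) hj | norm_num

end HadamardTransform

/-! ### Evaluation of the preparation on eigenvectors. -/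

section Circuits

variable {D n k : ℕ}

theorem Circuit.eval_append (U : Matrix (Fin D) (Fin D) ℂ) (c₁ c₂ : Circuit D n k) :
    Circuit.eval U (c₁ ++ c₂) = Circuit.eval U c₂ * Circuit.eval U c₁ := by
  induction c₁ with
  | nil => simp [Circuit.eval]
  | cons g c ih =>
    rw [List.cons_append, Circuit.eval, ih, Circuit.eval, mul_assoc]

theorem Circuit.eval_singleton (U : Matrix (Fin D) (Fin D) ℂ) (g : Gate D n k) :
    Circuit.eval U [g] = g.eval U := by
  simp [Circuit.eval]

theorem Circuit.eval_inverse (U : Matrix (Fin D) (Fin D) ℂ) (c : Circuit D n k) :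
    Circuit.eval U (Circuit.inverse c) = (Circuit.eval U c)ᴴ := by
  induction c with
  | nil => simp [Circuit.inverse, Circuit.eval]
  | cons g c ih =>
    have h : Circuit.inverse (g :: c) = Circuit.inverse c ++ [g.inv] := by
      simp [Circuit.inverse]
    rw [h, Circuit.eval_append, ih, Circuit.eval_singleton, Circuit.eval,
      Matrix.conjTranspose_mul]
    congr 1
    cases g <;> simp [Gate.inv, Gate.eval]

theorem Circuit.eval_mem_unitaryGroup (U : Matrix (Fin D) (Fin D) ℂ) (c : Circuit D n k)
    (h : ∀ g ∈ c, g.eval U ∈ Matrix.unitaryGroup (Basis D n k) ℂ) :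
    Circuit.eval U c ∈ Matrix.unitaryGroup (Basis D n k) ℂ := by
  induction c with
  | nil => exact one_mem _
  | cons g c ih =>
    exact mul_mem (ih fun g' hg' => h g' (List.mem_cons_of_mem _ hg')) (h g List.mem_cons_self)

theorem preparation_eval_mem_unitaryGroup {U : Matrix (Fin D) (Fin D) ℂ}
    (hU : U ∈ Matrix.unitaryGroup (Fin D) ℂ) {β : ℝ} (hβ : 0 ≤ β) :
    Circuit.eval U (preparation D n k β) ∈ Matrix.unitaryGroup (Basis D n k) ℂ := by
  refine Circuit.eval_mem_unitaryGroup U _ fun g hg => ?_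
  simp only [preparation, phaseEstimation, List.mem_append, List.mem_flatMap, List.mem_cons,
    List.mem_replicate, List.not_mem_nil, or_false] at hg
  rcases hg with ⟨l, -, (rfl | ⟨j, -, -, rfl⟩) | rfl⟩ | rfl | rfl
  · exact onEnergy_mem_unitaryGroup l (hadamard_mem_unitaryGroup n)
  · exact controlledU_mem_unitaryGroup hU l j
  · exact onEnergy_mem_unitaryGroup l (inverseQFT_mem_unitaryGroup n)
  · exact medianGate_mem_unitaryGroup
  · exact rotationGate_mem_unitaryGroup hβ

/-- The product state with `v` on `A`, `g` on `B`, `α l` on the `l`-th energy register, and `|0⟩`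
on the median register and the ancilla. -/
def productState (v g : Fin D → ℂ) (α : Fin k → Fin (2 ^ n) → ℂ) (x : Basis D n k) : ℂ :=
  if med x = 0 ∧ anc x = 0 then v x.1 * g (regB x) * ∏ l, α l (energy x l) else 0

theorem onEnergy_mulVec_productState (l : Fin k) (W : Matrix (Fin (2 ^ n)) (Fin (2 ^ n)) ℂ)
    (v g : Fin D → ℂ) (α : Fin k → Fin (2 ^ n) → ℂ) :
    onEnergy l W *ᵥ productState v g α = productState v g (Function.update α l (W *ᵥ α l)) := by
  funext x
  rw [Matrix.mulVec, dotProduct, sum_onEnergy_mul]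
  have h1 : ∀ b, productState v g α (setEnergy x l b) = if med x = 0 ∧ anc x = 0 then
      v x.1 * g (regB x) * (α l b * ∏ l' ∈ Finset.univ.erase l, α l' (energy x l')) else 0 := by
    intro b
    change (if med x = 0 ∧ anc x = 0 then
      v x.1 * g (regB x) * ∏ l', α l' (Function.update (energy x) l b l') else 0) = _
    congr 2
    rw [← Finset.mul_prod_erase _ _ (Finset.mem_univ l), Function.update_self]
    congr 1
    refine Finset.prod_congr rfl fun l' hl' => ?_
    rw [Function.update_of_ne (Finset.ne_of_mem_erase hl')]
  simp_rw [h1]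
  rw [productState]
  split_ifs with h
  · rw [← Finset.mul_prod_erase _ _ (Finset.mem_univ l), Function.update_self, Matrix.mulVec,
      dotProduct, Finset.sum_mul, Finset.mul_sum]
    refine Finset.sum_congr rfl fun b _ => ?_
    have h2 : ∏ l' ∈ Finset.univ.erase l, Function.update α l (W *ᵥ α l) l' (energy x l')
        = ∏ l' ∈ Finset.univ.erase l, α l' (energy x l') :=
      Finset.prod_congr rfl fun l' hl' => by
        rw [Function.update_of_ne (Finset.ne_of_mem_erase hl')]
    rw [h2]
    ring
  · simp

/-- Phase kickback: an eigenvector on A is unchanged and its eigenvalue moves to the control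
register, so product states stay product states. -/
theorem controlledU_mulVec_productState {U : Matrix (Fin D) (Fin D) ℂ} {v : Fin D → ℂ} {μ : ℂ}
    (hv : U *ᵥ v = μ • v) (l : Fin k) (j : Fin n) (g : Fin D → ℂ)
    (α : Fin k → Fin (2 ^ n) → ℂ) :
    controlledU U l j *ᵥ productState v g α = productState v g (Function.update α l
      fun b => (if b.val.testBit j.val then μ else 1) * α l b) := by
  funext x
  rw [Matrix.mulVec, dotProduct, sum_controlledU_mul]
  have h1 : ∀ a, productState v g α (a, x.2) = v a * (if med x = 0 ∧ anc x = 0 then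
      g (regB x) * ∏ l', α l' (energy x l') else 0) := by
    intro a
    change (if med x = 0 ∧ anc x = 0 then v a * g (regB x) * ∏ l', α l' (energy x l') else 0) = _
    split_ifs <;> ring
  simp_rw [h1, ← mul_assoc]
  rw [← Finset.sum_mul]
  have h2 : ∑ a, (if (energy x l).val.testBit j.val then U x.1 a
      else (1 : Matrix _ _ ℂ) x.1 a) * v a
        = (if (energy x l).val.testBit j.val then μ else 1) * v x.1 := by
    split_ifs with h
    · exact congrFun hv x.1
    · rw [one_mul]
      exact congrFun (Matrix.one_mulVec v) x.1
  rw [h2, productState]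
  have h3 : ∏ l', Function.update α l (fun b => (if b.val.testBit j.val then μ else 1) * α l b) l'
      (energy x l') = (if (energy x l).val.testBit j.val then μ else 1) *
        ∏ l', α l' (energy x l') := by
    rw [← Finset.mul_prod_erase _ _ (Finset.mem_univ l), Function.update_self,
      ← Finset.mul_prod_erase Finset.univ (fun l' => α l' (energy x l')) (Finset.mem_univ l),
      mul_assoc]
    congr 2
    refine Finset.prod_congr rfl fun l' hl' => ?_
    rw [Function.update_of_ne (Finset.ne_of_mem_erase hl')]
  rw [h3]
  split_ifs <;> ring

theorem eval_replicate_query_productState {U : Matrix (Fin D) (Fin D) ℂ} {v : Fin D → ℂ} {μ : ℂ}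
    (hv : U *ᵥ v = μ • v) (l : Fin k) (j : Fin n) (g : Fin D → ℂ) (m : ℕ) :
    ∀ α : Fin k → Fin (2 ^ n) → ℂ,
    Circuit.eval U (List.replicate m (Gate.query l j)) *ᵥ productState v g α =
      productState v g (Function.update α l
        fun b => (if b.val.testBit j.val then μ else 1) ^ m * α l b) := by
  induction m with
  | zero =>
    intro α
    simp [Circuit.eval]
  | succ m ih =>
    intro α
    rw [List.replicate_succ, Circuit.eval, ← Matrix.mulVec_mulVec, Gate.eval,
      controlledU_mulVec_productState hv, ih, Function.update_idem, Function.update_self]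
    congr 2
    funext b
    ring

theorem eval_queries_productState {U : Matrix (Fin D) (Fin D) ℂ} {v : Fin D → ℂ} {μ : ℂ}
    (hv : U *ᵥ v = μ • v) (l : Fin k) (g : Fin D → ℂ) (js : List (Fin n)) :
    ∀ α : Fin k → Fin (2 ^ n) → ℂ,
    Circuit.eval U (js.flatMap fun j => List.replicate (2 ^ j.val) (Gate.query l j)) *ᵥ
      productState v g α = productState v g (Function.update α l fun b =>
        (js.map fun j : Fin n => (if b.val.testBit j.val then μ else 1) ^ (2 ^ j.val)).prod
          * α l b) := by
  induction js with
  | nil => intro α; simp [Circuit.eval]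
  | cons j js ih =>
    intro α
    rw [List.flatMap_cons, Circuit.eval_append, ← Matrix.mulVec_mulVec,
      eval_replicate_query_productState hv, ih, Function.update_idem, Function.update_self]
    congr 2
    funext b
    rw [List.map_cons, List.prod_cons]
    ring

theorem eval_phaseEstimation_productState {U : Matrix (Fin D) (Fin D) ℂ} {v : Fin D → ℂ} {θ : ℝ}
    (hv : U *ᵥ v = Complex.exp ((2 * Real.pi * θ : ℝ) * Complex.I) • v) (l : Fin k)
    (g : Fin D → ℂ) (α : Fin k → Fin (2 ^ n) → ℂ) (hα : α l = Pi.single 0 1) :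
    Circuit.eval U (phaseEstimation l) *ᵥ productState v g α =
      productState v g (Function.update α l (phaseAmp n θ)) := by
  rw [phaseEstimation, Circuit.eval_append, Circuit.eval_append, Circuit.eval_singleton,
    Circuit.eval_singleton, ← Matrix.mulVec_mulVec, ← Matrix.mulVec_mulVec, Gate.eval, Gate.eval,
    onEnergy_mulVec_productState, eval_queries_productState hv, onEnergy_mulVec_productState,
    Function.update_idem, Function.update_idem, Function.update_self, Function.update_self, phaseAmp]
  congr 3
  funext b
  rw [← Fin.prod_univ_def, prod_testBit_pow n b.val b.2, hα, Matrix.mulVec_single_one,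
    Matrix.col_apply, hadamard_apply_zero, phaseVec, ← Complex.exp_nat_mul, mul_one_div]
  congr 2
  push_cast
  ring

/-- Since A is left in the same eigenvector, the runs are independent. `Nodup` ensures that each run
meets a fresh register in |0⟩. -/
theorem eval_phaseEstimations_productState {U : Matrix (Fin D) (Fin D) ℂ} {v : Fin D → ℂ} {θ : ℝ}
    (hv : U *ᵥ v = Complex.exp ((2 * Real.pi * θ : ℝ) * Complex.I) • v) (g : Fin D → ℂ)
    (ls : List (Fin k)) : ls.Nodup → ∀ α : Fin k → Fin (2 ^ n) → ℂ,
    (∀ l ∈ ls, α l = Pi.single 0 1) →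
    Circuit.eval U (ls.flatMap phaseEstimation) *ᵥ productState v g α =
      productState v g fun l => if l ∈ ls then phaseAmp n θ else α l := by
  induction ls with
  | nil => intro _ α _; simp [Circuit.eval]
  | cons l ls ih =>
    intro hnd α hα
    rw [List.nodup_cons] at hnd
    rw [List.flatMap_cons, Circuit.eval_append, ← Matrix.mulVec_mulVec,
      eval_phaseEstimation_productState hv l g α (hα l List.mem_cons_self), ih hnd.2]
    · congr 1
      funext l'
      by_cases h1 : l' = l
      · subst h1; simp [hnd.1]
      · simp [h1]
    · intro l' hl'
      have : l' ≠ l := by rintro rfl; exact hnd.1 hl'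
      rw [Function.update_of_ne this]
      exact hα l' (List.mem_cons_of_mem _ hl')

/-- The maximally entangled state is the same in every orthonormal basis when the conjugate basis is
used on B; this is QQ† = 1 entrywise. -/
theorem start_eq_sum {Q : Matrix (Fin D) (Fin D) ℂ} (hQ : Q ∈ Matrix.unitaryGroup (Fin D) ℂ) :
    start D n k = ∑ j, ((1 / Real.sqrt (D : ℝ) : ℝ) : ℂ) •
      productState (fun a => Q a j) (fun b => star (Q b j)) fun _ => Pi.single 0 1 := by
  funext x
  have hprod : ∏ l, (Pi.single (M := fun _ => ℂ) 0 1 : Fin (2 ^ n) → ℂ) (energy x l)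
      = if ∀ l, energy x l = 0 then 1 else 0 := by
    simp only [Pi.single_apply]
    rw [Finset.prod_ite_zero]
    simp
  have hone := congrFun (congrFun (mul_conjTranspose_self_of_mem hQ) x.1) (regB x)
  rw [Matrix.mul_apply] at hone
  simp only [Matrix.conjTranspose_apply] at hone
  rw [Finset.sum_apply]
  simp only [Pi.smul_apply, smul_eq_mul, productState, hprod]
  rw [← Finset.mul_sum, start]
  by_cases hm : med x = 0 ∧ anc x = 0
  · simp only [hm, and_true, if_true]
    rw [← Finset.sum_mul, hone, Matrix.one_apply]
    split_ifs <;> simp_all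
  · simp only [hm, if_false, and_false, Finset.sum_const_zero, mul_zero]

/-- The joint amplitude of `A`, `B` and the energy registers after all phase estimations. -/
noncomputable def estimateAmp (n k : ℕ) (Q : Matrix (Fin D) (Fin D) ℂ) (θ : Fin D → ℝ)
    (a b : Fin D) (e : Fin k → Fin (2 ^ n)) : ℂ :=
  ((1 / Real.sqrt (D : ℝ) : ℝ) : ℂ) *
    ∑ j, Q a j * star (Q b j) * ∏ l, phaseAmp n (θ j) (e l)

theorem mulVec_udiag_col {ι : Type*} [Fintype ι] [DecidableEq ι] {Q : Matrix ι ι ℂ}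
    (hQ : Q ∈ Matrix.unitaryGroup ι ℂ) (d : ι → ℂ) (j : ι) :
    udiag Q d *ᵥ (fun a => Q a j) = d j • fun a => Q a j := by
  have h : udiag Q d * Q = Q * Matrix.diagonal d := by
    rw [udiag, mul_assoc, conjTranspose_mul_self_of_mem hQ, mul_one]
  funext a
  have := congrFun (congrFun h a) j
  rw [Matrix.mul_diagonal, Matrix.mul_apply] at this
  rw [Matrix.mulVec, dotProduct, this, Pi.smul_apply, smul_eq_mul, mul_comm]

/-- The accepted branch of the prepared state. -/
theorem projZero_preparation_start {Q : Matrix (Fin D) (Fin D) ℂ}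
    (hQ : Q ∈ Matrix.unitaryGroup (Fin D) ℂ) (θ : Fin D → ℝ) (β : ℝ) (x : Basis D n k) :
    (projZero D n k *ᵥ (Circuit.eval (udiag Q fun j =>
      Complex.exp ((2 * Real.pi * θ j : ℝ) * Complex.I)) (preparation D n k β) *ᵥ
        start D n k)) x =
      if anc x = 0 ∧ med x = median (energy x) then
        ((√(Real.exp (-β * ((med x).val / 2 ^ n))) : ℝ) : ℂ) *
          estimateAmp n k Q θ x.1 (regB x) (energy x) else 0 := by
  set U := udiag Q fun j => Complex.exp ((2 * Real.pi * θ j : ℝ) * Complex.I) with hU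
  have hcol := fun j => mulVec_udiag_col hQ
    (fun j => Complex.exp ((2 * Real.pi * θ j : ℝ) * Complex.I)) j
  rw [← hU] at hcol
  have hest : Circuit.eval U ((List.finRange k).flatMap phaseEstimation) *ᵥ start D n k =
      fun x => if med x = 0 ∧ anc x = 0 then
        estimateAmp n k Q θ x.1 (regB x) (energy x) else 0 := by
    rw [start_eq_sum hQ, Matrix.mulVec_sum]
    simp_rw [Matrix.mulVec_smul]
    funext y
    rw [Finset.sum_apply]
    have h1 : ∀ j, Circuit.eval U ((List.finRange k).flatMap phaseEstimation) *ᵥ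
        productState (fun a => Q a j) (fun b => star (Q b j)) (fun _ => Pi.single 0 1)
        = productState (fun a => Q a j) (fun b => star (Q b j)) fun _ : Fin k => phaseAmp n (θ j) := by
      intro j
      rw [eval_phaseEstimations_productState (hcol j) _ _ (List.nodup_finRange k) _
        (fun _ _ => rfl)]
      simp
    simp_rw [h1]
    simp only [Pi.smul_apply, smul_eq_mul, productState]
    rw [← Finset.mul_sum, estimateAmp]
    split_ifs <;> simp
  rw [projZero, Matrix.mulVec_diagonal, preparation, Circuit.eval_append, ← Matrix.mulVec_mulVec,
    hest]
  by_cases hanc : anc x = 0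
  swap
  · simp [hanc]
  simp only [hanc, if_true, one_mul, true_and]
  rw [Circuit.eval, Circuit.eval, Circuit.eval, one_mul, Gate.eval, Gate.eval,
    ← Matrix.mulVec_mulVec]
  rw [Matrix.mulVec, dotProduct, sum_rotationGate_mul]
  simp_rw [Matrix.mulVec, dotProduct]
  simp_rw [sum_medianGate_mul]
  -- Read backwards from ancilla 0: the state before the rotation has ancilla 0 too, so only the
  -- entry √e^{-βE} of the rotation survives, and the initially empty median register must now hold
  -- the median.
  rw [Fin.sum_univ_two, hanc]
  have h0 : ∀ c, anc (setMed (setAnc x c) (med (setAnc x c) - median (energy (setAnc x c)))) = c :=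
    fun c => rfl
  have h1 : ∀ c, med (setMed (setAnc x c) (med (setAnc x c) - median (energy (setAnc x c))))
    = med x - median (energy x) := fun c => rfl
  simp only [h0, h1, sub_eq_zero]
  simp only [and_true, one_ne_zero, and_false, if_false, mul_zero, add_zero]
  simp only [mul_ite, mul_zero]
  rfl

end Circuits

/-! ### Amplitude amplification -/

section Output

variable {D n k : ℕ}

theorem star_dotProduct_self_eq {ι : Type*} [Fintype ι] (y : ι → ℂ) :
    star y ⬝ᵥ y = ((∑ i, ‖y i‖ ^ 2 : ℝ) : ℂ) := by
  simp only [dotProduct, Pi.star_apply]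
  push_cast
  refine Finset.sum_congr rfl fun i _ => ?_
  rw [Complex.star_def, mul_comm, Complex.mul_conj, Complex.normSq_eq_norm_sq]
  push_cast; rfl

theorem sum_sq_norm_start [NeZero D] : ∑ x, ‖start D n k x‖ ^ 2 = 1 := by
  have hD : (0 : ℝ) < D := by exact_mod_cast Nat.pos_of_ne_zero (NeZero.ne D)
  have h : ∑ _a : Fin D, (1 / (D : ℝ)) = 1 := by
    rw [Finset.sum_const, Finset.card_univ, Fintype.card_fin, nsmul_eq_mul]
    field_simp
  rw [← h]
  symm
  refine Fintype.sum_of_injective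
    (fun a : Fin D => ((a, (a, fun _ => 0, 0, 0)) : Basis D n k)) ?_ _ _ ?_ ?_
  · intro a b hab
    exact congrArg Prod.fst hab
  · intro x hx
    rw [start, if_neg]
    · simp
    · rintro ⟨h1, h2, h3, h4⟩
      refine hx ⟨x.1, Prod.ext rfl (Prod.ext h1 (Prod.ext ?_ (Prod.ext h3.symm h4.symm)))⟩
      exact (funext h2).symm
  · intro a
    rw [start, if_pos ⟨rfl, fun _ => rfl, rfl, rfl⟩, Complex.norm_real,
      Real.norm_of_nonneg (by positivity), div_pow, Real.sq_sqrt hD.le, one_pow]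

/-- The conjugate eigenvectors on B are orthonormal, so summing over B removes the cross terms and
turns the superposition into a mixture. -/
theorem sum_estimateAmp_mul {Q : Matrix (Fin D) (Fin D) ℂ}
    (hQ : Q ∈ Matrix.unitaryGroup (Fin D) ℂ) (θ : Fin D → ℝ) (a a' : Fin D)
    (e : Fin k → Fin (2 ^ n)) :
    ∑ b, estimateAmp n k Q θ a b e * star (estimateAmp n k Q θ a' b e) =
      ((1 / D : ℝ) : ℂ) * ∑ j, ((estimateProb n k (θ j) e : ℝ) : ℂ) * (Q a j * star (Q a' j)) := by
  set A : Fin D → ℂ := fun j => ∏ l, phaseAmp n (θ j) (e l) with hA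
  have hAA : ∀ j, A j * star (A j) = ((estimateProb n k (θ j) e : ℝ) : ℂ) := fun j => by
    rw [Complex.star_def, Complex.mul_conj, Complex.normSq_eq_norm_sq, hA, estimateProb]
    simp only [phaseProb, norm_prod, Finset.prod_pow]
  have hc : ((1 / Real.sqrt (D : ℝ) : ℝ) : ℂ) * ((1 / Real.sqrt (D : ℝ) : ℝ) : ℂ)
      = ((1 / D : ℝ) : ℂ) := by
    rw [← Complex.ofReal_mul, div_mul_div_comm, Real.mul_self_sqrt (Nat.cast_nonneg _), one_mul]
  have horth : ∀ j j', ∑ b, star (Q b j) * Q b j' = if j = j' then 1 else 0 := fun j j' => by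
    have h := congrFun (congrFun (conjTranspose_mul_self_of_mem hQ) j) j'
    rw [Matrix.mul_apply, Matrix.one_apply] at h
    simpa only [Matrix.conjTranspose_apply] using h
  have h1 : ∀ b, estimateAmp n k Q θ a b e * star (estimateAmp n k Q θ a' b e) =
      ((1 / D : ℝ) : ℂ) * ∑ j, ∑ j', (Q a j * A j * star (Q a' j' * A j')) *
        (star (Q b j) * Q b j') := by
    intro b
    rw [estimateAmp, estimateAmp, star_mul', Complex.star_def, Complex.conj_ofReal, ← hc,
      mul_mul_mul_comm, map_sum, Finset.sum_mul_sum]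
    congr 1
    refine Finset.sum_congr rfl fun j _ => Finset.sum_congr rfl fun j' _ => ?_
    simp only [map_mul, Complex.conj_conj, hA]
    ring
  simp_rw [h1]
  rw [← Finset.mul_sum]
  congr 1
  rw [Finset.sum_comm]
  refine Finset.sum_congr rfl fun j _ => ?_
  rw [Finset.sum_comm]
  simp_rw [← Finset.mul_sum, horth]
  rw [Finset.sum_eq_single j]
  · rw [if_pos rfl, mul_one, ← hAA, star_mul']
    ring
  · intro j' _ hj'
    rw [if_neg hj'.symm, mul_zero]
  · intro h; exact absurd (Finset.mem_univ _) h

/-- The accepted branch lives on basis states determined by A, B and the estimates alone. The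
squared rotation amplitude is the Boltzmann factor of the median, and averaging it over the
estimates gives `weight`. -/
theorem partialTrace_accepted {Q : Matrix (Fin D) (Fin D) ℂ}
    (hQ : Q ∈ Matrix.unitaryGroup (Fin D) ℂ) (θ : Fin D → ℝ) (β : ℝ) {Φ : Basis D n k → ℂ}
    (hΦ : ∀ x, Φ x = if anc x = 0 ∧ med x = median (energy x) then
        ((√(Real.exp (-β * ((med x).val / 2 ^ n))) : ℝ) : ℂ) *
          estimateAmp n k Q θ x.1 (regB x) (energy x) else 0) :
    partialTrace (Matrix.vecMulVec Φ (star Φ)) =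
      ((1 / D : ℝ) : ℂ) • udiag Q fun j => ((weight n k β (θ j) : ℝ) : ℂ) := by
  ext a a'
  rw [partialTrace, Matrix.smul_apply, udiag_apply, smul_eq_mul]
  have h1 : ∑ r : Env D n k, Matrix.vecMulVec Φ (star Φ) (a, r) (a', r) =
      ∑ be : Fin D × (Fin k → Fin (2 ^ n)),
        ((Real.exp (-β * ((median be.2).val / 2 ^ n)) : ℝ) : ℂ) *
          (estimateAmp n k Q θ a be.1 be.2 * star (estimateAmp n k Q θ a' be.1 be.2)) := by
    symm
    refine Fintype.sum_of_injective (fun be : Fin D × (Fin k → Fin (2 ^ n)) =>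
      ((be.1, be.2, median be.2, 0) : Env D n k)) ?_ _ _ ?_ ?_
    · intro x y hxy
      exact Prod.ext (congrArg (fun r : Env D n k => r.1) hxy) (congrArg (fun r : Env D n k => r.2.1) hxy)
    · intro r hr
      rw [Matrix.vecMulVec_apply, hΦ, if_neg, zero_mul]
      rintro ⟨h1, h2⟩
      exact hr ⟨(r.1, r.2.1), Prod.ext rfl (Prod.ext rfl (Prod.ext h2.symm h1.symm))⟩
    · intro be
      rw [Matrix.vecMulVec_apply, Pi.star_apply, hΦ, hΦ, if_pos ⟨rfl, rfl⟩, if_pos ⟨rfl, rfl⟩]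
      have h2 := Real.mul_self_sqrt (Real.exp_pos (-β * ((median be.2).val / 2 ^ n))).le
      nth_rewrite 1 [← h2]
      rw [star_mul', Complex.star_def, Complex.conj_ofReal, Complex.ofReal_mul]
      change _ = (_ * estimateAmp n k Q θ a be.1 be.2) *
        (_ * (starRingEnd ℂ) (estimateAmp n k Q θ a' be.1 be.2))
      simp only [med]
      ring
  rw [h1, Fintype.sum_prod_type, Finset.sum_comm]
  simp_rw [← Finset.mul_sum, sum_estimateAmp_mul hQ, weight]
  push_cast
  simp_rw [Finset.mul_sum, Finset.sum_mul]
  rw [Finset.sum_comm]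
  refine Finset.sum_congr rfl fun j _ => ?_
  rw [Finset.mul_sum]
  exact Finset.sum_congr rfl fun e _ => by ring

theorem sum_sq_norm_eq_trace_partialTrace (Φ : Basis D n k → ℂ) :
    ((∑ x, ‖Φ x‖ ^ 2 : ℝ) : ℂ) = (partialTrace (Matrix.vecMulVec Φ (star Φ))).trace := by
  rw [← star_dotProduct_self_eq, dotProduct, Fintype.sum_prod_type, Matrix.trace]
  refine Finset.sum_congr rfl fun a _ => Finset.sum_congr rfl fun r _ => ?_
  rw [Matrix.vecMulVec_apply, mul_comm]

theorem projZero_mulVec_apply (f : Basis D n k → ℂ) (x : Basis D n k) :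
    (projZero D n k *ᵥ f) x = if anc x = 0 then f x else 0 := by
  rw [projZero, Matrix.mulVec_diagonal]
  split_ifs <;> simp

theorem projZero_mulVec_idem (f : Basis D n k → ℂ) :
    projZero D n k *ᵥ (projZero D n k *ᵥ f) = projZero D n k *ᵥ f := by
  funext x
  rw [projZero_mulVec_apply, projZero_mulVec_apply]
  split_ifs <;> rfl

theorem projZero_mul_vecMulVec_mul (f : Basis D n k → ℂ) :
    projZero D n k * Matrix.vecMulVec f (star f) * projZero D n k =
      Matrix.vecMulVec (projZero D n k *ᵥ f) (star (projZero D n k *ᵥ f)) := by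
  have hs : (projZero D n k)ᴴ = projZero D n k := by
    rw [projZero, Matrix.diagonal_conjTranspose]
    congr 1; funext x
    rw [Pi.star_apply]
    split_ifs <;> simp
  rw [Matrix.mul_vecMulVec, Matrix.vecMulVec_mul, Matrix.star_mulVec, hs]

theorem star_dotProduct_projZero (f : Basis D n k → ℂ) :
    star f ⬝ᵥ (projZero D n k *ᵥ f) = ((∑ x, ‖(projZero D n k *ᵥ f) x‖ ^ 2 : ℝ) : ℂ) := by
  rw [← star_dotProduct_self_eq]
  refine Finset.sum_congr rfl fun x _ => ?_
  rw [Pi.star_apply, Pi.star_apply, projZero_mulVec_apply]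
  split_ifs <;> simp

theorem groverIteration_mulVec {U : Matrix (Fin D) (Fin D) ℂ}
    (hU : U ∈ Matrix.unitaryGroup (Fin D) ℂ) {β : ℝ} (hβ : 0 ≤ β) (f : Basis D n k → ℂ) :
    Circuit.eval U (groverIteration D n k β) *ᵥ f =
      (2 * (star (Circuit.eval U (preparation D n k β) *ᵥ start D n k) ⬝ᵥ
        (f - (2 : ℂ) • (projZero D n k *ᵥ f)))) •
          (Circuit.eval U (preparation D n k β) *ᵥ start D n k) -
        (f - (2 : ℂ) • (projZero D n k *ᵥ f)) := by
  have hV := preparation_eval_mem_unitaryGroup (n := n) (k := k) hU hβ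
  rw [groverIteration, Circuit.eval_append, Circuit.eval_append, Circuit.eval_append,
    Circuit.eval_singleton, Circuit.eval_singleton, Circuit.eval_inverse, Gate.eval, Gate.eval]
  set V := Circuit.eval U (preparation D n k β)
  set s := start D n k
  have h1 : V * ((2 : ℂ) • Matrix.vecMulVec s (star s) - 1) * Vᴴ =
      (2 : ℂ) • Matrix.vecMulVec (V *ᵥ s) (star (V *ᵥ s)) - 1 := by
    rw [mul_sub, sub_mul, mul_one, mul_conjTranspose_self_of_mem hV, Matrix.mul_smul,
      Matrix.smul_mul, Matrix.mul_vecMulVec, Matrix.vecMulVec_mul, ← Matrix.star_mulVec]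
  have h2 : (1 - (2 : ℂ) • projZero D n k) *ᵥ f = f - (2 : ℂ) • (projZero D n k *ᵥ f) := by
    rw [Matrix.sub_mulVec, Matrix.one_mulVec, Matrix.smul_mulVec]
  rw [← mul_assoc, ← mul_assoc, h1, ← Matrix.mulVec_mulVec, h2, Matrix.sub_mulVec,
    Matrix.one_mulVec, Matrix.smul_mulVec, Matrix.vecMulVec_mulVec]
  congr 1
  funext x
  simp only [Pi.smul_apply, smul_eq_mul, MulOpposite.smul_eq_mul_unop, MulOpposite.unop_op]
  ring

theorem attemptState_succ (U : Matrix (Fin D) (Fin D) ℂ) (β : ℝ) (j : ℕ) :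
    attemptState n k U β (j + 1) =
      Circuit.eval U (groverIteration D n k β) *ᵥ attemptState n k U β j := by
  simp only [attemptState, attempt]
  rw [List.replicate_succ', List.flatten_append, ← List.append_assoc, Circuit.eval_append,
    ← Matrix.mulVec_mulVec]
  simp

/-- Amplitude amplification stays in the plane of the accepted and the rejected branch. -/
theorem exists_attemptState_eq [NeZero D] {U : Matrix (Fin D) (Fin D) ℂ}
    (hU : U ∈ Matrix.unitaryGroup (Fin D) ℂ) {β φ : ℝ} (hβ : 0 ≤ β) {Ψ Φ : Basis D n k → ℂ}
    (hΨ : Ψ = Circuit.eval U (preparation D n k β) *ᵥ start D n k)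
    (hΦ : Φ = projZero D n k *ᵥ Ψ) (hφ : ∑ x, ‖Φ x‖ ^ 2 = Real.sin φ ^ 2) (j : ℕ) :
    ∃ p q : ℝ, attemptState n k U β j = (p : ℂ) • Φ + (q : ℂ) • (Ψ - Φ) ∧
      Real.sin φ * p = Real.sin ((2 * j + 1) * φ) ∧
      Real.cos φ * q = Real.cos ((2 * j + 1) * φ) := by
  have hΨΦ : star Ψ ⬝ᵥ Φ = ((Real.sin φ ^ 2 : ℝ) : ℂ) := by
    rw [hΦ, star_dotProduct_projZero, ← hΦ, hφ]
  have hΨΨ : star Ψ ⬝ᵥ Ψ = 1 := by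
    rw [star_dotProduct_self_eq, hΨ,
      sum_sq_norm_unitary_mulVec (preparation_eval_mem_unitaryGroup hU hβ), sum_sq_norm_start]
    simp
  have hPΦ : projZero D n k *ᵥ Φ = Φ := by rw [hΦ, projZero_mulVec_idem]
  -- The invariants are products with sin φ and cos φ, so no division is needed when cos φ = 0, i.e.
  -- when everything is accepted.
  induction j with
  | zero =>
    refine ⟨1, 1, ?_, by simp, by simp⟩
    simp [attemptState, attempt, hΨ]
  | succ j ih =>
    obtain ⟨p, q, hs, hp, hq⟩ := ih
    set a := Real.sin φ ^ 2 with ha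
    have hca : Real.cos φ ^ 2 = 1 - a := by
      rw [ha]; linarith [Real.sin_sq_add_cos_sq φ]
    refine ⟨(1 - 2 * a) * p + 2 * (1 - a) * q, -2 * a * p + (1 - 2 * a) * q, ?_, ?_, ?_⟩
    · rw [attemptState_succ, groverIteration_mulVec hU hβ, ← hΨ, hs]
      have h1 : projZero D n k *ᵥ ((p : ℂ) • Φ + (q : ℂ) • (Ψ - Φ)) = (p : ℂ) • Φ := by
        rw [Matrix.mulVec_add, Matrix.mulVec_smul, Matrix.mulVec_smul, Matrix.mulVec_sub, hPΦ,
          ← hΦ, sub_self, smul_zero, add_zero]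
      rw [h1]
      have h2 : star Ψ ⬝ᵥ ((p : ℂ) • Φ + (q : ℂ) • (Ψ - Φ) - (2 : ℂ) • (p : ℂ) • Φ)
          = -(p * a) + q * (1 - a) := by
        rw [dotProduct_sub, dotProduct_add, dotProduct_smul, dotProduct_smul, dotProduct_smul,
          dotProduct_smul, dotProduct_sub, hΨΨ, hΨΦ]
        simp only [smul_eq_mul]
        ring
      rw [h2]
      funext x
      simp only [Pi.sub_apply, Pi.add_apply, Pi.smul_apply, smul_eq_mul]
      push_cast
      ring
    · have e : ((2 * ((j + 1 : ℕ) : ℝ) + 1) * φ) = (2 * j + 1) * φ + 2 * φ := by push_cast; ring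
      rw [e, Real.sin_add, ← hp, ← hq, Real.cos_two_mul, Real.sin_two_mul, hca]
      linear_combination (2 * q * Real.sin φ) * (-hca)
    · have e : ((2 * ((j + 1 : ℕ) : ℝ) + 1) * φ) = (2 * j + 1) * φ + 2 * φ := by push_cast; ring
      rw [e, Real.cos_add, ← hp, ← hq, Real.cos_two_mul, Real.sin_two_mul, hca, ha]
      ring

/-- Projection leaves a multiple pΦ of one fixed vector whatever j is, so the number of iterations
affects only the probability, not the state. -/
theorem attempt_accepted [NeZero D] {U : Matrix (Fin D) (Fin D) ℂ}
    (hU : U ∈ Matrix.unitaryGroup (Fin D) ℂ) {β φ : ℝ} (hβ : 0 ≤ β) {Φ : Basis D n k → ℂ}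
    (hΦ : Φ = projZero D n k *ᵥ (Circuit.eval U (preparation D n k β) *ᵥ start D n k))
    (hφ : ∑ x, ‖Φ x‖ ^ 2 = Real.sin φ ^ 2) (j : ℕ) :
    ∃ p : ℝ, successProb n k U β j = p ^ 2 * ∑ x, ‖Φ x‖ ^ 2 ∧
      successProb n k U β j = Real.sin ((2 * j + 1) * φ) ^ 2 ∧
      attemptOutput n k U β j = ((p ^ 2 : ℝ) : ℂ) •
        partialTrace (Matrix.vecMulVec Φ (star Φ)) := by
  obtain ⟨p, q, hs, hp, -⟩ := exists_attemptState_eq hU hβ rfl hΦ hφ j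
  have hPΦ : projZero D n k *ᵥ Φ = Φ := by rw [hΦ, projZero_mulVec_idem]
  have hproj : projZero D n k *ᵥ attemptState n k U β j = (p : ℂ) • Φ := by
    rw [hs, Matrix.mulVec_add, Matrix.mulVec_smul, Matrix.mulVec_smul, Matrix.mulVec_sub, hPΦ, ← hΦ,
      sub_self, smul_zero, add_zero]
  have h1 : successProb n k U β j = p ^ 2 * ∑ x, ‖Φ x‖ ^ 2 := by
    rw [successProb, hproj, Finset.mul_sum]
    refine Finset.sum_congr rfl fun x _ => ?_
    rw [Pi.smul_apply, norm_smul, mul_pow, Complex.norm_real, Real.norm_eq_abs, sq_abs]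
  refine ⟨p, h1, ?_, ?_⟩
  · rw [h1, hφ, ← hp]; ring
  · rw [attemptOutput, projZero_mul_vecMulVec_mul, hproj]
    ext a a'
    simp only [partialTrace, Matrix.smul_apply, smul_eq_mul, Finset.mul_sum]
    refine Finset.sum_congr rfl fun r _ => ?_
    simp only [Matrix.vecMulVec_apply, Pi.smul_apply, Pi.star_apply, smul_eq_mul, star_mul',
      Complex.star_def, Complex.conj_ofReal]
    push_cast
    ring

end Output

/-! ### The search with unknown overlap -/

section Rounds

theorem two_sin_mul_sum_cos (x : ℝ) (M : ℕ) :
    2 * Real.sin x * ∑ j ∈ Finset.range M, Real.cos ((2 * j + 1) * x) = Real.sin (2 * M * x) := by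
  induction M with
  | zero => simp
  | succ M ih =>
    rw [Finset.sum_range_succ, mul_add, ih]
    have e1 : 2 * ((M + 1 : ℕ) : ℝ) * x = (2 * M + 1) * x + x := by push_cast; ring
    have e2 : 2 * (M : ℝ) * x = (2 * M + 1) * x - x := by ring
    rw [e1, e2, Real.sin_add, Real.sin_sub]
    ring

theorem sum_sin_sq_eq (φ : ℝ) (M : ℕ) :
    ∑ j ∈ Finset.range M, Real.sin ((2 * j + 1) * φ) ^ 2 =
      (M - ∑ j ∈ Finset.range M, Real.cos ((2 * j + 1) * (2 * φ))) / 2 := by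
  have h : ∀ j : ℕ, Real.sin ((2 * j + 1) * φ) ^ 2
      = 1 / 2 - Real.cos ((2 * j + 1) * (2 * φ)) / 2 := fun j => by
    rw [Real.sin_sq_eq_half_sub]
    congr 3; ring
  simp_rw [h]
  rw [Finset.sum_sub_distrib, Finset.sum_const, Finset.card_range, nsmul_eq_mul, ← Finset.sum_div,
    mul_one_div, sub_div]

/-- The sum equals sin(4Mφ) / (2 sin 2φ) when sin 2φ ≠ 0, so M sin 2φ ≥ 1 is enough. For φ ≤ π/3
this follows from sin 2φ ≥ sin φ. Near π/2, where sin 2φ degenerates, ψ = π/2 - φ takes over: either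
4Mψ ≤ π and the sum is not positive, or Jordan's inequality gives M sin 2ψ ≥ 1. -/
theorem sum_cos_le_half {φ : ℝ} (h0 : 0 < φ) (h1 : φ ≤ Real.pi / 2) {M : ℕ} (hM0 : 0 < M)
    (hM : 1 ≤ M * Real.sin φ) :
    ∑ j ∈ Finset.range M, Real.cos ((2 * j + 1) * (2 * φ)) ≤ M / 2 := by
  have hπ := Real.pi_pos
  have hMr : (0 : ℝ) < M := by exact_mod_cast hM0
  set T := ∑ j ∈ Finset.range M, Real.cos ((2 * j + 1) * (2 * φ)) with hT
  have key := two_sin_mul_sum_cos (2 * φ) M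
  rw [← hT] at key
  have hsin : 0 < Real.sin φ := Real.sin_pos_of_pos_of_lt_pi h0 (by linarith)
  -- if `M sin (2φ) ≥ 1`, the sum is at most `1 / (2 sin (2φ))`
  have main : 1 ≤ M * Real.sin (2 * φ) → T ≤ M / 2 := by
    intro h
    have hs : 0 < Real.sin (2 * φ) := by
      by_contra hcon
      push Not at hcon
      nlinarith
    have h2 := Real.sin_le_one (2 * M * (2 * φ))
    rw [← key] at h2
    by_contra hcon
    push Not at hcon
    nlinarith
  rcases le_or_gt φ (Real.pi / 3) with h | h
  · apply main
    have hc : 1 / 2 ≤ Real.cos φ := by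
      rw [← Real.cos_pi_div_three]
      exact Real.cos_le_cos_of_nonneg_of_le_pi h0.le (by linarith) h
    rw [Real.sin_two_mul]
    nlinarith
  · set ψ := Real.pi / 2 - φ with hψ
    have hψ0 : 0 ≤ ψ := by linarith
    have e1 : Real.sin (2 * φ) = Real.sin (2 * ψ) := by
      rw [show 2 * φ = Real.pi - 2 * ψ by rw [hψ]; ring, Real.sin_pi_sub]
    rcases eq_or_lt_of_le hψ0 with hz | hpos
    · have hneg : ∀ j ∈ Finset.range M, Real.cos ((2 * j + 1) * (2 * φ)) ≤ 0 := by
        intro j _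
        have : (2 * (j : ℝ) + 1) * (2 * φ) = Real.pi + j * (2 * Real.pi) := by
          have : φ = Real.pi / 2 := by linarith
          rw [this]; ring
        rw [this, Real.cos_add_nat_mul_two_pi, Real.cos_pi]
        norm_num
      exact (Finset.sum_nonpos hneg).trans (by positivity)
    have hjordan := Real.mul_le_sin (x := 2 * ψ) (by linarith) (by linarith)
    rcases le_or_gt (4 * M * ψ) Real.pi with hsmall | hlarge
    · have e2 : Real.sin (2 * M * (2 * φ)) = -Real.sin (4 * M * ψ) := by
        rw [show 2 * (M : ℝ) * (2 * φ) = M * (2 * Real.pi) - 4 * M * ψ by rw [hψ]; ring,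
          Real.sin_nat_mul_two_pi_sub]
      have h3 : 0 ≤ Real.sin (4 * M * ψ) :=
        Real.sin_nonneg_of_nonneg_of_le_pi (by positivity) hsmall
      have h4 : 0 < Real.sin (2 * φ) := by
        rw [e1]; exact Real.sin_pos_of_pos_of_lt_pi (by linarith) (by linarith)
      by_contra hcon
      push Not at hcon
      have : 0 < T := lt_trans (by positivity) hcon
      have : 0 < 2 * Real.sin (2 * φ) * T := by positivity
      linarith
    · apply main
      rw [e1]
      have h5 : 1 ≤ M * (2 / Real.pi * (2 * ψ)) := by
        rw [show (M : ℝ) * (2 / Real.pi * (2 * ψ)) = 4 * M * ψ / Real.pi by ring, le_div_iff₀ hπ]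
        linarith
      exact h5.trans (by gcongr)

theorem sum_range_odd (M : ℕ) : ∑ j ∈ Finset.range M, (2 * (j : ℝ) + 1) = (M : ℝ) ^ 2 := by
  induction M with
  | zero => simp
  | succ M ih => rw [Finset.sum_range_succ, ih]; push_cast; ring

theorem roundSize_pos (s : ℕ) : 0 < roundSize s := Nat.ceil_pos.2 (by positivity)

theorem le_roundSize (s : ℕ) : ((6 : ℝ) / 5) ^ s ≤ roundSize s := Nat.le_ceil _

theorem roundSize_le (s : ℕ) : (roundSize s : ℝ) ≤ 2 * ((6 : ℝ) / 5) ^ s := by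
  have h1 := (Nat.ceil_lt_add_one (by positivity : (0 : ℝ) ≤ ((6 : ℝ) / 5) ^ s)).le
  have h2 : (1 : ℝ) ≤ ((6 : ℝ) / 5) ^ s := one_le_pow₀ (by norm_num)
  rw [roundSize]
  linarith

end Rounds

/-! ### Termination and expected work of the search. -/

section Search

variable {D n k : ℕ} {U : Matrix (Fin D) (Fin D) ℂ} {β φ : ℝ}

theorem roundSuccess_mem
    (hsucc : ∀ j : ℕ, successProb n k U β j = Real.sin ((2 * j + 1) * φ) ^ 2) (s : ℕ) :
    0 ≤ roundSuccess n k U β s ∧ roundSuccess n k U β s ≤ 1 := by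
  have hM : (0 : ℝ) < roundSize s := by exact_mod_cast roundSize_pos s
  rw [roundSuccess]
  simp_rw [hsucc]
  refine ⟨div_nonneg (Finset.sum_nonneg fun _ _ => sq_nonneg _) hM.le, ?_⟩
  rw [div_le_one hM]
  refine (Finset.sum_le_sum fun j _ => Real.sin_sq_le_one _).trans ?_
  simp

/-- The average of sin²((2j+1)φ) over j < M is 1/2 minus the cosine sum over 2M, and that sum is at
most M/2. -/
theorem roundSuccess_ge (h0 : 0 < φ) (h1 : φ ≤ Real.pi / 2)
    (hsucc : ∀ j : ℕ, successProb n k U β j = Real.sin ((2 * j + 1) * φ) ^ 2) {s : ℕ}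
    (hs : 1 ≤ ((6 : ℝ) / 5) ^ s * Real.sin φ) : 1 / 4 ≤ roundSuccess n k U β s := by
  have hM : (0 : ℝ) < roundSize s := by exact_mod_cast roundSize_pos s
  have hsin : 0 < Real.sin φ := Real.sin_pos_of_pos_of_lt_pi h0 (by linarith [Real.pi_pos])
  have h2 := sum_cos_le_half h0 h1 (roundSize_pos s)
    (hs.trans (mul_le_mul_of_nonneg_right (le_roundSize s) hsin.le))
  rw [roundSuccess]
  simp_rw [hsucc]
  rw [sum_sin_sq_eq, le_div_iff₀ hM]
  linarith

theorem reachProb_nonneg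
    (hsucc : ∀ j : ℕ, successProb n k U β j = Real.sin ((2 * j + 1) * φ) ^ 2) (s : ℕ) :
    0 ≤ reachProb n k U β s :=
  Finset.prod_nonneg fun t _ => by linarith [(roundSuccess_mem hsucc t).2]

theorem reachProb_le_one
    (hsucc : ∀ j : ℕ, successProb n k U β j = Real.sin ((2 * j + 1) * φ) ^ 2) (s : ℕ) :
    reachProb n k U β s ≤ 1 :=
  Finset.prod_le_one (fun t _ => by linarith [(roundSuccess_mem hsucc t).2])
    fun t _ => by linarith [(roundSuccess_mem hsucc t).1]

/-- A first round from which on every round succeeds with probability at least `1/4`. -/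
theorem exists_reachProb_le (h0 : 0 < φ) (h1 : φ ≤ Real.pi / 2)
    (hsucc : ∀ j : ℕ, successProb n k U β j = Real.sin ((2 * j + 1) * φ) ^ 2) :
    ∃ s₀ : ℕ, ((6 : ℝ) / 5) ^ s₀ ≤ 6 / 5 * (1 / Real.sin φ) ∧
      ∀ i, reachProb n k U β (s₀ + i) ≤ (3 / 4) ^ i := by
  have hsin : 0 < Real.sin φ := Real.sin_pos_of_pos_of_lt_pi h0 (by linarith [Real.pi_pos])
  have hex : ∃ s : ℕ, 1 ≤ ((6 : ℝ) / 5) ^ s * Real.sin φ := by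
    obtain ⟨s, hs⟩ := pow_unbounded_of_one_lt (1 / Real.sin φ) (by norm_num : (1 : ℝ) < 6 / 5)
    refine ⟨s, ?_⟩
    rw [div_lt_iff₀ hsin] at hs
    exact hs.le
  classical
  refine ⟨Nat.find hex, ?_, fun i => ?_⟩
  · rcases Nat.eq_zero_or_pos (Nat.find hex) with hz | hpos
    · rw [hz, pow_zero]
      have : 1 ≤ 1 / Real.sin φ := by
        rw [le_div_iff₀ hsin, one_mul]; exact Real.sin_le_one _
      linarith
    · obtain ⟨m, hm⟩ := Nat.exists_eq_succ_of_ne_zero hpos.ne'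
      have hlt := Nat.find_min hex (m := m) (by omega)
      push Not at hlt
      rw [hm, pow_succ]
      have : ((6 : ℝ) / 5) ^ m ≤ 1 / Real.sin φ := by
        rw [le_div_iff₀ hsin]; exact hlt.le
      linarith
  · have hspec := Nat.find_spec hex
    rw [reachProb, Finset.prod_range_add]
    have hb : ∀ t, 0 ≤ 1 - roundSuccess n k U β t := fun t => by
      linarith [(roundSuccess_mem hsucc t).2]
    have h2 : ∏ t ∈ Finset.range i, (1 - roundSuccess n k U β (Nat.find hex + t))
        ≤ ∏ _t ∈ Finset.range i, (3 / 4 : ℝ) := by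
      refine Finset.prod_le_prod (fun t _ => hb _) fun t _ => ?_
      have h3 : 1 ≤ ((6 : ℝ) / 5) ^ (Nat.find hex + t) * Real.sin φ := by
        refine hspec.trans (mul_le_mul_of_nonneg_right ?_ hsin.le)
        exact pow_le_pow_right₀ (by norm_num) (Nat.le_add_right _ _)
      linarith [roundSuccess_ge h0 h1 hsucc h3]
    rw [Finset.prod_const, Finset.card_range] at h2
    exact (mul_le_of_le_one_left (Finset.prod_nonneg fun t _ => hb _)
      (reachProb_le_one hsucc _)).trans h2

theorem hasSum_stopProb (h0 : 0 < φ) (h1 : φ ≤ Real.pi / 2)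
    (hsucc : ∀ j : ℕ, successProb n k U β j = Real.sin ((2 * j + 1) * φ) ^ 2) :
    HasSum (stopProb n k U β) 1 := by
  have hnn : ∀ s, 0 ≤ stopProb n k U β s := fun s =>
    mul_nonneg (reachProb_nonneg hsucc s) (roundSuccess_mem hsucc s).1
  rw [hasSum_iff_tendsto_nat_of_nonneg hnn]
  have hpart : ∀ S, ∑ s ∈ Finset.range S, stopProb n k U β s = 1 - reachProb n k U β S := by
    intro S
    induction S with
    | zero => simp [reachProb]
    | succ S ih =>
      rw [Finset.sum_range_succ, ih, stopProb, reachProb, reachProb, Finset.prod_range_succ]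
      ring
  simp_rw [hpart]
  obtain ⟨s₀, -, hs₀⟩ := exists_reachProb_le h0 h1 hsucc
  have hlim : Filter.Tendsto (fun S => reachProb n k U β S) Filter.atTop (nhds 0) := by
    rw [← Filter.tendsto_add_atTop_iff_nat s₀]
    refine squeeze_zero (fun S => reachProb_nonneg hsucc _) (fun S => ?_)
      (tendsto_pow_atTop_nhds_zero_of_lt_one (by norm_num) (by norm_num : (3 / 4 : ℝ) < 1))
    rw [add_comm]
    exact hs₀ S
  simpa using hlim.const_sub 1

/-- Before s₀ the rounds form a geometric sum bounded by 5(6/5)^{s₀}. From s₀ on, each further round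
multiplies the bound by (3/4)(6/5) = 9/10, for a total of 10(6/5)^{s₀}. It is essential that the
growth rate 6/5 is below 4/3. -/
theorem sum_reachProb_mul_pow_le (h0 : 0 < φ) (h1 : φ ≤ Real.pi / 2)
    (hsucc : ∀ j : ℕ, successProb n k U β j = Real.sin ((2 * j + 1) * φ) ^ 2) (S : ℕ) :
    ∑ s ∈ Finset.range S, reachProb n k U β s * ((6 : ℝ) / 5) ^ s ≤ 18 / Real.sin φ := by
  obtain ⟨s₀, hT, hs₀⟩ := exists_reachProb_le h0 h1 hsucc
  have hnn : ∀ s, 0 ≤ reachProb n k U β s * ((6 : ℝ) / 5) ^ s := fun s =>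
    mul_nonneg (reachProb_nonneg hsucc s) (by positivity)
  have hpos : (0 : ℝ) < (6 / 5) ^ s₀ := by positivity
  calc ∑ s ∈ Finset.range S, reachProb n k U β s * ((6 : ℝ) / 5) ^ s
      ≤ ∑ s ∈ Finset.range (s₀ + S), reachProb n k U β s * ((6 : ℝ) / 5) ^ s :=
        Finset.sum_le_sum_of_subset_of_nonneg (Finset.range_mono (Nat.le_add_left _ _))
          fun s _ _ => hnn s
    _ ≤ 5 * (6 / 5) ^ s₀ + 10 * (6 / 5) ^ s₀ := by
        rw [Finset.sum_range_add]
        refine add_le_add ?_ ?_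
        · have h2 : ∑ s ∈ Finset.range s₀, reachProb n k U β s * ((6 : ℝ) / 5) ^ s
              ≤ ∑ s ∈ Finset.range s₀, ((6 : ℝ) / 5) ^ s :=
            Finset.sum_le_sum fun s _ =>
              mul_le_of_le_one_left (by positivity) (reachProb_le_one hsucc s)
          rw [geom_sum_eq (by norm_num)] at h2
          refine h2.trans ?_
          rw [div_le_iff₀ (by norm_num)]
          linarith
        · have h3 : ∀ i ∈ Finset.range S, reachProb n k U β (s₀ + i) * ((6 : ℝ) / 5) ^ (s₀ + i)
              ≤ (6 / 5) ^ s₀ * (9 / 10 : ℝ) ^ i := fun i _ => by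
            calc _ ≤ (3 / 4 : ℝ) ^ i * (6 / 5) ^ (s₀ + i) := by gcongr; exact hs₀ i
              _ = (6 / 5) ^ s₀ * ((3 / 4) * (6 / 5)) ^ i := by rw [mul_pow, pow_add]; ring
              _ = _ := by norm_num
          refine (Finset.sum_le_sum h3).trans ?_
          rw [← Finset.mul_sum, geom_sum_eq (by norm_num), mul_comm]
          refine mul_le_mul_of_nonneg_right ?_ hpos.le
          have : (0 : ℝ) < (9 / 10) ^ S := by positivity
          rw [div_le_iff_of_neg (by norm_num)]
          linarith
    _ = 15 * (6 / 5) ^ s₀ := by ring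
    _ ≤ 15 * (6 / 5 * (1 / Real.sin φ)) := by gcongr
    _ = 18 / Real.sin φ := by ring

end Search

/-! ### Counting invocations. -/

section Cost

variable {D n k : ℕ}

theorem Circuit.cost_append (c₁ c₂ : Circuit D n k) :
    Circuit.cost (c₁ ++ c₂) = Circuit.cost c₁ + Circuit.cost c₂ := by
  simp [Circuit.cost]

theorem Circuit.cost_inverse (c : Circuit D n k) : Circuit.cost (Circuit.inverse c) = c.cost := by
  have h : ∀ g : Gate D n k, g.inv.cost = g.cost := fun g => by cases g <;> rfl
  simp [Circuit.cost, Circuit.inverse, List.sum_reverse, Function.comp_def, h]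

theorem cost_phaseEstimation (l : Fin k) :
    Circuit.cost (phaseEstimation l : Circuit D n k) = 2 ^ n - 1 := by
  have h1 : ∀ (js : List (Fin n)), Circuit.cost
      (js.flatMap fun j => List.replicate (2 ^ j.val) (Gate.query l j) : Circuit D n k)
      = (js.map fun j : Fin n => 2 ^ j.val).sum := by
    intro js
    induction js with
    | nil => rfl
    | cons j js ih =>
      rw [List.flatMap_cons, Circuit.cost_append, ih, List.map_cons, List.sum_cons]
      simp [Circuit.cost, Gate.cost]
  rw [phaseEstimation, Circuit.cost_append, Circuit.cost_append, h1, ← Fin.sum_univ_def,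
    Fin.sum_univ_eq_sum_range (fun i => 2 ^ i), Nat.geomSum_eq le_rfl]
  simp [Circuit.cost, Gate.cost]

theorem cost_preparation (β : ℝ) :
    Circuit.cost (preparation D n k β) = k * (2 ^ n - 1) := by
  have h1 : ∀ ls : List (Fin k), Circuit.cost (ls.flatMap phaseEstimation : Circuit D n k)
      = ls.length * (2 ^ n - 1) := by
    intro ls
    induction ls with
    | nil => simp [Circuit.cost]
    | cons l ls ih =>
      rw [List.flatMap_cons, Circuit.cost_append, ih, cost_phaseEstimation, List.length_cons]
      ring
  rw [preparation, Circuit.cost_append, h1, List.length_finRange]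
  simp [Circuit.cost, Gate.cost]

theorem cost_attempt (β : ℝ) (j : ℕ) :
    Circuit.cost (attempt D n k β j) = (2 * j + 1) * (k * (2 ^ n - 1)) := by
  have hG : Circuit.cost (groverIteration D n k β) = 2 * (k * (2 ^ n - 1)) := by
    rw [groverIteration, Circuit.cost_append, Circuit.cost_append, Circuit.cost_append,
      Circuit.cost_inverse, cost_preparation]
    simp only [Circuit.cost, List.map_cons, List.map_nil, List.sum_cons, List.sum_nil, Gate.cost]
    ring
  have hj : Circuit.cost (List.replicate j (groverIteration D n k β)).flatten
      = j * (2 * (k * (2 ^ n - 1))) := by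
    induction j with
    | zero => simp [Circuit.cost]
    | succ j ih =>
      rw [List.replicate_succ, List.flatten_cons, Circuit.cost_append, ih, hG]
      ring
  rw [attempt, Circuit.cost_append, cost_preparation, hj]
  ring

/-- An attempt with j iterations costs 2j + 1 preparations, which average to M over j < M. Since M ≤
2(6/5)^s, the factor is 36 = 2 · 18. -/
theorem expectedQueries_le {U : Matrix (Fin D) (Fin D) ℂ} {β φ : ℝ} (h0 : 0 < φ)
    (h1 : φ ≤ Real.pi / 2)
    (hsucc : ∀ j : ℕ, successProb n k U β j = Real.sin ((2 * j + 1) * φ) ^ 2) :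
    expectedQueries D n k U β ≤
      ENNReal.ofReal (36 / Real.sin φ * (k * (2 ^ n - 1))) := by
  have hP : ((k * (2 ^ n - 1) : ℕ) : ℝ) = k * (2 ^ n - 1) := by
    rw [Nat.cast_mul, Nat.cast_sub Nat.one_le_two_pow]; push_cast; rfl
  have hP0 : (0 : ℝ) ≤ k * (2 ^ n - 1) := by rw [← hP]; positivity
  have hterm : ∀ s, reachProb n k U β s * ((∑ j ∈ Finset.range (roundSize s),
      (Circuit.cost (attempt D n k β j) : ℝ)) / roundSize s) ≤
      2 * (k * (2 ^ n - 1)) * (reachProb n k U β s * ((6 : ℝ) / 5) ^ s) := by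
    intro s
    have hM : (0 : ℝ) < roundSize s := by exact_mod_cast roundSize_pos s
    have h2 : (∑ j ∈ Finset.range (roundSize s), (Circuit.cost (attempt D n k β j) : ℝ))
        / roundSize s = roundSize s * (k * (2 ^ n - 1)) := by
      have h3 : ∀ j : ℕ, (Circuit.cost (attempt D n k β j) : ℝ)
          = (2 * (j : ℝ) + 1) * (k * (2 ^ n - 1)) := fun j => by
        rw [cost_attempt, Nat.cast_mul, hP]; push_cast; rfl
      simp_rw [h3]
      rw [← Finset.sum_mul, sum_range_odd]
      field_simp
    rw [h2]
    have h4 := mul_le_mul_of_nonneg_left (mul_le_mul_of_nonneg_right (roundSize_le s) hP0)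
      (reachProb_nonneg hsucc s)
    linarith
  have hnn : ∀ s, 0 ≤ reachProb n k U β s * ((∑ j ∈ Finset.range (roundSize s),
      (Circuit.cost (attempt D n k β j) : ℝ)) / roundSize s) := fun s =>
    mul_nonneg (reachProb_nonneg hsucc s) (by positivity)
  rw [expectedQueries]
  refine ENNReal.tsum_le_of_sum_range_le fun S => ?_
  rw [← ENNReal.ofReal_sum_of_nonneg fun s _ => hnn s]
  refine ENNReal.ofReal_le_ofReal ((Finset.sum_le_sum fun s _ => hterm s).trans ?_)
  rw [← Finset.mul_sum]
  have := mul_le_mul_of_nonneg_left (sum_reachProb_mul_pow_le h0 h1 hsucc S)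
    (by positivity : (0 : ℝ) ≤ 2 * (k * (2 ^ n - 1)))
  refine this.trans (le_of_eq ?_)
  ring

end Cost

/-! ### The main theorem -/

section Main

variable {D : ℕ} {n k : ℕ} {β : ℝ} {Q : Matrix (Fin D) (Fin D) ℂ}

theorem weight_pos (hβ : 0 ≤ β) (θ : ℝ) : 0 < weight n k β θ :=
  (Real.exp_pos _).trans_le (exp_neg_le_weight hβ θ)

/-- The trace of the accepted state is W/D with 0 < W ≤ D, so φ = arcsin √(W/D) is a legitimate
angle in (0, π/2]. -/
theorem exists_successProb_eq [NeZero D] (hQ : Q ∈ Matrix.unitaryGroup (Fin D) ℂ)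
    (θ : Fin D → ℝ) (hβ : 0 ≤ β) {U : Matrix (Fin D) (Fin D) ℂ}
    (hU : U = udiag Q fun j => Complex.exp ((2 * Real.pi * θ j : ℝ) * Complex.I)) :
    ∃ φ, 0 < φ ∧ φ ≤ Real.pi / 2 ∧ Real.sin φ = √((∑ j, weight n k β (θ j)) / D) ∧
      (∀ j : ℕ, successProb n k U β j = Real.sin ((2 * j + 1) * φ) ^ 2) ∧
      ∀ j, attemptOutput n k U β j = ((successProb n k U β j : ℝ) : ℂ) •
        udiag Q fun j => ((weight n k β (θ j) / ∑ i, weight n k β (θ i) : ℝ) : ℂ) := by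
  have hUu : U ∈ Matrix.unitaryGroup (Fin D) ℂ := by
    rw [hU]
    exact udiag_mem_unitaryGroup hQ fun j => Complex.norm_exp_ofReal_mul_I _
  have hD : (0 : ℝ) < D := by exact_mod_cast NeZero.pos D
  set Φ : Basis D n k → ℂ :=
    projZero D n k *ᵥ (Circuit.eval U (preparation D n k β) *ᵥ start D n k) with hΦ
  set W := ∑ j, weight n k β (θ j) with hW
  have hW0 : 0 < W := Finset.sum_pos (fun j _ => weight_pos hβ _) Finset.univ_nonempty
  have hWD : W ≤ D := by
    have := Finset.sum_le_sum fun j (_ : j ∈ Finset.univ) => weight_le_one (n := n) (k := k) hβ (θ j)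
    simpa using this
  have hpt : partialTrace (Matrix.vecMulVec Φ (star Φ)) =
      ((1 / D : ℝ) : ℂ) • udiag Q fun j => ((weight n k β (θ j) : ℝ) : ℂ) := by
    refine partialTrace_accepted hQ θ β fun x => ?_
    rw [hΦ, hU]
    exact projZero_preparation_start hQ θ β x
  have ha : ∑ x, ‖Φ x‖ ^ 2 = W / D := by
    have h := sum_sq_norm_eq_trace_partialTrace Φ
    rw [hpt, Matrix.trace_smul, udiag_trace hQ, smul_eq_mul, ← Complex.ofReal_sum,
      ← Complex.ofReal_mul] at h
    rw [Complex.ofReal_injective h, ← hW, one_div_mul_eq_div]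
  have hr0 : 0 < √(W / D) := Real.sqrt_pos.2 (div_pos hW0 hD)
  have hr1 : √(W / D) ≤ 1 := Real.sqrt_le_one.2 ((div_le_one hD).2 hWD)
  have hs : Real.sin (Real.arcsin √(W / D)) = √(W / D) :=
    Real.sin_arcsin (by linarith) hr1
  have hφ : ∑ x, ‖Φ x‖ ^ 2 = Real.sin (Real.arcsin √(W / D)) ^ 2 := by
    rw [hs, ha, Real.sq_sqrt (div_pos hW0 hD).le]
  refine ⟨Real.arcsin √(W / D), Real.arcsin_pos.2 hr0, Real.arcsin_le_pi_div_two _, hs,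
    fun j => ?_, fun j => ?_⟩
  · obtain ⟨p, -, h, -⟩ := attempt_accepted hUu hβ hΦ hφ j
    exact h
  · obtain ⟨p, h1, -, h2⟩ := attempt_accepted hUu hβ hΦ hφ j
    rw [h2, h1, hpt, ha, ← udiag_smul, ← udiag_smul, ← udiag_smul]
    congr 1
    funext i
    simp only [Pi.smul_apply, smul_eq_mul, ← Complex.ofReal_mul]
    congr 1
    field_simp

theorem posSemidef_udiag (Q : Matrix (Fin D) (Fin D) ℂ) {d : Fin D → ℝ} (hd : ∀ i, 0 ≤ d i) :
    (udiag Q fun i => (d i : ℂ)).PosSemidef := by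
  have h : (Matrix.diagonal fun i => (d i : ℂ)).PosSemidef :=
    Matrix.PosSemidef.diagonal fun i => by simpa using hd i
  exact h.mul_mul_conjTranspose_same Q

/-- Round s contributes its stopping probability times the common state, and these probabilities sum
to 1. -/
theorem isOutput_of_attemptOutput {U ρ : Matrix (Fin D) (Fin D) ℂ} {φ : ℝ} (h0 : 0 < φ)
    (h1 : φ ≤ Real.pi / 2) (hρ : ρ.PosSemidef) (htr : ρ.trace = 1)
    (hsucc : ∀ j : ℕ, successProb n k U β j = Real.sin ((2 * j + 1) * φ) ^ 2)
    (hout : ∀ j, attemptOutput n k U β j = ((successProb n k U β j : ℝ) : ℂ) • ρ) :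
    IsOutput n k U β ρ := by
  have hsum := hasSum_stopProb h0 h1 hsucc
  refine ⟨hρ, htr, hsum, ?_, hout⟩
  have hround : roundOutput n k U β = fun s => ((stopProb n k U β s : ℝ) : ℂ) • ρ := by
    funext s
    rw [roundOutput, Finset.sum_congr rfl fun j _ => hout j, ← Finset.sum_smul, smul_smul,
      ← Complex.ofReal_sum, ← Complex.ofReal_mul, stopProb, roundSuccess, div_mul_eq_mul_div,
      mul_div_assoc]
  rw [hround]
  have hc : HasSum (fun s => ((stopProb n k U β s : ℝ) : ℂ)) ((1 : ℝ) : ℂ) :=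
    Complex.hasSum_ofReal.2 hsum
  simpa using hc.smul_const ρ

/-- The lower bound 1/32 absorbs the +1 from the ceiling: 36 = 4 + 32. -/
theorem repetitions_le {ε : ℝ} (hβ : 0 < β) (hε : 0 < ε) (hε1 : ε < 1)
    (h : 1 / 32 ≤ Real.log (1 / ε) + β) :
    (repetitions (Real.exp (-β) * ε ^ 2) : ℝ) ≤ 36 * (Real.log (1 / ε) + β) := by
  have hl : 0 ≤ Real.log (1 / ε) := Real.log_nonneg (one_le_one_div hε hε1.le)
  have hlog : Real.log (1 / (Real.exp (-β) * ε ^ 2)) = β + 2 * Real.log (1 / ε) := by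
    rw [one_div, Real.log_inv, Real.log_mul (Real.exp_pos _).ne' (by positivity), Real.log_exp,
      Real.log_pow, one_div, Real.log_inv]
    push_cast; ring
  have h2 : (1 / 2 : ℝ) ≤ Real.log 2 := by linarith [Real.log_two_gt_d9]
  have hb : Real.logb 2 (1 / (Real.exp (-β) * ε ^ 2)) ≤ 4 * (Real.log (1 / ε) + β) := by
    rw [Real.logb, hlog, div_le_iff₀ (by linarith)]
    nlinarith
  have hb0 : 0 ≤ Real.logb 2 (1 / (Real.exp (-β) * ε ^ 2)) := by
    rw [Real.logb, hlog]
    exact div_nonneg (by linarith) (by linarith)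
  have := (Nat.ceil_lt_add_one hb0).le
  rw [repetitions]
  linarith

/-- If 32β ≤ ε the registers are empty and the count 2^n - 1 vanishes; this is why the bound can
scale with β/ε even for tiny β. Otherwise log(1/ε) ≥ 1 - ε together with β > ε/32 gives the lower
bound 1/32 needed for k. -/
theorem two_pow_precisionQubits_sub_one_mul_repetitions_le {ε : ℝ} (hβ : 0 < β) (hε : 0 < ε)
    (hε1 : ε < 1) :
    (repetitions (Real.exp (-β) * ε ^ 2) : ℝ) * (2 ^ precisionQubits (ε / (32 * β)) - 1) ≤
      2304 * (β / ε * (Real.log (1 / ε) + β)) := by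
  have hl : 0 ≤ Real.log (1 / ε) := Real.log_nonneg (one_le_one_div hε hε1.le)
  have hβε : 0 < β / ε := div_pos hβ hε
  have hx : 1 / (ε / (32 * β)) = 32 * (β / ε) := by field_simp
  rcases le_or_gt (1 / (ε / (32 * β))) 1 with h | h
  · have hn : precisionQubits (ε / (32 * β)) = 0 := by
      rw [precisionQubits, Nat.ceil_eq_zero]
      exact Real.logb_nonpos one_lt_two (by positivity) h
    rw [hn]
    simp only [pow_zero, sub_self, mul_zero]
    positivity
  · have hn := two_pow_ceil_logb_le h.le
    rw [← precisionQubits, hx] at hn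
    have hβ32 : ε < 32 * β := by
      rw [hx, ← mul_div_assoc, one_lt_div hε] at h
      exact h
    have hlog : 1 - ε ≤ Real.log (1 / ε) := by
      have := Real.log_le_sub_one_of_pos hε
      rw [one_div, Real.log_inv]
      linarith
    have hk := repetitions_le hβ hε hε1 (by linarith)
    have hn1 : (1 : ℝ) ≤ 2 ^ precisionQubits (ε / (32 * β)) := one_le_pow₀ (by norm_num)
    calc (repetitions (Real.exp (-β) * ε ^ 2) : ℝ) * (2 ^ precisionQubits (ε / (32 * β)) - 1)
        ≤ (36 * (Real.log (1 / ε) + β)) * (2 * (32 * (β / ε))) :=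
          mul_le_mul hk (by linarith) (by linarith) (by linarith)
      _ = _ := by ring

theorem expectedQueries_le_sqrt {U : Matrix (Fin D) (Fin D) ℂ} {φ ε W Z : ℝ} (hβ : 0 < β)
    (hε : 0 < ε) (hε1 : ε < 1) (h0 : 0 < φ) (h1 : φ ≤ Real.pi / 2) (hD : 0 < D) (hZ : 0 < Z)
    (hWZ : Z ≤ 4 * W) (hsin : Real.sin φ = √(W / D))
    (hsucc : ∀ j : ℕ, successProb (precisionQubits (ε / (32 * β)))
      (repetitions (Real.exp (-β) * ε ^ 2)) U β j = Real.sin ((2 * j + 1) * φ) ^ 2) :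
    expectedQueries D (precisionQubits (ε / (32 * β))) (repetitions (Real.exp (-β) * ε ^ 2)) U β ≤
      ENNReal.ofReal (165888 * √(D / Z) * (β / ε) * (Real.log (1 / ε) + β)) := by
  refine (expectedQueries_le h0 h1 hsucc).trans (ENNReal.ofReal_le_ofReal ?_)
  have hDr : (0 : ℝ) < D := by exact_mod_cast hD
  have hW : 0 < W := by linarith
  have hr : 36 / Real.sin φ ≤ 72 * √(D / Z) := by
    have h4 : √((D : ℝ) / W) ≤ 2 * √(D / Z) := by
      rw [Real.sqrt_le_left (by positivity), mul_pow, Real.sq_sqrt (by positivity),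
        ← mul_div_assoc, div_le_div_iff₀ hW hZ]
      nlinarith
    rw [hsin, div_eq_mul_inv, ← Real.sqrt_inv, inv_div]
    linarith
  have hl : 0 ≤ Real.log (1 / ε) := Real.log_nonneg (one_le_one_div hε hε1.le)
  calc 36 / Real.sin φ * (repetitions (Real.exp (-β) * ε ^ 2) *
        (2 ^ precisionQubits (ε / (32 * β)) - 1))
      ≤ 72 * √(D / Z) * (2304 * (β / ε * (Real.log (1 / ε) + β))) :=
        mul_le_mul hr (two_pow_precisionQubits_sub_one_mul_repetitions_le hβ hε hε1)
          (mul_nonneg (Nat.cast_nonneg _) (sub_nonneg.2 (one_le_pow₀ (by norm_num))))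
          (by positivity)
    _ = _ := by ring

end Main

/-! ### Assembling accuracy and cost. -/

section Reduction

open scoped Matrix.Norms.L2Operator

variable {D : ℕ}

theorem IsSimulationConstant.mono {κ κ' : ℝ} (h : IsSimulationConstant κ) (hκ : κ ≤ κ') :
    IsSimulationConstant κ' := by
  intro D H V δ hH hV hδ
  obtain ⟨H', h1, h2, h3⟩ := h D H V δ hH hV hδ
  exact ⟨H', h1, h2, h3.trans (mul_le_mul_of_nonneg_right hκ ((norm_nonneg _).trans hδ))⟩

theorem exists_isOutput_and_expectedQueries_le [NeZero D] {H H' : Matrix (Fin D) (Fin D) ℂ}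
    {β ε η : ℝ} (hH : IsScaledHamiltonian H) (hH' : H'.IsHermitian) (hβ : 0 < β) (hε : 0 < ε)
    (hε1 : ε < 1) (hη0 : 0 ≤ η) (hη : opNorm (H - H') ≤ η) (hηε : β * η ≤ 0.0001 * ε ^ 2) :
    (∃ ρ : Matrix (Fin D) (Fin D) ℂ,
      IsOutput (precisionQubits (ε / (32 * β))) (repetitions (Real.exp (-β) * ε ^ 2))
        (evolution H') β ρ ∧ traceDist (gibbsState H β) ρ ≤ ε) ∧
    expectedQueries D (precisionQubits (ε / (32 * β))) (repetitions (Real.exp (-β) * ε ^ 2))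
      (evolution H') β ≤ ENNReal.ofReal
        (165888 * √(D / partitionFunction H β) * (β / ε) * (Real.log (1 / ε) + β)) := by
  obtain ⟨hHh, hspec⟩ := hH
  obtain ⟨P, hP, h, hh, rfl⟩ : ∃ P ∈ Matrix.unitaryGroup (Fin D) ℂ, ∃ h : Fin D → ℝ,
      (∀ a, h a ∈ Set.Icc (0 : ℝ) (Real.pi / 4)) ∧ H = udiag P fun i => (h i : ℂ) :=
    ⟨_, hHh.eigenvectorUnitary.2, _, hspec, eq_udiag_eigenvalues hHh⟩
  obtain ⟨Q, hQ, θ, rfl⟩ : ∃ Q ∈ Matrix.unitaryGroup (Fin D) ℂ, ∃ θ : Fin D → ℝ,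
      H' = udiag Q fun i => (θ i : ℂ) :=
    ⟨_, hH'.eigenvectorUnitary.2, _, eq_udiag_eigenvalues hH'⟩
  rw [opNorm_eq_norm] at hη
  -- Stability of the spectrum: the energies of H' may leave [0, π/4], but by at most η.
  have hθ : ∀ j, -η ≤ θ j ∧ θ j ≤ Real.pi / 4 + η := fun j => by
    obtain ⟨i, hi⟩ := exists_norm_sub_le_of_norm_udiag_sub_le hP hQ
      (fun i => (h i : ℂ)) (fun i => (θ i : ℂ)) j
    have := hi.trans hη
    rw [← Complex.ofReal_sub, Complex.norm_real, Real.norm_eq_abs, abs_le] at this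
    obtain ⟨h3, h4⟩ := hh i
    constructor <;> linarith
  obtain ⟨L, U, hL, hU, hLU, hw⟩ := exists_weight_bounds hβ hε hε1 hη0 hηε
  obtain ⟨φ, h0, h1, hsin, hsucc, hout⟩ := exists_successProb_eq
    (n := precisionQubits (ε / (32 * β))) (k := repetitions (Real.exp (-β) * ε ^ 2))
    hQ θ hβ.le (evolution_udiag hQ θ)
  set w : Fin D → ℝ := fun j =>
    weight (precisionQubits (ε / (32 * β))) (repetitions (Real.exp (-β) * ε ^ 2)) β (θ j) with hwdef
  have hw0 : ∀ j, 0 < w j := fun j => weight_pos hβ.le _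
  have hlow : ∀ j, L * Real.exp (-β * θ j) ≤ w j := fun j => (hw _ (hθ j).1 (hθ j).2).1
  have hup : ∀ j, w j ≤ U * Real.exp (-β * θ j) := fun j => (hw _ (hθ j).1 (hθ j).2).2
  have hws : 0 < ∑ j, w j := Finset.sum_pos (fun j _ => hw0 j) Finset.univ_nonempty
  have hD : 0 < D := NeZero.pos D
  refine ⟨⟨udiag Q fun j => ((w j / ∑ i, w i : ℝ) : ℂ),
    isOutput_of_attemptOutput h0 h1 (posSemidef_udiag Q fun j => (div_pos (hw0 j) hws).le)
      ?_ hsucc hout, ?_⟩, ?_⟩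
  · rw [udiag_trace hQ, ← Complex.ofReal_sum, ← Finset.sum_div, div_self hws.ne', Complex.ofReal_one]
  · refine (traceDist_gibbsState_udiag_le hP hQ hD hβ.le hη (by linarith) hU hws hlow hup).trans ?_
    have hs : √(β * η / 2) ≤ 0.01 * ε := by
      rw [Real.sqrt_le_left (by positivity)]
      nlinarith [mul_nonneg hβ.le hη0]
    linarith
  · have hZ : 0 < ∑ i, Real.exp (-β * h i) :=
      Finset.sum_pos (fun i _ => Real.exp_pos _) Finset.univ_nonempty
    rw [partitionFunction_udiag hP]
    refine expectedQueries_le_sqrt hβ hε hε1 h0 h1 hD hZ ?_ hsin hsucc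
    -- W is at least 0.4 times the partition function of H', which is at least 0.9 times that of H;
    -- since 0.36 ≥ 1/4 this gives Z ≤ 4W.
    have h2 := exp_mul_sum_exp_le hP hQ hβ.le hη
    have h3 : (0.9 : ℝ) ≤ Real.exp (-(β * η)) := by
      have := Real.add_one_le_exp (-(β * η))
      nlinarith
    have h4 : L * ∑ j, Real.exp (-β * θ j) ≤ ∑ j, w j := by
      rw [Finset.mul_sum]
      exact Finset.sum_le_sum fun j _ => hlow j
    have h5 : 0.9 * ∑ i, Real.exp (-β * h i) ≤ ∑ j, Real.exp (-β * θ j) :=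
      (mul_le_mul_of_nonneg_right h3 hZ.le).trans h2
    have h6 : 0.4 * ∑ j, Real.exp (-β * θ j) ≤ ∑ j, w j :=
      (mul_le_mul_of_nonneg_right hL (by linarith)).trans h4
    linarith

end Reduction

end GibbsPrep

theorem mainTheorem1 :
    ∃ κ > (0 : ℝ), GibbsPrep.IsSimulationConstant κ ∧ ∃ C > (0 : ℝ),
      ∀ (D : ℕ) [NeZero D] (H Usim : Matrix (Fin D) (Fin D) ℂ) (β ε εsim εprec εfail : ℝ),
        GibbsPrep.IsScaledHamiltonian H →
        Usim ∈ Matrix.unitaryGroup (Fin D) ℂ →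
        0 < β → 0 < ε → ε < 1 →
        GibbsPrep.opNorm (GibbsPrep.evolution H - Usim) ≤ εsim →
        εsim ≤ ε ^ 2 / (8 * β * κ) →
        εprec = ε / (32 * β) →
        εfail = Real.exp (-β) * ε ^ 2 →
        (∃ ρ : Matrix (Fin D) (Fin D) ℂ,
          GibbsPrep.IsOutput (GibbsPrep.precisionQubits εprec) (GibbsPrep.repetitions εfail)
            Usim β ρ ∧
          GibbsPrep.traceDist (GibbsPrep.gibbsState H β) ρ ≤ ε) ∧
        GibbsPrep.expectedQueries D (GibbsPrep.precisionQubits εprec)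
            (GibbsPrep.repetitions εfail) Usim β ≤
          ENNReal.ofReal
            (C * Real.sqrt (D / GibbsPrep.partitionFunction H β) * (β / ε) *
              (Real.log (1 / ε) + β)) := by
  obtain ⟨κ, hκ0, hκ⟩ := GibbsPrep.exists_simulationConstant
  -- Enlarging a simulation constant keeps it valid and tightens the hypothesis on ε_sim: with 8 ·
  -- 1250 = 10⁴ it yields βη ≤ 10⁻⁴ ε² for η = κ ε_sim.
  refine ⟨1250 * κ, by positivity, hκ.mono (by linarith), 165888, by norm_num, ?_⟩
  rintro D _ H Usim β ε εsim _ _ hH hU hβ hε hε1 hsim hbound rfl rfl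
  obtain ⟨H', hH', rfl, hη⟩ := hκ D H Usim εsim hH hU hsim
  have hsim0 : 0 ≤ εsim := (norm_nonneg _).trans hsim
  refine GibbsPrep.exists_isOutput_and_expectedQueries_le hH hH' hβ hε hε1
    (mul_nonneg hκ0.le hsim0) hη ?_
  rw [le_div_iff₀ (by positivity)] at hbound
  linarith
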